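/- Let $p$ be an odd prime, $G=\mathrm{SL}(2,p)$, and let $U\le G$ be the subgroup of upper triangular matrices. Fix a generator $\lambda$ of $\mathbb F_p^{*}$, a non-square $t\in\mathbb F_p$, an element $f\in G$ of order $p+1$, and primitive roots of unity $\zeta,\sigma,\eta\in\mathbb C$ of orders $p-1$, $p+1$, $p$. Put $a=\begin{pmatrix}\lambda&0\\0&\lambda^{-1}\end{pmatrix}$, $b=\begin{pmatrix}1&1\\0&1\end{pmatrix}$, $d=\begin{pmatrix}1&t\\0&1\end{pmatrix}$, and for $x\in\mathbb F_p$ put $P(x)=\sum_{l=0}^{(p-3)/2}\eta^{x\lambda^{2l}}$, $Z=P(1)$, $Z^{(t)}=P(t)$. Functions on $U$: for an integer $k$, $\chi_{0,k}$ is the linear character with $\chi_{0,k}(a)=\zeta^k$, $\chi_{0,k}(b)=1$; for $k\in\{1,2\}$, with $s_1=1$, $s_2=t$, the function $\chi_{i,k}$ ($i=1,2$) vanishes off $\langle -1,b\rangle$ and satisfies $\chi_{i,k}((-1)^\nu b^\tau)=(-1)^{\nu k}P(s_i\tau)$. Class functions on $G$ (given by their values on the class representatives; $1\le l\le\frac{p-3}2$,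 $1\le m\le\frac{p-1}2$): $$\begin{array}{c|cccccccc} &1&-1&b&d&-b&-d&a^l&f^m\\ \hline 1_G&1&1&1&1&1&1&1&1\\ \varphi&p&p&0&0&0&0&1&-1\\ \chi_i&p+1&(-1)^i(p+1)&1&1&(-1)^i&(-1)^i&\zeta^{il}+\zeta^{-il}&0\\ \theta_j&p-1&(-1)^j(p-1)&-1&-1&(-1)^{j+1}&(-1)^{j+1}&0&-(\sigma^{jm}+\sigma^{-jm})\\ \xi_1&\frac{p+1}2&\frac{p+1}2&-Z^{(t)}&-Z&-Z^{(t)}&-Z&(-1)^l&0\\ \xi_2&\frac{p+1}2&\frac{p+1}2&-Z&-Z^{(t)}&-Z&-Z^{(t)}&(-1)^l&0\\ \eta_1&\frac{p-1}2&-\frac{p-1}2&Z&Z^{(t)}&-Z&-Z^{(t)}&0&(-1)^{m+1}\\ \eta_2&\frac{p-1}2&-\frac{p-1}2&Z^{(t)}&Z&-Z^{(t)}&-Z&0&(-1)^{m+1}\\ \xi_1'&\frac{p+1}2&-\frac{p+1}2&-Z^{(t)}&-Z&Z^{(t)}&Z&(-1)^l&0\\ \xi_2'&\frac{p+1}2&-\frac{p+1}2&-Z&-Z^{(t)}&Z&Z^{(t)}&(-1)^l&0\\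 \eta_1'&\frac{p-1}2&\frac{p-1}2&Z&Z^{(t)}&Z&Z^{(t)}&0&(-1)^{m+1}\\ \eta_2'&\frac{p-1}2&\frac{p-1}2&Z^{(t)}&Z&Z^{(t)}&Z&0&(-1)^{m+1} \end{array}$$ Here $1\le i\le\frac{p-3}2$ and $1\le j\le\frac{p-1}2$; the rows $\xi_k,\eta_k$ are used for $p\equiv1\pmod 4$ and the rows $\xi_k',\eta_k'$ for $p\equiv3\pmod 4$. Then the irreducible complex characters of $G$ are exactly $1_G$, $\varphi$, the $\chi_i$, the $\theta_j$, together with $\xi_1,\xi_2,\eta_1,\eta_2$ if $p\equiv1\pmod4$, and with $\xi_1',\xi_2',\eta_1',\eta_2'$ if $p\equiv3\pmod4$. The functions $1_U$, $\chi_{0,k}$ ($1\le k\le p-2$), $\chi_{1,1},\chi_{1,2},\chi_{2,1},\chi_{2,2}$ are pairwise distinct irreducible characters of $U$. The restrictions to $U$ are: 1. $1_G|_U=1_U$; 2. $\varphi|_U=1_U+\chi_{1,2}+\chi_{2,2}$; 3. $\chi_i|_U=\chi_{0,i}+\chi_{0,p-1-i}+\chi_{1,1}+\chi_{2,1}$ for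 $i$ odd, and $\chi_i|_U=\chi_{0,i}+\chi_{0,p-1-i}+\chi_{1,2}+\chi_{2,2}$ for $i$ even; 4. $\theta_j|_U=\chi_{1,1}+\chi_{2,1}$ for $j$ odd, and $\theta_j|_U=\chi_{1,2}+\chi_{2,2}$ for $j$ even; 5. if $p\equiv1\pmod4$: $\xi_1|_U=\chi_{0,(p-1)/2}+\chi_{1,2}$, $\xi_2|_U=\chi_{0,(p-1)/2}+\chi_{2,2}$, $\eta_1|_U=\chi_{1,1}$, $\eta_2|_U=\chi_{2,1}$; 6. if $p\equiv3\pmod4$: $\xi_1'|_U=\chi_{0,(p-1)/2}+\chi_{1,1}$, $\xi_2'|_U=\chi_{0,(p-1)/2}+\chi_{2,1}$, $\eta_1'|_U=\chi_{1,2}$, $\eta_2'|_U=\chi_{2,2}$. Consequently $(G,U)$ is a strong Gelfand pair: $\langle\chi,\psi\uparrow^G\rangle\le1$ for all irreducible characters $\chi$ of $G$ and $\psi$ of $U$. -/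

import Mathlib

open scoped ComplexOrder

noncomputable section

namespace StrongGelfand

open scoped Classical in
/-- The class function `ψ ↑ G` induced from a (class) function `ψ` on the subgroup `H`. -/
def induced {G : Type*} [Group G] [Fintype G] (H : Subgroup G) (ψ : H → ℂ) (g : G) : ℂ :=
  (Nat.card H : ℂ)⁻¹ * ∑ x : G, if h : x⁻¹ * g * x ∈ H then ψ ⟨x⁻¹ * g * x, h⟩ else 0

/-- The usual Hermitian inner product of complex functions on a finite group. -/
def charInner {G : Type*} [Group G] [Fintype G] (χ ψ : G → ℂ) : ℂ :=
  (Nat.card G : ℂ)⁻¹ * ∑ g : G, χ g * (starRingEnd ℂ) (ψ g)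

/-- `χ` is the character of an irreducible finite-dimensional complex representation of `G`. -/
def IsIrrChar {G : Type*} [Group G] (χ : G → ℂ) : Prop :=
  ∃ (V : Type) (_ : AddCommGroup V) (_ : Module ℂ V) (_ : FiniteDimensional ℂ V)
    (ρ : Representation ℂ G V), ρ.IsIrreducible ∧ ρ.character = χ

/-- `(G, H)` is a strong Gelfand pair: `⟨χ, ψ ↑ G⟩ ≤ 1` for all irreducible characters
`χ` of `G` and `ψ` of `H` (in particular the inner product is real). -/
def IsStrongGelfandPair {G : Type*} [Group G] [Fintype G] (H : Subgroup G) : Prop :=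
  ∀ (χ : G → ℂ) (ψ : H → ℂ), IsIrrChar χ → IsIrrChar ψ → charInner χ (induced H ψ) ≤ 1

/-- Restriction of a function on `G` to the subgroup `H`. -/
def res {G : Type*} [Group G] (H : Subgroup G) (χ : G → ℂ) : H → ℂ := fun u => χ u

/-- `SL(2,p)`. -/
abbrev SL2 (p : ℕ) : Type := Matrix.SpecialLinearGroup (Fin 2) (ZMod p)

/-- The subgroup `U` of upper triangular matrices in `SL(2,p)`. -/
def U (p : ℕ) : Subgroup (SL2 p) where
  carrier := {g | g 1 0 = 0}
  mul_mem' := by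
    intro g h hg hh
    simp only [Set.mem_ofPred_eq] at hg hh ⊢
    simp [Matrix.mul_apply, Fin.sum_univ_two, hg, hh]
  one_mem' := by simp
  inv_mem' := by
    intro g hg
    simp only [Set.mem_ofPred_eq] at hg ⊢
    simp [Matrix.SpecialLinearGroup.SL2_inv_expl, hg]

/-- The choices that the naming of the conjugacy classes and of the characters depends on. -/
structure Choices (p : ℕ) where
  /-- a generator of the multiplicative group of the field with `p` elements -/
  lam : (ZMod p)ˣ
  lam_generates : ∀ x : (ZMod p)ˣ, x ∈ Subgroup.zpowers lam
  /-- a non-square mod `p` -/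
  t : ZMod p
  t_nonsquare : ¬ IsSquare t
  /-- an element of order `p + 1` -/
  f : SL2 p
  f_order : orderOf f = p + 1
  /-- a primitive `(p - 1)`-th root of unity -/
  zeta : ℂ
  zeta_primitive : IsPrimitiveRoot zeta (p - 1)
  /-- a primitive `(p + 1)`-th root of unity -/
  sigma : ℂ
  sigma_primitive : IsPrimitiveRoot sigma (p + 1)
  /-- a primitive `p`-th root of unity -/
  eta : ℂ
  eta_primitive : IsPrimitiveRoot eta p

/-- A row of the character table of `SL(2,p)`: the values at `1, -1, b, d, -b, -d`, at `a ^ l`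
for `1 ≤ l ≤ (p - 3) / 2`, and at `f ^ m` for `1 ≤ m ≤ (p - 1) / 2`. -/
structure Row where
  one : ℂ
  negOne : ℂ
  b : ℂ
  d : ℂ
  negB : ℂ
  negD : ℂ
  a : ℕ → ℂ
  f : ℕ → ℂ

namespace Choices

variable {p : ℕ} (D : Choices p)

/-- `diag(lam, lam⁻¹)`. -/
def a : SL2 p := ⟨!![(D.lam : ZMod p), 0; 0, ((D.lam⁻¹ : (ZMod p)ˣ) : ZMod p)], by
  simp [Matrix.det_fin_two]⟩

/-- The matrix with rows `(1, 1)` and `(0, 1)`. -/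
def b (_D : Choices p) : SL2 p := ⟨!![1, 1; 0, 1], by simp [Matrix.det_fin_two]⟩

/-- The matrix with rows `(1, t)` and `(0, 1)`. -/
def d : SL2 p := ⟨!![1, D.t; 0, 1], by simp [Matrix.det_fin_two]⟩

/-- The sum of `eta ^ (x * lam ^ (2 * l))` over `0 ≤ l ≤ (p - 3) / 2`. -/
def gaussPeriod (x : ZMod p) : ℂ :=
  ∑ l ∈ Finset.range ((p - 1) / 2), D.eta ^ (x * (D.lam : ZMod p) ^ (2 * l)).val

/-- `Z`. -/
def Z : ℂ := D.gaussPeriod 1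

/-- `Z^{(t)}`. -/
def Zt : ℂ := D.gaussPeriod D.t

/-! ### Characters of `U` -/

open scoped Classical in
/-- The linear character of `U` which is trivial on `b` and sends `a` to `zeta ^ k`: a matrix with
upper left entry `lam ^ j` is sent to `zeta ^ (k * j)`. -/
def chiLin (k : ℕ) (u : U p) : ℂ :=
  if h : ∃ j : ℕ, (D.lam : ZMod p) ^ j = u.1 0 0 then D.zeta ^ (k * Nat.find h) else 0

open scoped Classical in
/-- The character of `U` induced from the linear character `(-1)^ν b^τ ↦ (-1)^(ν k) eta^(s τ)` of
the subgroup generated by `-1` and `b`. It vanishes off that subgroup. -/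
def chiInd (s : ZMod p) (k : ℕ) (u : U p) : ℂ :=
  if u.1 0 0 = 1 then D.gaussPeriod (s * u.1 0 1)
  else if u.1 0 0 = -1 then (-1) ^ k * D.gaussPeriod (s * -u.1 0 1)
  else 0

/-- `χ_{1,k}`. -/
def chiOne (k : ℕ) : U p → ℂ := D.chiInd 1 k

/-- `χ_{2,k}`. -/
def chiTwo (k : ℕ) : U p → ℂ := D.chiInd D.t k

/-! ### Characters of `SL(2,p)` -/

open scoped Classical in
/-- The class function on `SL(2,p)` (`p` odd) with the values prescribed by a row of the table. -/
def ofRow (r : Row) (g : SL2 p) : ℂ :=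
  if g = 1 then r.one
  else if g = -1 then r.negOne
  else if IsConj D.b g then r.b
  else if IsConj D.d g then r.d
  else if IsConj (-D.b) g then r.negB
  else if IsConj (-D.d) g then r.negD
  else if h : ∃ l : ℕ, 1 ≤ l ∧ l ≤ (p - 3) / 2 ∧ IsConj (D.a ^ l) g then r.a (Nat.find h)
  else if h : ∃ m : ℕ, 1 ≤ m ∧ m ≤ (p - 1) / 2 ∧ IsConj (D.f ^ m) g then r.f (Nat.find h)
  else 0

/-- `φ`. -/
def phi : SL2 p → ℂ := D.ofRow
  { one := p, negOne := p, b := 0, d := 0, negB := 0, negD := 0,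
    a := fun _ => 1, f := fun _ => -1 }

/-- `χ_i`. -/
def chi (i : ℕ) : SL2 p → ℂ := D.ofRow
  { one := p + 1, negOne := (-1) ^ i * (p + 1), b := 1, d := 1,
    negB := (-1) ^ i, negD := (-1) ^ i,
    a := fun l => D.zeta ^ (i * l) + (D.zeta ^ (i * l))⁻¹, f := fun _ => 0 }

/-- `θ_j`. -/
def theta (j : ℕ) : SL2 p → ℂ := D.ofRow
  { one := p - 1, negOne := (-1) ^ j * (p - 1), b := -1, d := -1,
    negB := (-1) ^ (j + 1), negD := (-1) ^ (j + 1),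
    a := fun _ => 0, f := fun m => -(D.sigma ^ (j * m) + (D.sigma ^ (j * m))⁻¹) }

/-- `ξ_1`, for `p ≡ 1 mod 4`. -/
def xi1 : SL2 p → ℂ := D.ofRow
  { one := (p + 1) / 2, negOne := (p + 1) / 2, b := -D.Zt, d := -D.Z, negB := -D.Zt, negD := -D.Z,
    a := fun l => (-1) ^ l, f := fun _ => 0 }

/-- `ξ_2`, for `p ≡ 1 mod 4`. -/
def xi2 : SL2 p → ℂ := D.ofRow
  { one := (p + 1) / 2, negOne := (p + 1) / 2, b := -D.Z, d := -D.Zt, negB := -D.Z, negD := -D.Zt,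
    a := fun l => (-1) ^ l, f := fun _ => 0 }

/-- `η_1`, for `p ≡ 1 mod 4`. -/
def eta1 : SL2 p → ℂ := D.ofRow
  { one := (p - 1) / 2, negOne := -((p - 1) / 2), b := D.Z, d := D.Zt, negB := -D.Z, negD := -D.Zt,
    a := fun _ => 0, f := fun m => (-1) ^ (m + 1) }

/-- `η_2`, for `p ≡ 1 mod 4`. -/
def eta2 : SL2 p → ℂ := D.ofRow
  { one := (p - 1) / 2, negOne := -((p - 1) / 2), b := D.Zt, d := D.Z, negB := -D.Zt, negD := -D.Z,
    a := fun _ => 0, f := fun m => (-1) ^ (m + 1) }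

/-- `ξ_1'`, for `p ≡ 3 mod 4`. -/
def xi1' : SL2 p → ℂ := D.ofRow
  { one := (p + 1) / 2, negOne := -((p + 1) / 2), b := -D.Zt, d := -D.Z, negB := D.Zt, negD := D.Z,
    a := fun l => (-1) ^ l, f := fun _ => 0 }

/-- `ξ_2'`, for `p ≡ 3 mod 4`. -/
def xi2' : SL2 p → ℂ := D.ofRow
  { one := (p + 1) / 2, negOne := -((p + 1) / 2), b := -D.Z, d := -D.Zt, negB := D.Z, negD := D.Zt,
    a := fun l => (-1) ^ l, f := fun _ => 0 }

/-- `η_1'`, for `p ≡ 3 mod 4`. -/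
def eta1' : SL2 p → ℂ := D.ofRow
  { one := (p - 1) / 2, negOne := (p - 1) / 2, b := D.Z, d := D.Zt, negB := D.Z, negD := D.Zt,
    a := fun _ => 0, f := fun m => (-1) ^ (m + 1) }

/-- `η_2'`, for `p ≡ 3 mod 4`. -/
def eta2' : SL2 p → ℂ := D.ofRow
  { one := (p - 1) / 2, negOne := (p - 1) / 2, b := D.Zt, d := D.Z, negB := D.Zt, negD := D.Z,
    a := fun _ => 0, f := fun m => (-1) ^ (m + 1) }

end Choices

end StrongGelfand

end

/-!
# The character table of `SL(2,p)` and its restriction to the upper triangular subgroup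

Every irreducible character of `G = SL(2,p)` is obtained, as a virtual character, from characters
induced from `U` and from the nonsplit torus `T = ⟨f⟩`, so that its restriction to `U` is known by
construction. A class function with integral inner products with the irreducible characters, norm
one and nonnegative degree is an irreducible character (`IsVirtualChar.isIrrChar`), and all the
norms needed come from Frobenius reciprocity (`charInner_induced`). Write `N = (p - 1) / 2`.

* On `U`, the functions `chiInd s k` are induced from linear characters of `⟨-1, b⟩`; together with
  the linear characters `chiLin i` they exhaust the regular character (`regular_decomposition`).
* The principal series `Ind_U^G (chiLin i)` is irreducible for `1 ≤ i < N`, and `Ind_U^G 1 - 1` is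
  the Steinberg character.
* The discrete series is the virtual character
  `Ind_U^G (chiInd 1 j) + Ind_U^G (chiInd t j) - Ind_T^G (sigma ^ j)`, whose norm is computed from
  its restrictions to `U` and to `T`.
* Removing from the Gelfand-Graev character `Ind_U^G (chiInd s k)` all the constituents of the
  previous kinds leaves a virtual character of norm one, `remainder s k`. These are the four
  exceptional characters, of degree `N` or `N + 1`.

The list is complete because every constituent of the regular character of `U` induces a sum of
listed characters (`isIrrChar_iff_isListed`). The characters are then identified with the rows of
the table by evaluating them on the representatives `±1`, `±b`, `±d`, `a ^ l`, `f ^ m`: a matrix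
which is not `±1` is conjugate to a power of `a` or of `f` if `tr ^ 2 ≠ 4`, since the traces of
these powers exhaust the prime field, and to one of `±b`, `±d` otherwise (`conj_cases`). Finally the
restrictions to `U` are sums of distinct irreducible characters, which is the strong Gelfand
property.
-/

noncomputable section

namespace StrongGelfand

section General

variable {G : Type} [Group G] [Fintype G]

lemma card_ne_zero' : (Nat.card G : ℂ) ≠ 0 := by
  exact_mod_cast Nat.card_pos.ne'

/-! ### Complex conjugation of characters -/

/-- The positive definite form `∑ h, (M h)ᴴ * M h` is invariant under the representation, so that
`M g⁻¹` is conjugate to `(M g)ᴴ`. -/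
theorem character_inv {V : Type*} [AddCommGroup V] [Module ℂ V] [FiniteDimensional ℂ V]
    (ρ : Representation ℂ G V) (g : G) :
    ρ.character g⁻¹ = (starRingEnd ℂ) (ρ.character g) := by
  classical
  let b := Module.finBasis ℂ V
  let M : G → Matrix _ _ ℂ := fun h => LinearMap.toMatrix b b (ρ h)
  have hM : ∀ x y, M (x * y) = M x * M y := fun x y => by
    simp only [M, map_mul, Module.End.mul_eq_comp, LinearMap.toMatrix_comp b b b]
  have hM1 : M 1 = 1 := by simp [M]
  have htr : ∀ h, ρ.character h = (M h).trace := fun h => by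
    rw [Representation.character, LinearMap.trace_eq_matrix_trace ℂ b]
  let P : Matrix _ _ ℂ := ∑ h : G, (M h).conjTranspose * M h
  have hP : P.PosDef := by
    have h1 : ∀ h ∈ (Finset.univ : Finset G), ((M h).conjTranspose * M h).PosDef := by
      intro h _
      apply Matrix.PosDef.conjTranspose_mul_self
      apply Matrix.mulVec_injective_of_isUnit
      refine IsUnit.of_mul_eq_one (M h⁻¹) ?_
      rw [← hM, mul_inv_cancel, hM1]
    exact Matrix.posDef_sum ⟨1, Finset.mem_univ _⟩ h1
  have hinv : (M g).conjTranspose * P * M g = P := by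
    simp only [P, Finset.mul_sum, Finset.sum_mul]
    refine Fintype.sum_equiv (Equiv.mulRight g) _ _ fun h => ?_
    simp only [Equiv.coe_mulRight, hM, Matrix.conjTranspose_mul, Matrix.mul_assoc]
  have hPu : IsUnit P.det := (Matrix.isUnit_iff_isUnit_det _).1 hP.isUnit
  have hinv2 : (M g).conjTranspose * P = P * M g⁻¹ := by
    have : (M g).conjTranspose * P * M g * M g⁻¹ = P * M g⁻¹ := by rw [hinv]
    rwa [Matrix.mul_assoc, ← hM, mul_inv_cancel, hM1, Matrix.mul_one] at this
  have h3 : M g⁻¹ = P⁻¹ * ((M g).conjTranspose * P) := by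
    rw [hinv2, ← Matrix.mul_assoc, Matrix.nonsing_inv_mul _ hPu, Matrix.one_mul]
  rw [htr, htr, h3, Matrix.trace_mul_comm, Matrix.mul_assoc, Matrix.mul_nonsing_inv _ hPu,
    Matrix.mul_one, Matrix.trace_conjTranspose]
  rfl

/-! ### The inner product -/

lemma charInner_add_left (X X' Y : G → ℂ) :
    charInner (X + X') Y = charInner X Y + charInner X' Y := by
  simp [charInner, add_mul, Finset.sum_add_distrib, mul_add]

lemma charInner_smul_left (c : ℂ) (X Y : G → ℂ) :
    charInner (c • X) Y = c * charInner X Y := by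
  simp only [charInner, Pi.smul_apply, smul_eq_mul, mul_assoc, ← Finset.mul_sum]
  ring

lemma charInner_conj (X Y : G → ℂ) :
    charInner Y X = (starRingEnd ℂ) (charInner X Y) := by
  simp [charInner, map_sum, mul_comm]

/-- The inner product with a fixed second argument, as a linear form. -/
def charInnerLeft (Y : G → ℂ) : (G → ℂ) →ₗ[ℂ] ℂ where
  toFun X := charInner X Y
  map_add' X X' := charInner_add_left X X' Y
  map_smul' c X := charInner_smul_left c X Y

lemma charInner_sub_left (X X' Y : G → ℂ) :
    charInner (X - X') Y = charInner X Y - charInner X' Y :=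
  map_sub (charInnerLeft Y) X X'

lemma charInner_sum_left {ι : Type*} (s : Finset ι) (X : ι → G → ℂ) (Y : G → ℂ) :
    charInner (∑ i ∈ s, X i) Y = ∑ i ∈ s, charInner (X i) Y :=
  map_sum (charInnerLeft Y) X s

lemma charInner_zero_left (Y : G → ℂ) : charInner 0 Y = 0 :=
  map_zero (charInnerLeft Y)

lemma charInner_add_right (Y X X' : G → ℂ) :
    charInner Y (X + X') = charInner Y X + charInner Y X' := by
  rw [charInner_conj, charInner_add_left, map_add, ← charInner_conj, ← charInner_conj]

lemma charInner_sub_right (Y X X' : G → ℂ) :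
    charInner Y (X - X') = charInner Y X - charInner Y X' := by
  rw [charInner_conj, charInner_sub_left, map_sub, ← charInner_conj, ← charInner_conj]

lemma charInner_sum_right {ι : Type*} (s : Finset ι) (X : ι → G → ℂ) (Y : G → ℂ) :
    charInner Y (∑ i ∈ s, X i) = ∑ i ∈ s, charInner Y (X i) := by
  rw [charInner_conj, charInner_sum_left, map_sum]
  exact Finset.sum_congr rfl fun i _ => (charInner_conj _ _).symm

/-! ### Irreducible characters -/

omit [Fintype G] in
lemma IsIrrChar.conj {χ : G → ℂ} (h : IsIrrChar χ) (x g : G) : χ (x * g * x⁻¹) = χ g := by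
  obtain ⟨V, _, _, _, ρ, _, rfl⟩ := h
  exact ρ.char_conj g x

omit [Fintype G] in
lemma IsIrrChar.one_apply {χ : G → ℂ} (h : IsIrrChar χ) : ∃ n : ℕ, n ≠ 0 ∧ χ 1 = n := by
  obtain ⟨V, _, _, _, ρ, hρ, rfl⟩ := h
  refine ⟨Module.finrank ℂ V, ?_, ρ.char_one⟩
  have : Nontrivial V := by
    by_contra hV
    rw [not_nontrivial_iff_subsingleton] at hV
    obtain ⟨x, y, hxy⟩ := hρ.toNontrivial
    exact hxy (Subrepresentation.toSubmodule_injective (Subsingleton.elim _ _))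
  exact Module.finrank_pos.ne'

open scoped Classical in
/-- Row orthogonality, for characters rather than for isomorphism classes of representations. -/
theorem IsIrrChar.charInner_eq {χ ψ : G → ℂ} (hχ : IsIrrChar χ) (hψ : IsIrrChar ψ) :
    charInner χ ψ = if χ = ψ then 1 else 0 := by
  obtain ⟨V, _, _, _, ρ, hρ, rfl⟩ := hχ
  obtain ⟨W, _, _, _, σ, hσ, rfl⟩ := hψ
  have : Invertible (Nat.card G : ℂ) := invertibleOfNonzero card_ne_zero'
  have key := Representation.char_orthonormal ρ σ
  simp only [character_inv σ] at key
  change charInner ρ.character σ.character = _ at key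
  rw [key]
  by_cases h : ρ.character = σ.character
  · rw [if_pos h]
    have key2 := Representation.char_orthonormal ρ ρ
    simp only [character_inv ρ] at key2
    rw [if_pos ⟨Representation.Equiv.refl ρ⟩] at key2
    rw [← key, ← h]
    exact key2
  · rw [if_neg h, if_neg]
    rintro ⟨e⟩
    exact h (Representation.char_iso e).symm

lemma IsIrrChar.charInner_self {χ : G → ℂ} (hχ : IsIrrChar χ) : charInner χ χ = 1 := by
  rw [hχ.charInner_eq hχ, if_pos rfl]

lemma IsIrrChar.charInner_ne {χ ψ : G → ℂ} (hχ : IsIrrChar χ) (hψ : IsIrrChar ψ) (h : χ ≠ ψ) :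
    charInner χ ψ = 0 := by
  rw [hχ.charInner_eq hψ, if_neg h]

omit [Fintype G] in
/-- The multiplicity of an irreducible character of `H` in the restriction of a character of `G` is
the dimension of a space of intertwining maps. -/
theorem IsIrrChar.charInner_res {χ : G → ℂ} (hχ : IsIrrChar χ) (H : Subgroup G) [Fintype H]
    {ψ : H → ℂ} (hψ : IsIrrChar ψ) : ∃ n : ℕ, charInner ψ (res H χ) = n := by
  obtain ⟨V, _, _, _, ρ, hρ, rfl⟩ := hχ
  obtain ⟨W, _, _, _, σ, hσ, rfl⟩ := hψ
  have : Invertible (Nat.card H : ℂ) := invertibleOfNonzero card_ne_zero'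
  let τ : Representation ℂ H V := ρ.comp H.subtype
  have hτ : res H ρ.character = τ.character := rfl
  refine ⟨_, Eq.trans ?_ (Representation.card_inv_mul_sum_char_mul_char_eq_finrank τ σ)⟩
  rw [hτ]
  simp only [character_inv τ]
  rfl

/-- A homomorphism to `ℂ` is an irreducible character. -/
theorem isIrrChar_of_hom {H : Type} [Group H] (f : H →* ℂ) : IsIrrChar (f : H → ℂ) := by
  let ρ : Representation ℂ H ℂ :=
    (Algebra.lmul ℂ ℂ : ℂ →* Module.End ℂ ℂ).comp f
  have hρ : ∀ g x, ρ g x = f g * x := fun g x => rfl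
  refine ⟨ℂ, inferInstance, inferInstance, inferInstance, ρ, ?_, ?_⟩
  · have : Nontrivial (Subrepresentation ρ) := ⟨⊥, ⊤, fun h => by
      have : (1 : ℂ) ∈ (⊥ : Subrepresentation ρ).toSubmodule := by
        rw [h]; trivial
      have h1 : (1 : ℂ) = 0 := this
      exact one_ne_zero h1⟩
    refine ⟨fun S => ?_⟩
    rcases eq_bot_or_eq_top S.toSubmodule with h | h
    · left
      exact Subrepresentation.toSubmodule_injective h
    · right
      exact Subrepresentation.toSubmodule_injective h
  · ext g
    have : ρ g = f g • LinearMap.id := by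
      ext; simp [hρ]
    rw [Representation.character, this, map_smul]
    simp

/-! ### Class functions and virtual characters -/

/-- Functions which are constant on conjugacy classes. -/
def IsClassFun {G : Type*} [Group G] (X : G → ℂ) : Prop := ∀ x g, X (x * g * x⁻¹) = X g

section
omit [Fintype G]

lemma IsClassFun.apply_eq {X : G → ℂ} (h : IsClassFun X) {g g' : G} (hc : IsConj g g') :
    X g' = X g := by
  obtain ⟨c, rfl⟩ := isConj_iff.1 hc
  exact h c g

lemma IsClassFun.add {X Y : G → ℂ} (hX : IsClassFun X) (hY : IsClassFun Y) :
    IsClassFun (X + Y) := fun x g => by simp [hX x g, hY x g]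

lemma IsClassFun.sub {X Y : G → ℂ} (hX : IsClassFun X) (hY : IsClassFun Y) :
    IsClassFun (X - Y) := fun x g => by simp [hX x g, hY x g]

lemma IsClassFun.smul {X : G → ℂ} (c : ℂ) (hX : IsClassFun X) :
    IsClassFun (c • X) := fun x g => by simp [hX x g]

lemma IsClassFun.sum {ι : Type*} (s : Finset ι) {X : ι → G → ℂ}
    (h : ∀ i ∈ s, IsClassFun (X i)) : IsClassFun (∑ i ∈ s, X i) := fun x g => by
  simp only [Finset.sum_apply]
  exact Finset.sum_congr rfl fun i hi => h i hi x g

lemma IsIrrChar.isClassFun {χ : G → ℂ} (h : IsIrrChar χ) : IsClassFun χ := h.conj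

end

/-- By the lemma of Schur, the central element of the group algebra attached to a class function
acts on an irreducible representation by a scalar, which is the inner product of the class function
with the character up to a nonzero factor. -/
theorem sum_smul_eq_zero_of_orthogonal {X : G → ℂ} (hX : IsClassFun X)
    (h : ∀ χ, IsIrrChar χ → charInner X χ = 0)
    {V : Type} [AddCommGroup V] [Module ℂ V] [FiniteDimensional ℂ V]
    (ρ : Representation ℂ G V) (hρ : ρ.IsIrreducible) :
    ∑ g : G, (starRingEnd ℂ) (X g) • ρ g = 0 := by
  set T : V →ₗ[ℂ] V := ∑ g : G, (starRingEnd ℂ) (X g) • ρ g with hT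
  have hcomm : ∀ x v, T (ρ x v) = ρ x (T v) := by
    intro x v
    simp only [hT, LinearMap.sum_apply, LinearMap.smul_apply, map_sum, map_smul]
    refine Fintype.sum_equiv (MulAut.conj x⁻¹).toEquiv _ _ fun g => ?_
    have h1 : (MulAut.conj x⁻¹).toEquiv g = x⁻¹ * g * x⁻¹⁻¹ := rfl
    rw [h1, hX, ← Module.End.mul_apply, ← Module.End.mul_apply, ← map_mul, ← map_mul]
    have h2 : x * (x⁻¹ * g * x⁻¹⁻¹) = g * x := by group
    rw [h2]
  have hb := Representation.IsIrreducible.algebraMap_intertwiningMap_bijective_of_isAlgClosed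
    (ρ := ρ)
  obtain ⟨c, hc⟩ := hb.2 (LinearMap.intertwiningMap_of_isIntertwiningMap ρ ρ T hcomm)
  have hc' : T = c • LinearMap.id := by
    have := congrArg Representation.IntertwiningMap.toLinearMap hc
    rw [Algebra.algebraMap_eq_smul_one] at this
    ext v
    have := LinearMap.congr_fun this v
    exact this.symm
  have htr : LinearMap.trace ℂ V T = 0 := by
    have h1 := h ρ.character ⟨V, _, _, inferInstance, ρ, hρ, rfl⟩
    have h2 : ∑ g : G, X g * (starRingEnd ℂ) (ρ.character g) = 0 := by
      simpa [charInner] using h1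
    have h3 := congrArg (starRingEnd ℂ) h2
    simpa [hT, map_sum, Representation.character] using h3
  obtain ⟨n, hn, hn1⟩ := IsIrrChar.one_apply (χ := ρ.character) ⟨V, _, _, inferInstance, ρ, hρ, rfl⟩
  rw [Representation.char_one] at hn1
  rw [hc', map_smul, LinearMap.trace_id, hn1, smul_eq_mul] at htr
  have : c = 0 := by simpa [hn] using htr
  rw [hc', this, zero_smul]

omit [Fintype G] in
/-- Simple submodules of the group algebra are irreducible representations. -/
lemma isIrreducible_ofModule' (S : Submodule (MonoidAlgebra ℂ G) (MonoidAlgebra ℂ G))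
    [hS : IsSimpleModule (MonoidAlgebra ℂ G) S] :
    (Representation.ofModule' (k := ℂ) (G := G) S).IsIrreducible := by
  have hact : ∀ (g : G) (v : S), Representation.ofModule' (k := ℂ) (G := G) S g v =
      MonoidAlgebra.of ℂ G g • v := fun g v => rfl
  have hnt : Nontrivial S := IsSimpleModule.nontrivial (MonoidAlgebra ℂ G) S
  have : Nontrivial (Subrepresentation (Representation.ofModule' (k := ℂ) (G := G) S)) :=
    ⟨⊥, ⊤, fun h => by
      obtain ⟨v, hv⟩ := exists_ne (0 : S)
      have : v ∈ (⊥ : Subrepresentation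
        (Representation.ofModule' (k := ℂ) (G := G) S)).toSubmodule := by
        rw [h]; trivial
      exact hv this⟩
  refine ⟨fun W => ?_⟩
  let W' : Submodule (MonoidAlgebra ℂ G) S :=
    { W.toSubmodule.toAddSubmonoid with
      smul_mem' := fun c v hv => by
        induction c using MonoidAlgebra.induction_on with
        | of g => exact W.apply_mem_toSubmodule g hv
        | add a b ha hb =>
          rw [add_smul]
          exact W.toSubmodule.add_mem ha hb
        | smul r a ha =>
          rw [smul_assoc]
          exact W.toSubmodule.smul_mem r ha }
  rcases eq_bot_or_eq_top W' with h | h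
  · left
    refine Subrepresentation.toSubmodule_injective (SetLike.ext fun v => ?_)
    exact SetLike.ext_iff.1 h v
  · right
    refine Subrepresentation.toSubmodule_injective (SetLike.ext fun v => ?_)
    exact SetLike.ext_iff.1 h v

/-- A class function orthogonal to every irreducible character vanishes: the corresponding
central element of the group algebra kills every simple submodule of the group algebra. -/
theorem IsClassFun.eq_zero_of_orthogonal {X : G → ℂ} (hX : IsClassFun X)
    (h : ∀ χ, IsIrrChar χ → charInner X χ = 0) : X = 0 := by
  let z : MonoidAlgebra ℂ G := ∑ g : G, MonoidAlgebra.single g ((starRingEnd ℂ) (X g))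
  have hzc : ∀ y : MonoidAlgebra ℂ G, z * y = y * z := by
    intro y
    induction y using MonoidAlgebra.induction_on with
    | of x =>
      simp only [z, Finset.sum_mul, Finset.mul_sum, MonoidAlgebra.of_apply,
        MonoidAlgebra.single_mul_single, mul_one, one_mul]
      refine Fintype.sum_equiv (MulAut.conj x⁻¹).toEquiv _ _ fun g => ?_
      have h1 : (MulAut.conj x⁻¹).toEquiv g = x⁻¹ * g * x⁻¹⁻¹ := rfl
      rw [h1, hX]
      congr 1
      group
    | add a b ha hb => rw [mul_add, add_mul, ha, hb]
    | smul r a ha => rw [mul_smul_comm, smul_mul_assoc, ha]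
  let K : Submodule (MonoidAlgebra ℂ G) (MonoidAlgebra ℂ G) :=
    { carrier := {m | z * m = 0}
      add_mem' := fun {a b} ha hb => by
        simp only [Set.mem_ofPred_eq] at *
        rw [mul_add, ha, hb, add_zero]
      zero_mem' := mul_zero z
      smul_mem' := fun c m hm => by
        simp only [Set.mem_ofPred_eq, smul_eq_mul] at *
        rw [← mul_assoc, hzc, mul_assoc, hm, mul_zero] }
  have : NeZero (Nat.card G : ℂ) := ⟨card_ne_zero'⟩
  have hK : K = ⊤ := by
    rw [eq_top_iff, ← IsSemisimpleModule.sSup_simples_eq_top]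
    refine sSup_le fun S hS => ?_
    have hS' : IsSimpleModule (MonoidAlgebra ℂ G) S := hS
    have hfin : FiniteDimensional ℂ S := Module.Finite.trans (MonoidAlgebra ℂ G) _
    have h0 := sum_smul_eq_zero_of_orthogonal hX h _ (isIrreducible_ofModule' S)
    intro m hm
    have h1 := LinearMap.congr_fun h0 ⟨m, hm⟩
    have h2 := congrArg Subtype.val h1
    simp only [LinearMap.sum_apply, LinearMap.smul_apply, LinearMap.zero_apply,
      Submodule.coe_sum, ZeroMemClass.coe_zero] at h2
    change ∑ g : G, (starRingEnd ℂ) (X g) • (MonoidAlgebra.of ℂ G g * m) = 0 at h2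
    change z * m = 0
    rw [← h2, Finset.sum_mul]
    refine Finset.sum_congr rfl fun g _ => ?_
    rw [← smul_mul_assoc, MonoidAlgebra.of_apply, MonoidAlgebra.smul_single, smul_eq_mul, mul_one]
  have hz : z = 0 := by
    have : (1 : MonoidAlgebra ℂ G) ∈ K := by rw [hK]; trivial
    have h1 : z * 1 = 0 := this
    rwa [mul_one] at h1
  ext g
  have h1 : z.coeff g = (starRingEnd ℂ) (X g) := by
    classical simp [z, Finsupp.single_apply]
  rw [hz] at h1
  simpa using h1.symm

variable (G) in
lemma finite_isIrrChar : {χ : G → ℂ | IsIrrChar χ}.Finite := by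
  have : LinearIndependent ℂ (Subtype.val : {χ : G → ℂ | IsIrrChar χ} → G → ℂ) := by
    rw [linearIndependent_iff']
    intro s g hg i hi
    have h1 := congrArg (charInnerLeft (i : G → ℂ)) hg
    rw [map_sum, map_zero, Finset.sum_eq_single i] at h1
    · rw [map_smul] at h1
      change g i • charInner i.1 i.1 = 0 at h1
      simpa [i.2.charInner_self] using h1
    · intro j _ hji
      rw [map_smul]
      change g j • charInner j.1 i.1 = 0
      rw [j.2.charInner_ne i.2 (fun h => hji (Subtype.ext h)), smul_zero]
    · exact fun h => absurd hi h
  exact this.setFinite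

/-- A class function is the sum of its components along the irreducible characters. -/
theorem IsClassFun.eq_sum {X : G → ℂ} (hX : IsClassFun X) :
    X = ∑ χ ∈ (finite_isIrrChar G).toFinset, charInner X χ • χ := by
  rw [← sub_eq_zero]
  have hmem : ∀ χ ∈ (finite_isIrrChar G).toFinset, IsIrrChar χ := fun χ h => by simpa using h
  refine IsClassFun.eq_zero_of_orthogonal
    (hX.sub (IsClassFun.sum _ fun χ h => (hmem χ h).isClassFun.smul _)) fun χ hχ => ?_
  rw [charInner_sub_left, charInner_sum_left, Finset.sum_eq_single χ]
  · rw [charInner_smul_left, hχ.charInner_self, mul_one, sub_self]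
  · intro ψ hψ hne
    rw [charInner_smul_left, (hmem ψ hψ).charInner_ne hχ hne, mul_zero]
  · intro h
    simp [hχ] at h

/-- Integral linear combinations of irreducible characters, encoded as the class functions whose
inner products with the irreducible characters are integers. -/
def IsVirtualChar (X : G → ℂ) : Prop :=
  IsClassFun X ∧ ∀ χ, IsIrrChar χ → ∃ n : ℤ, charInner X χ = n

lemma IsIrrChar.isVirtualChar {χ : G → ℂ} (h : IsIrrChar χ) : IsVirtualChar χ := by
  refine ⟨h.isClassFun, fun ψ hψ => ?_⟩
  rw [h.charInner_eq hψ]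
  split_ifs
  exacts [⟨1, by simp⟩, ⟨0, by simp⟩]

lemma IsVirtualChar.add {X Y : G → ℂ} (hX : IsVirtualChar X) (hY : IsVirtualChar Y) :
    IsVirtualChar (X + Y) := by
  refine ⟨hX.1.add hY.1, fun χ hχ => ?_⟩
  obtain ⟨m, hm⟩ := hX.2 χ hχ
  obtain ⟨n, hn⟩ := hY.2 χ hχ
  exact ⟨m + n, by rw [charInner_add_left, hm, hn]; push_cast; rfl⟩

lemma IsVirtualChar.sub {X Y : G → ℂ} (hX : IsVirtualChar X) (hY : IsVirtualChar Y) :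
    IsVirtualChar (X - Y) := by
  refine ⟨hX.1.sub hY.1, fun χ hχ => ?_⟩
  obtain ⟨m, hm⟩ := hX.2 χ hχ
  obtain ⟨n, hn⟩ := hY.2 χ hχ
  exact ⟨m - n, by rw [charInner_sub_left, hm, hn]; push_cast; rfl⟩

lemma IsVirtualChar.sum {ι : Type*} (s : Finset ι) {X : ι → G → ℂ}
    (h : ∀ i ∈ s, IsVirtualChar (X i)) : IsVirtualChar (∑ i ∈ s, X i) := by
  refine ⟨IsClassFun.sum s fun i hi => (h i hi).1, fun χ hχ => ?_⟩
  rw [charInner_sum_left]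
  choose! n hn using fun i hi => (h i hi).2 χ hχ
  exact ⟨∑ i ∈ s, n i, by rw [Finset.sum_congr rfl hn]; push_cast; rfl⟩

/-- A virtual character of norm one and of nonnegative degree is irreducible. -/
theorem IsVirtualChar.isIrrChar {X : G → ℂ} (hX : IsVirtualChar X) (h1 : charInner X X = 1)
    (hpos : 0 ≤ X 1) : IsIrrChar X := by
  classical
  choose! n hn using hX.2
  set s := (finite_isIrrChar G).toFinset
  have hmem : ∀ χ ∈ s, IsIrrChar χ := fun χ h => by simpa [s] using h
  have hsum : X = ∑ χ ∈ s, (n χ : ℂ) • χ := by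
    conv_lhs => rw [hX.1.eq_sum]
    exact Finset.sum_congr rfl fun χ hχ => by rw [hn χ (hmem χ hχ)]
  have hsq : ∑ χ ∈ s, n χ ^ 2 = 1 := by
    have h2 : charInner X X = ∑ χ ∈ s, (n χ : ℂ) ^ 2 := by
      conv_lhs => rw [hsum]
      rw [charInner_sum_left]
      refine Finset.sum_congr rfl fun χ hχ => ?_
      rw [← hsum, charInner_smul_left, charInner_conj X χ, hn χ (hmem χ hχ)]
      simp [sq]
    rw [h1] at h2
    exact_mod_cast h2.symm
  obtain ⟨χ, hχ, hne⟩ : ∃ χ ∈ s, n χ ≠ 0 := by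
    by_contra! hc
    rw [Finset.sum_eq_zero (fun χ hχ => by rw [hc χ hχ]; rfl)] at hsq
    exact zero_ne_one hsq
  rw [← Finset.add_sum_erase s _ hχ] at hsq
  have hge : 1 ≤ n χ ^ 2 := by
    have := sq_pos_of_ne_zero hne
    omega
  have hrest : ∑ ψ ∈ s.erase χ, n ψ ^ 2 = 0 := by
    have := Finset.sum_nonneg (s := s.erase χ) (f := fun ψ => n ψ ^ 2) fun ψ _ => sq_nonneg _
    omega
  have hzero : ∀ ψ ∈ s.erase χ, n ψ = 0 := fun ψ hψ => by
    have := (Finset.sum_eq_zero_iff_of_nonneg (fun ψ _ => sq_nonneg (n ψ))).1 hrest ψ hψ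
    exact pow_eq_zero_iff (two_ne_zero) |>.1 this
  have hX' : X = (n χ : ℂ) • χ := by
    conv_lhs => rw [hsum, ← Finset.add_sum_erase s _ hχ]
    rw [Finset.sum_eq_zero (fun ψ hψ => by rw [hzero ψ hψ]; simp), add_zero]
  have hn1 : n χ ^ 2 = 1 := by omega
  rcases (by simpa using hn1 : n χ = 1 ∨ n χ = -1) with h | h
  · rw [h] at hX'
    rw [hX']
    simpa using hmem χ hχ
  · exfalso
    obtain ⟨d, hd, hd1⟩ := (hmem χ hχ).one_apply
    rw [hX', h] at hpos
    have h3 : (0 : ℂ) ≤ ((-d : ℝ) : ℂ) := by simpa [hd1] using hpos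
    have h4 : (0 : ℝ) ≤ -d := by exact_mod_cast h3
    have : (0 : ℝ) < d := by exact_mod_cast Nat.pos_of_ne_zero hd
    linarith

/-! ### Induction -/

open scoped Classical in
/-- The extension by zero to `G` of a function on the subgroup `H`. -/
def extendZero {G : Type*} [Group G] (H : Subgroup G) (ψ : H → ℂ) (g : G) : ℂ :=
  if h : g ∈ H then ψ ⟨g, h⟩ else 0

omit [Fintype G] in
lemma extendZero_of_mem (H : Subgroup G) (ψ : H → ℂ) {g : G} (h : g ∈ H) :
    extendZero H ψ g = ψ ⟨g, h⟩ := dif_pos h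

omit [Fintype G] in
lemma extendZero_of_notMem (H : Subgroup G) (ψ : H → ℂ) {g : G} (h : g ∉ H) :
    extendZero H ψ g = 0 := dif_neg h

lemma induced_apply (H : Subgroup G) (ψ : H → ℂ) (g : G) :
    induced H ψ g = (Nat.card H : ℂ)⁻¹ * ∑ x : G, extendZero H ψ (x⁻¹ * g * x) := rfl

lemma isClassFun_induced (H : Subgroup G) (ψ : H → ℂ) : IsClassFun (induced H ψ) := by
  intro y g
  rw [induced_apply, induced_apply]
  congr 1
  refine Fintype.sum_equiv (Equiv.mulLeft y⁻¹) _ _ fun x => ?_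
  have : x⁻¹ * (y * g * y⁻¹) * x = (y⁻¹ * x)⁻¹ * g * (y⁻¹ * x) := by group
  rw [Equiv.coe_mulLeft, this]

lemma sum_extendZero_mul (H : Subgroup G) [Fintype H] (ψ : H → ℂ) (F : G → ℂ) :
    ∑ y : G, extendZero H ψ y * F y = ∑ u : H, ψ u * F u := by
  classical
  rw [← Finset.sum_filter_add_sum_filter_not Finset.univ (fun y : G => y ∈ H),
    Finset.sum_eq_zero (s := Finset.univ.filter fun y : G => ¬ y ∈ H)
      (fun y hy => by rw [extendZero_of_notMem H ψ (Finset.mem_filter.1 hy).2, zero_mul]),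
    add_zero]
  symm
  refine Finset.sum_bij (fun u _ => (u : G)) (fun u _ => by simp) (fun u _ v _ h => Subtype.ext h)
    (fun y hy => ⟨⟨y, (Finset.mem_filter.1 hy).2⟩, Finset.mem_univ _, rfl⟩) (fun u _ => ?_)
  rw [extendZero_of_mem H ψ u.2]

/-- Frobenius reciprocity for class functions. -/
theorem charInner_induced (H : Subgroup G) [Fintype H] (ψ : H → ℂ) {X : G → ℂ}
    (hX : IsClassFun X) : charInner (induced H ψ) X = charInner ψ (res H X) := by
  have h1 : ∀ x : G, ∑ g : G, extendZero H ψ (x⁻¹ * g * x) * (starRingEnd ℂ) (X g) =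
      ∑ u : H, ψ u * (starRingEnd ℂ) (X u) := by
    intro x
    rw [← sum_extendZero_mul H ψ fun y => (starRingEnd ℂ) (X y)]
    refine Fintype.sum_equiv (MulAut.conj x⁻¹).toEquiv _ _ fun g => ?_
    have h3 : (MulAut.conj x⁻¹).toEquiv g = x⁻¹ * g * x⁻¹⁻¹ := rfl
    rw [h3, hX, inv_inv]
  unfold charInner
  simp only [induced_apply]
  simp only [mul_assoc _ (Finset.sum _ _), Finset.sum_mul, ← Finset.mul_sum]
  rw [Finset.sum_comm, Fintype.sum_congr _ _ h1]
  simp only [Finset.sum_const, Finset.card_univ, nsmul_eq_mul, ← Nat.card_eq_fintype_card, res]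
  rw [mul_left_comm, ← mul_assoc (Nat.card G : ℂ)⁻¹, inv_mul_cancel₀ card_ne_zero', one_mul]

lemma charInner_induced_right (H : Subgroup G) [Fintype H] (ψ : H → ℂ) {X : G → ℂ}
    (hX : IsClassFun X) : charInner X (induced H ψ) = charInner (res H X) ψ := by
  rw [charInner_conj, charInner_induced H ψ hX, ← charInner_conj]

theorem isVirtualChar_induced (H : Subgroup G) {ψ : H → ℂ} (hψ : IsIrrChar ψ) :
    IsVirtualChar (induced H ψ) := by
  classical
  refine ⟨isClassFun_induced H ψ, fun χ hχ => ?_⟩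
  rw [charInner_induced H ψ hχ.isClassFun]
  obtain ⟨n, hn⟩ := hχ.charInner_res H hψ
  exact ⟨n, by rw [hn]; simp⟩

end General

/-! ### Conjugacy in `SL(2,p)` -/

section Conj

variable {p : ℕ} [hpf : Fact p.Prime]

omit hpf in
lemma SL2.ext_entries {g h : SL2 p} (h00 : g.1 0 0 = h.1 0 0) (h01 : g.1 0 1 = h.1 0 1)
    (h10 : g.1 1 0 = h.1 1 0) (h11 : g.1 1 1 = h.1 1 1) : g = h := by
  apply Subtype.ext
  ext i j
  fin_cases i <;> fin_cases j <;> assumption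

lemma SL2.det_eq (g : SL2 p) : g.1 0 0 * g.1 1 1 - g.1 0 1 * g.1 1 0 = 1 := by
  have := g.2
  rwa [Matrix.det_fin_two] at this

lemma SL2.mul_entry (g h : SL2 p) (i j : Fin 2) :
    (g * h).1 i j = g.1 i 0 * h.1 0 j + g.1 i 1 * h.1 1 j := by
  rw [Matrix.SpecialLinearGroup.coe_mul, Matrix.mul_apply, Fin.sum_univ_two]

lemma SL2.inv_entries (g : SL2 p) : g⁻¹.1 0 0 = g.1 1 1 ∧ g⁻¹.1 0 1 = -g.1 0 1 ∧
    g⁻¹.1 1 0 = -g.1 1 0 ∧ g⁻¹.1 1 1 = g.1 0 0 := by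
  rw [Matrix.SpecialLinearGroup.SL2_inv_expl]
  simp

lemma SL2.neg_entry (g : SL2 p) (i j : Fin 2) : (-g).1 i j = -g.1 i j := by
  simp

lemma SL2.one_entries : (1 : SL2 p).1 0 0 = 1 ∧ (1 : SL2 p).1 0 1 = 0 ∧
    (1 : SL2 p).1 1 0 = 0 ∧ (1 : SL2 p).1 1 1 = 1 := by
  simp

/-- The trace of an element of `SL(2,p)`. -/
def tr (g : SL2 p) : ZMod p := g.1 0 0 + g.1 1 1

lemma tr_mul_comm (g h : SL2 p) : tr (g * h) = tr (h * g) := by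
  simp only [tr, SL2.mul_entry]
  ring

lemma tr_conj (x g : SL2 p) : tr (x⁻¹ * g * x) = tr g := by
  rw [tr_mul_comm, mul_inv_cancel_left]

lemma tr_inv (g : SL2 p) : tr g⁻¹ = tr g := by
  obtain ⟨h1, _, _, h2⟩ := SL2.inv_entries g
  rw [tr, tr, h1, h2, add_comm]

lemma tr_neg (g : SL2 p) : tr (-g) = -tr g := by
  rw [tr, tr, SL2.neg_entry, SL2.neg_entry]
  ring

lemma tr_one : tr (1 : SL2 p) = 2 := by
  rw [tr, SL2.one_entries.1, SL2.one_entries.2.2.2]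
  norm_num

/-- The Cayley-Hamilton theorem in `SL(2,p)`. -/
lemma add_inv_val (g : SL2 p) : g.1 + g⁻¹.1 = tr g • (1 : Matrix (Fin 2) (Fin 2) (ZMod p)) := by
  obtain ⟨i00, i01, i10, i11⟩ := SL2.inv_entries g
  ext i j
  fin_cases i <;> fin_cases j <;>
    simp [-Matrix.SpecialLinearGroup.coe_inv, i00, i01, i10, i11, tr, add_comm]

/-- The determinant of the matrix with columns `v` and `g v`, where `v = (x, y)`. -/
def cyclicForm (g : SL2 p) (x y : ZMod p) : ZMod p :=
  g.1 1 0 * x ^ 2 + (g.1 1 1 - g.1 0 0) * x * y - g.1 0 1 * y ^ 2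

/-- Two elements with the same trace are conjugate in `SL(2,p)` as soon as they have cyclic
vectors `v`, `w` such that `det (v, g v) = det (w, h w)`: the change of basis from `(w, h w)` to
`(v, g v)` then has determinant one. -/
theorem isConj_of_cyclicForm_eq {g h : SL2 p} (htr : tr g = tr h) {x y x' y' c : ZMod p}
    (hc : c ≠ 0) (hg : cyclicForm g x y = c) (hh : cyclicForm h x' y' = c) : IsConj h g := by
  let P : Matrix (Fin 2) (Fin 2) (ZMod p) :=
    !![x, g.1 0 0 * x + g.1 0 1 * y; y, g.1 1 0 * x + g.1 1 1 * y]
  let Q : Matrix (Fin 2) (Fin 2) (ZMod p) :=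
    !![x', h.1 0 0 * x' + h.1 0 1 * y'; y', h.1 1 0 * x' + h.1 1 1 * y']
  let C : Matrix (Fin 2) (Fin 2) (ZMod p) := !![0, -1; 1, tr g]
  have hdg := SL2.det_eq g
  have hdh := SL2.det_eq h
  have hP : P.det = c := by
    rw [← hg, Matrix.det_fin_two_of, cyclicForm]; ring
  have hQ : Q.det = c := by
    rw [← hh, Matrix.det_fin_two_of, cyclicForm]; ring
  have hgP : g.1 * P = P * C := by
    ext i j
    fin_cases i <;> fin_cases j <;> simp [P, C, Matrix.mul_apply, Fin.sum_univ_two, tr]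
    · linear_combination (-x) * hdg
    · linear_combination (-y) * hdg
  have hhQ : h.1 * Q = Q * C := by
    ext i j
    fin_cases i <;> fin_cases j <;> simp [Q, C, Matrix.mul_apply, Fin.sum_univ_two, htr] <;>
      simp only [tr]
    · linear_combination (-x') * hdh
    · linear_combination (-y') * hdh
  have hadj : Q.adjugate * h.1 = C * Q.adjugate := by
    have h1 : Q.adjugate * h.1 * (Q * Q.adjugate) = C * Q.adjugate * (Q * Q.adjugate) := by
      calc Q.adjugate * h.1 * (Q * Q.adjugate) = Q.adjugate * (h.1 * Q) * Q.adjugate := by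
            simp only [Matrix.mul_assoc]
        _ = (Q.adjugate * Q) * C * Q.adjugate := by rw [hhQ]; simp only [Matrix.mul_assoc]
        _ = C * Q.adjugate * (Q * Q.adjugate) := by
            rw [Matrix.adjugate_mul, Matrix.mul_adjugate]
            simp
    rw [Matrix.mul_adjugate, hQ] at h1
    simp only [Matrix.mul_smul, Matrix.mul_one] at h1
    exact smul_right_injective _ hc h1
  let k : SL2 p := ⟨c⁻¹ • (P * Q.adjugate), by
    rw [Matrix.det_smul, Matrix.det_mul, Matrix.det_adjugate, hP, hQ]
    simp only [Fintype.card_fin]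
    field_simp
    norm_num⟩
  refine isConj_iff.2 ⟨k, ?_⟩
  rw [mul_inv_eq_iff_eq_mul]
  apply Subtype.ext
  change c⁻¹ • (P * Q.adjugate) * h.1 = g.1 * (c⁻¹ • (P * Q.adjugate))
  rw [Matrix.smul_mul, Matrix.mul_smul, Matrix.mul_assoc, hadj, ← Matrix.mul_assoc,
    ← Matrix.mul_assoc, hgP]

lemma two_ne_zero_of_odd (hp : p ≠ 2) : (2 : ZMod p) ≠ 0 := by
  intro h
  have : ((2 : ℕ) : ZMod p) = 0 := by exact_mod_cast h
  rw [ZMod.natCast_eq_zero_iff] at this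
  exact hp ((Nat.prime_dvd_prime_iff_eq hpf.out Nat.prime_two).1 this)

/-- If the discriminant of the characteristic polynomial of `g` is nonzero, then the
binary quadratic form `cyclicForm g` is universal. -/
lemma exists_cyclicForm_eq (hp : p ≠ 2) {g : SL2 p} (hg : tr g ^ 2 ≠ 4) (c : ZMod p) :
    ∃ x y, cyclicForm g x y = c := by
  have h2 := two_ne_zero_of_odd hp
  have hd := SL2.det_eq g
  have hdisc : (g.1 1 1 - g.1 0 0) ^ 2 + 4 * g.1 0 1 * g.1 1 0 ≠ 0 := by
    intro h
    apply hg
    rw [tr]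
    linear_combination h + 4 * hd
  by_cases h10 : g.1 1 0 = 0
  · have hne : g.1 1 1 - g.1 0 0 ≠ 0 := by
      intro h
      apply hdisc
      rw [h, h10]
      ring
    refine ⟨(c + g.1 0 1) / (g.1 1 1 - g.1 0 0), 1, ?_⟩
    rw [cyclicForm, h10]
    field_simp
    ring
  · set e := ((g.1 1 1 - g.1 0 0) ^ 2 + 4 * g.1 0 1 * g.1 1 0) with he
    have h4 : (4 : ZMod p) ≠ 0 := by
      have : (4 : ZMod p) = 2 * 2 := by norm_num
      rw [this]
      exact mul_ne_zero h2 h2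
    have he4 : -(e / 4) ≠ 0 := neg_ne_zero.2 (div_ne_zero hdisc h4)
    obtain ⟨X, Y, hXY⟩ := FiniteField.exists_root_sum_quadratic (R := ZMod p)
      (f := Polynomial.C 1 * Polynomial.X ^ 2 + Polynomial.C 0 * Polynomial.X + Polynomial.C 0)
      (g := Polynomial.C (-(e / 4)) * Polynomial.X ^ 2 + Polynomial.C 0 * Polynomial.X +
        Polynomial.C (-(g.1 1 0 * c)))
      (Polynomial.degree_quadratic one_ne_zero) (Polynomial.degree_quadratic he4)
      (by
        rw [ZMod.card]
        exact (Nat.Prime.eq_two_or_odd hpf.out).resolve_left hp)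
    simp only [Polynomial.eval_add, Polynomial.eval_mul, Polynomial.eval_C, Polynomial.eval_pow,
      Polynomial.eval_X] at hXY
    refine ⟨(X - (g.1 1 1 - g.1 0 0) / 2 * Y) / g.1 1 0, Y, ?_⟩
    rw [cyclicForm]
    field_simp
    field_simp at hXY
    rw [he] at hXY
    linear_combination hXY

/-- Elements of `SL(2,p)` with the same trace different from `±2` are conjugate. -/
theorem isConj_of_tr_eq (hp : p ≠ 2) {g h : SL2 p} (htr : tr g = tr h) (hg : tr g ^ 2 ≠ 4) :
    IsConj h g := by
  obtain ⟨x, y, h1⟩ := exists_cyclicForm_eq hp hg 1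
  obtain ⟨x', y', h2⟩ := exists_cyclicForm_eq hp (htr ▸ hg) 1
  exact isConj_of_cyclicForm_eq htr one_ne_zero h1 h2

/-- The matrix with rows `(1, x)` and `(0, 1)`. -/
def unip (x : ZMod p) : SL2 p := ⟨!![1, x; 0, 1], by simp [Matrix.det_fin_two]⟩

/-- The matrix `diag(μ, μ⁻¹)`. -/
def diagSL (μ : (ZMod p)ˣ) : SL2 p :=
  ⟨!![(μ : ZMod p), 0; 0, ((μ⁻¹ : (ZMod p)ˣ) : ZMod p)], by
    rw [Matrix.det_fin_two_of, Units.mul_inv, mul_zero, sub_zero]⟩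

lemma unip_zero : unip (0 : ZMod p) = 1 := by
  apply SL2.ext_entries <;> simp [unip]

lemma unip_add (x y : ZMod p) : unip (x + y) = unip x * unip y := by
  apply SL2.ext_entries <;> rw [SL2.mul_entry] <;> simp [unip, add_comm]

lemma unip_pow (x : ZMod p) (n : ℕ) : unip x ^ n = unip ((n : ZMod p) * x) := by
  induction n with
  | zero => simp [unip_zero]
  | succ n ih => rw [pow_succ, ih, ← unip_add]; congr 1; push_cast; ring

lemma diagSL_one : diagSL (1 : (ZMod p)ˣ) = 1 := by
  apply SL2.ext_entries <;> simp [diagSL, -Units.val_inv_eq_inv_val]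

lemma diagSL_mul (μ ν : (ZMod p)ˣ) : diagSL (μ * ν) = diagSL μ * diagSL ν := by
  apply SL2.ext_entries <;> rw [SL2.mul_entry] <;>
    simp [diagSL, mul_comm, -Units.val_inv_eq_inv_val]

lemma diagSL_pow (μ : (ZMod p)ˣ) (n : ℕ) : diagSL μ ^ n = diagSL (μ ^ n) := by
  induction n with
  | zero => simp [diagSL_one]
  | succ n ih => rw [pow_succ, ih, ← diagSL_mul, pow_succ]

lemma tr_diagSL (μ : (ZMod p)ˣ) : tr (diagSL μ) = μ + ((μ⁻¹ : (ZMod p)ˣ) : ZMod p) := rfl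

lemma tr_unip (x : ZMod p) : tr (unip x) = 2 := by
  simp [tr, unip]; norm_num

lemma cyclicForm_unip (x y z : ZMod p) : cyclicForm (unip z) x y = -(z * y ^ 2) := by
  simp [cyclicForm, unip]

lemma unit_pow_card_sub_one (μ : (ZMod p)ˣ) : μ ^ (p - 1) = 1 := by
  exact ZMod.units_pow_card_sub_one_eq_one p μ

/-- Every element of the prime field is a square or `t` times a square. -/
lemma exists_sq_or_mul_sq {t : ZMod p} (ht : ¬ IsSquare t) (x : ZMod p) :
    ∃ y, x = y ^ 2 ∨ x = t * y ^ 2 := by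
  have ht0 : t ≠ 0 := fun h => ht (h ▸ IsSquare.zero)
  by_cases hx : IsSquare x
  · obtain ⟨y, hy⟩ := hx
    exact ⟨y, Or.inl (by rw [hy, sq])⟩
  · have hx0 : x ≠ 0 := fun h => hx (h ▸ IsSquare.zero)
    have h1 : IsSquare (x * t) := by
      rw [← quadraticChar_one_iff_isSquare (mul_ne_zero hx0 ht0), map_mul,
        quadraticChar_neg_one_iff_not_isSquare.2 hx, quadraticChar_neg_one_iff_not_isSquare.2 ht]
      norm_num
    obtain ⟨y, hy⟩ := h1
    refine ⟨y / t, Or.inr ?_⟩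
    field_simp
    rw [hy, sq]

/-- The nontrivial elements of trace `2` form two conjugacy classes, told apart by the square class
of the values of `-cyclicForm`. -/
theorem isConj_unip_of_tr {t : ZMod p} (ht : ¬ IsSquare t) {g : SL2 p}
    (hg : tr g = 2) (h1 : g ≠ 1) : IsConj (unip 1) g ∨ IsConj (unip t) g := by
  have hd := SL2.det_eq g
  obtain ⟨x, y, c, hc, hgc⟩ : ∃ x y c, c ≠ 0 ∧ cyclicForm g x y = c := by
    by_cases h10 : g.1 1 0 = 0
    · by_cases h01 : g.1 0 1 = 0
      · exfalso
        apply h1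
        have h11 : g.1 1 1 = 2 - g.1 0 0 := by
          rw [← hg, tr]; ring
        have h00 : (g.1 0 0 - 1) ^ 2 = 0 := by
          rw [h10, h11] at hd
          linear_combination -hd
        have h00' : g.1 0 0 = 1 := by
          have := pow_eq_zero_iff (two_ne_zero) |>.1 h00
          linear_combination this
        have := SL2.one_entries (p := p)
        apply SL2.ext_entries
        · rw [this.1, h00']
        · rw [this.2.1, h01]
        · rw [this.2.2.1, h10]
        · rw [this.2.2.2, h11, h00']; norm_num
      · exact ⟨0, 1, -g.1 0 1, neg_ne_zero.2 h01, by rw [cyclicForm]; ring⟩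
    · exact ⟨1, 0, g.1 1 0, h10, by rw [cyclicForm]; ring⟩
  obtain ⟨z, hz⟩ := exists_sq_or_mul_sq ht (-c)
  rcases hz with hz | hz
  · left
    refine isConj_of_cyclicForm_eq (by rw [hg, tr_unip]) hc hgc (x' := 0) (y' := z) ?_
    rw [cyclicForm_unip]
    linear_combination hz
  · right
    refine isConj_of_cyclicForm_eq (by rw [hg, tr_unip]) hc hgc (x' := 0) (y' := z) ?_
    rw [cyclicForm_unip]
    linear_combination hz

omit hpf in
lemma isConj_neg {g h : SL2 p} (hc : IsConj g (-h)) : IsConj (-g) h := by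
  obtain ⟨c, hc⟩ := isConj_iff.1 hc
  refine isConj_iff.2 ⟨c, ?_⟩
  rw [mul_neg, neg_mul, hc, neg_neg]

lemma eq_one_or_neg_one_of_mul_self (hp : p ≠ 2) {c : SL2 p} (hsq : c * c = 1) :
    c = 1 ∨ c = -1 := by
  have hinv := add_inv_val c
  rw [← eq_inv_of_mul_eq_one_left hsq] at hinv
  have h01 : c.1 0 1 + c.1 0 1 = 0 := by
    have := congrFun (congrFun hinv 0) 1
    simpa using this
  have h10 : c.1 1 0 + c.1 1 0 = 0 := by
    have := congrFun (congrFun hinv 1) 0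
    simpa using this
  have h00 : c.1 0 0 + c.1 0 0 = tr c := by
    have := congrFun (congrFun hinv 0) 0
    simpa using this
  have h2 := two_ne_zero_of_odd hp
  have e01 : c.1 0 1 = 0 := by
    rw [← two_mul] at h01
    exact (mul_eq_zero.1 h01).resolve_left h2
  have e10 : c.1 1 0 = 0 := by
    rw [← two_mul] at h10
    exact (mul_eq_zero.1 h10).resolve_left h2
  have e11 : c.1 1 1 = c.1 0 0 := by rw [tr] at h00; linear_combination -h00
  have hd := SL2.det_eq c
  rw [e01, e11] at hd
  have hone := SL2.one_entries (p := p)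
  rcases mul_eq_zero.1 (show (c.1 0 0 - 1) * (c.1 0 0 + 1) = 0 by linear_combination hd) with h | h
  · left
    apply SL2.ext_entries
    · rw [hone.1]; linear_combination h
    · rw [hone.2.1, e01]
    · rw [hone.2.2.1, e10]
    · rw [hone.2.2.2, e11]; linear_combination h
  · right
    apply SL2.ext_entries <;> rw [SL2.neg_entry]
    · rw [hone.1]; linear_combination h
    · rw [hone.2.1, e01, neg_zero]
    · rw [hone.2.2.1, e10, neg_zero]
    · rw [hone.2.2.2, e11]; linear_combination h

end Conj

/-! ### The nonsplit torus -/

namespace Choices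

variable {p : ℕ} [hpf : Fact p.Prime] (D : Choices p)

lemma b_eq : D.b = unip 1 := rfl

lemma d_eq : D.d = unip D.t := rfl

lemma a_eq : D.a = diagSL D.lam := rfl

omit hpf in
lemma f_pow_eq_one_iff (n : ℕ) : D.f ^ n = 1 ↔ p + 1 ∣ n := by
  rw [← D.f_order, orderOf_dvd_iff_pow_eq_one]

lemma orderOf_lam : orderOf D.lam = p - 1 := by
  rw [orderOf_eq_card_of_forall_mem_zpowers D.lam_generates, Nat.card_eq_fintype_card,
    ZMod.card_units]

/-- The characteristic polynomial of `f` is irreducible: otherwise `f` would be conjugate to a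
diagonal or to plus or minus a unipotent matrix, whose order divides `p - 1` or `2 * p`. -/
theorem not_isSquare_disc (hp : p ≠ 2) : ¬ IsSquare (tr D.f ^ 2 - 4) := by
  rintro ⟨r, hr⟩
  have h2 := two_ne_zero_of_odd hp
  have hp2 := hpf.out.two_le
  have hpow : ∀ (n : ℕ) (g : SL2 p), IsConj g D.f → g ^ n = 1 → p + 1 ∣ n := by
    intro n g hc hg
    obtain ⟨c, hc⟩ := isConj_iff.1 hc
    rw [← D.f_pow_eq_one_iff, ← hc, conj_pow, hg, mul_one, mul_inv_cancel]
  have hcases : p + 1 ∣ p - 1 ∨ p + 1 ∣ 2 * p := by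
    by_cases hr0 : tr D.f ^ 2 = 4
    · right
      have hpp : ∀ x : ZMod p, unip x ^ p = 1 := fun x => by
        rw [unip_pow, ZMod.natCast_self, zero_mul, unip_zero]
      have hpp2 : ∀ x : ZMod p, (-unip x) ^ (2 * p) = 1 := fun x => by
        rw [pow_mul, neg_sq, ← pow_mul, mul_comm, pow_mul, hpp, one_pow]
      have hpp1 : ∀ x : ZMod p, (unip x) ^ (2 * p) = 1 := fun x => by
        rw [mul_comm, pow_mul, hpp, one_pow]
      have : (tr D.f - 2) * (tr D.f + 2) = 0 := by linear_combination hr0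
      rcases mul_eq_zero.1 this with h | h
      · by_cases h1 : D.f = 1
        · exact hpow _ 1 (h1 ▸ IsConj.refl _) (one_pow _)
        · rcases isConj_unip_of_tr D.t_nonsquare (sub_eq_zero.1 h) h1 with h | h
          · exact hpow _ _ h (hpp1 _)
          · exact hpow _ _ h (hpp1 _)
      · by_cases h1 : -D.f = 1
        · refine hpow _ (-1) ?_ (by rw [pow_mul, neg_one_sq, one_pow])
          rw [← h1, neg_neg]
        · rcases isConj_unip_of_tr D.t_nonsquare
            (by rw [tr_neg]; linear_combination -h) h1 with h | h
          · exact hpow _ _ (isConj_neg h) (hpp2 _)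
          · exact hpow _ _ (isConj_neg h) (hpp2 _)
    · left
      have hprod : (tr D.f + r) / 2 * ((tr D.f - r) / 2) = 1 := by
        field_simp
        linear_combination hr
      let μ : (ZMod p)ˣ := ⟨(tr D.f + r) / 2, (tr D.f - r) / 2, hprod, by rw [mul_comm, hprod]⟩
      have htr : tr D.f = tr (diagSL μ) := by
        rw [tr_diagSL]
        change tr D.f = (tr D.f + r) / 2 + (tr D.f - r) / 2
        field_simp
        ring
      refine hpow _ _ (isConj_of_tr_eq hp htr hr0) ?_
      rw [diagSL_pow, unit_pow_card_sub_one, diagSL_one]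
  rcases hcases with h | h
  · have := Nat.le_of_dvd (by omega) h
    omega
  · have h3 : p + 1 ∣ 2 * (p + 1) - 2 * p := Nat.dvd_sub (Dvd.intro_left 2 rfl) h
    have := Nat.le_of_dvd (by omega) h3
    omega

lemma disc_f : tr D.f ^ 2 - 4 = (D.f.1 1 1 - D.f.1 0 0) ^ 2 + 4 * D.f.1 0 1 * D.f.1 1 0 := by
  rw [tr]; linear_combination 4 * SL2.det_eq D.f

/-- The centralizer of `f` consists of linear combinations of `1` and `f`. -/
lemma exists_of_commute (hp : p ≠ 2) {c : SL2 p} (hc : c * D.f = D.f * c) :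
    ∃ y, c.1 0 1 = y * D.f.1 0 1 ∧ c.1 1 0 = y * D.f.1 1 0 ∧
      c.1 1 1 - c.1 0 0 = y * (D.f.1 1 1 - D.f.1 0 0) := by
  have hf10 : D.f.1 1 0 ≠ 0 := by
    intro h
    apply D.not_isSquare_disc hp
    rw [disc_f, h, mul_zero, add_zero, sq]
    exact ⟨_, rfl⟩
  have e00 := congrArg (fun g : SL2 p => g.1 0 0) hc
  have e10 := congrArg (fun g : SL2 p => g.1 1 0) hc
  simp only [SL2.mul_entry] at e00 e10
  refine ⟨c.1 1 0 / D.f.1 1 0, ?_, ?_, ?_⟩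
  · field_simp; linear_combination e00
  · field_simp
  · field_simp; linear_combination e10

/-- An element of the centralizer of `f` with an eigenvalue in the prime field is central. -/
theorem eq_one_or_neg_one_of_commute (hp : p ≠ 2) {c : SL2 p} (hc : c * D.f = D.f * c)
    (hsq : IsSquare (tr c ^ 2 - 4)) : c = 1 ∨ c = -1 := by
  have hns := D.not_isSquare_disc hp
  have hdc := SL2.det_eq c
  have hdisc := D.disc_f
  obtain ⟨y, hc01, hc10, hcd⟩ := D.exists_of_commute hp hc
  have hdc' : tr c ^ 2 - 4 = y ^ 2 * (tr D.f ^ 2 - 4) := by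
    rw [hdisc]
    have : tr c ^ 2 - 4 = (c.1 1 1 - c.1 0 0) ^ 2 + 4 * c.1 0 1 * c.1 1 0 := by
      rw [tr]; linear_combination 4 * hdc
    rw [this, hcd, hc10, hc01]
    ring
  have hy0 : y = 0 := by
    by_contra hne
    obtain ⟨r, hr⟩ := hsq
    apply hns
    refine ⟨r / y, ?_⟩
    rw [hdc'] at hr
    field_simp
    linear_combination hr
  rw [hy0, zero_mul] at hc10 hc01 hcd
  have h11 : c.1 1 1 = c.1 0 0 := by linear_combination hcd
  have hsq1 : (c.1 0 0 - 1) * (c.1 0 0 + 1) = 0 := by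
    rw [hc10, h11] at hdc
    linear_combination hdc
  have hone := SL2.one_entries (p := p)
  rcases mul_eq_zero.1 hsq1 with h | h
  · left
    apply SL2.ext_entries
    · rw [hone.1]; linear_combination h
    · rw [hone.2.1, hc01]
    · rw [hone.2.2.1, hc10]
    · rw [hone.2.2.2, h11]; linear_combination h
  · right
    apply SL2.ext_entries <;> rw [SL2.neg_entry]
    · rw [hone.1]; linear_combination h
    · rw [hone.2.1, hc01, neg_zero]
    · rw [hone.2.2.1, hc10, neg_zero]
    · rw [hone.2.2.2, h11]; linear_combination h

lemma eq_one_of_commute_of_tr (hp : p ≠ 2) {c : SL2 p} (hc : c * D.f = D.f * c)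
    (htr : tr c = 2) : c = 1 := by
  rcases D.eq_one_or_neg_one_of_commute hp hc ⟨0, by rw [htr]; norm_num⟩ with h | h
  · exact h
  · exfalso
    rw [h, tr_neg, tr_one] at htr
    have h2 := two_ne_zero_of_odd hp
    have : (2 : ZMod p) * 2 = 0 := by linear_combination -htr
    simp [h2] at this

/-- Commuting elements of the centralizer of `f` with the same trace are equal or inverse to each
other, since they are roots of the same quadratic polynomial. -/
theorem eq_or_eq_inv_of_tr_eq (hp : p ≠ 2) {c e : SL2 p} (hc : c * D.f = D.f * c)
    (he : e * D.f = D.f * e) (hce : c * e = e * c) (htr : tr c = tr e) : c = e ∨ c = e⁻¹ := by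
  have hdc := SL2.det_eq c
  have hde := SL2.det_eq e
  obtain ⟨i00, i01, i10, i11⟩ := SL2.inv_entries e
  have hkey : (2 - tr (c * e⁻¹)) * (2 - tr (c * e)) = 0 := by
    have h1 : (c.1 - e.1).det = 2 - tr (c * e⁻¹) := by
      rw [Matrix.det_fin_two]
      simp only [Matrix.sub_apply, tr, SL2.mul_entry, i00, i01, i10, i11]
      linear_combination hdc + hde
    have h2 : (c.1 - e⁻¹.1).det = 2 - tr (c * e) := by
      rw [Matrix.det_fin_two]
      simp only [Matrix.sub_apply, tr, SL2.mul_entry, i00, i01, i10, i11]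
      linear_combination hdc + hde
    have h3 : (c.1 - e.1) * (c.1 - e⁻¹.1) = 0 := by
      have hce' : c.1 * e.1 = e.1 * c.1 := congrArg Subtype.val hce
      have h4 : e.1 * e⁻¹.1 = 1 := congrArg Subtype.val (mul_inv_cancel e)
      have h5 : c.1 * c⁻¹.1 = 1 := congrArg Subtype.val (mul_inv_cancel c)
      have h6 : e.1 + e⁻¹.1 = c.1 + c⁻¹.1 := by rw [add_inv_val, add_inv_val, htr]
      calc (c.1 - e.1) * (c.1 - e⁻¹.1) = c.1 * (c.1 - (e.1 + e⁻¹.1)) + 1 := by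
            rw [sub_mul, mul_sub, mul_sub, h4, ← hce', mul_sub, mul_add]; abel
        _ = 0 := by rw [h6, sub_add_cancel_left, mul_neg, h5, neg_add_cancel]
    rw [← h1, ← h2, ← Matrix.det_mul, h3, Matrix.det_zero]
  rcases mul_eq_zero.1 hkey with h | h
  · left
    have := D.eq_one_of_commute_of_tr hp (c := c * e⁻¹)
      (by
        have : Commute e⁻¹ D.f := (show Commute e D.f from he).inv_left
        rw [mul_assoc, this.eq, ← mul_assoc, hc, mul_assoc])
      (by linear_combination -h)
    exact mul_inv_eq_one.1 this
  · right
    have := D.eq_one_of_commute_of_tr hp (c := c * e)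
      (by rw [mul_assoc, he, ← mul_assoc, hc, mul_assoc])
      (by linear_combination -h)
    exact eq_inv_of_mul_eq_one_left this

/-- The half order `(p - 1) / 2`. -/
def half (p : ℕ) : ℕ := (p - 1) / 2

lemma two_mul_half (hp : p ≠ 2) : 2 * half p = p - 1 := by
  have := (Nat.Prime.eq_two_or_odd hpf.out).resolve_left hp
  unfold half
  omega

lemma half_pos (hp : p ≠ 2) : 0 < half p := by
  have := two_mul_half (p := p) hp
  have := hpf.out.two_le
  omega

omit hpf in
lemma f_pow_comm (m : ℕ) : D.f ^ m * D.f = D.f * D.f ^ m := (pow_mul_comm' D.f m)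

lemma isSquare_disc_diagSL (μ : (ZMod p)ˣ) : IsSquare (tr (diagSL μ) ^ 2 - 4) := by
  refine ⟨μ - ((μ⁻¹ : (ZMod p)ˣ) : ZMod p), ?_⟩
  have := μ.mul_inv
  rw [tr_diagSL]
  linear_combination 4 * this

lemma not_isSquare_disc_f_pow (hp : p ≠ 2) {m : ℕ} (h1 : 1 ≤ m) (h2 : m ≤ half p) :
    ¬ IsSquare (tr (D.f ^ m) ^ 2 - 4) := by
  intro h
  have hsq : D.f ^ (m * 2) = 1 := by
    rw [pow_mul]
    rcases D.eq_one_or_neg_one_of_commute hp (D.f_pow_comm m) h with h | h <;> rw [h]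
    · rw [one_pow]
    · rw [neg_one_sq]
  have := Nat.le_of_dvd (by omega) ((D.f_pow_eq_one_iff _).1 hsq)
  have := two_mul_half (p := p) hp
  omega

lemma tr_f_pow_ne_diag (hp : p ≠ 2) {m : ℕ} (h1 : 1 ≤ m) (h2 : m ≤ half p) (μ : (ZMod p)ˣ) :
    tr (D.f ^ m) ≠ tr (diagSL μ) := fun h =>
  D.not_isSquare_disc_f_pow hp h1 h2 (h ▸ isSquare_disc_diagSL μ)

lemma tr_diagSL_eq {μ ν : (ZMod p)ˣ} (h : tr (diagSL μ) = tr (diagSL ν)) : μ = ν ∨ μ * ν = 1 := by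
  rw [tr_diagSL, tr_diagSL] at h
  have h1 := μ.mul_inv
  have h2 := ν.mul_inv
  have : ((μ : ZMod p) - ν) * (μ * ν - 1) = 0 := by
    linear_combination (μ : ZMod p) * ν * h - ν * h1 + μ * h2
  rcases mul_eq_zero.1 this with h | h
  · left; exact Units.ext (sub_eq_zero.1 h)
  · right; exact Units.ext (by push_cast; linear_combination h)

/-- Every element of the prime field is the trace of a power of `a` or of `f`: there are exactly
`p` distinct such traces. -/
theorem exists_tr_eq (hp : p ≠ 2) (s : ZMod p) :
    (∃ n ≤ half p, s = tr (diagSL (D.lam ^ n))) ∨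
      ∃ m, 1 ≤ m ∧ m ≤ half p ∧ s = tr (D.f ^ m) := by
  have hN := two_mul_half (p := p) hp
  have hpos := half_pos (p := p) hp
  have hp2 := hpf.out.two_le
  let F : Fin p → ZMod p := fun n =>
    if n.1 ≤ half p then tr (diagSL (D.lam ^ n.1)) else tr (D.f ^ (n.1 - half p))
  have hlam : ∀ n, D.lam ^ n = 1 ↔ p - 1 ∣ n := fun n => by
    rw [← D.orderOf_lam, orderOf_dvd_iff_pow_eq_one]
  have hinj : Function.Injective F := by
    rintro ⟨n, hn⟩ ⟨n', hn'⟩ h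
    simp only [F] at h
    rw [Fin.mk.injEq]
    by_cases h1 : n ≤ half p <;> by_cases h2 : n' ≤ half p
    · rw [if_pos h1, if_pos h2] at h
      rcases tr_diagSL_eq h with h | h
      · refine pow_injOn_Iio_orderOf (x := D.lam) ?_ ?_ h
        · rw [D.orderOf_lam, Set.mem_Iio]; omega
        · rw [D.orderOf_lam, Set.mem_Iio]; omega
      · rw [← pow_add, hlam] at h
        rcases Nat.eq_zero_or_pos (n + n') with h0 | h0
        · omega
        · have := Nat.le_of_dvd h0 h
          omega
    · rw [if_pos h1, if_neg h2] at h
      exact absurd h.symm (D.tr_f_pow_ne_diag hp (by omega) (by omega) _)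
    · rw [if_neg h1, if_pos h2] at h
      exact absurd h (D.tr_f_pow_ne_diag hp (by omega) (by omega) _)
    · rw [if_neg h1, if_neg h2] at h
      rcases D.eq_or_eq_inv_of_tr_eq hp (D.f_pow_comm _) (D.f_pow_comm _)
        (by rw [← pow_add, ← pow_add, add_comm]) h with h | h
      · have : n - half p = n' - half p := by
          refine pow_injOn_Iio_orderOf (x := D.f) ?_ ?_ h
          · rw [D.f_order, Set.mem_Iio]; omega
          · rw [D.f_order, Set.mem_Iio]; omega
        omega
      · rw [eq_inv_iff_mul_eq_one, ← pow_add, D.f_pow_eq_one_iff] at h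
        have := Nat.le_of_dvd (by omega) h
        omega
  have hsurj : Function.Surjective F :=
    ((Fintype.bijective_iff_injective_and_card F).2 ⟨hinj, by simp [ZMod.card]⟩).2
  obtain ⟨⟨n, hn⟩, rfl⟩ := hsurj s
  by_cases h1 : n ≤ half p
  · exact Or.inl ⟨n, h1, by simp [F, h1]⟩
  · exact Or.inr ⟨n - half p, by omega, by omega, by simp [F, h1]⟩

lemma lam_pow_half (hp : p ≠ 2) : D.lam ^ half p = -1 := by
  have hN := two_mul_half (p := p) hp
  have hpos := half_pos (p := p) hp
  have h1 : (D.lam ^ half p) ^ 2 = 1 := by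
    rw [← pow_mul, mul_comm, hN, ← D.orderOf_lam, pow_orderOf_eq_one]
  have h2 : D.lam ^ half p ≠ 1 := fun h => by
    have := Nat.le_of_dvd hpos (orderOf_dvd_of_pow_eq_one h)
    rw [D.orderOf_lam] at this
    omega
  have h3 : ((D.lam ^ half p : (ZMod p)ˣ) : ZMod p) ^ 2 = 1 := by
    rw [← Units.val_pow_eq_pow_val, h1, Units.val_one]
  rcases sq_eq_one_iff.1 h3 with h | h
  · exact absurd (Units.ext h) h2
  · exact Units.ext h

/-- The list of conjugacy classes of `SL(2,p)`. -/
theorem conj_cases (hp : p ≠ 2) (g : SL2 p) :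
    g = 1 ∨ g = -1 ∨ IsConj D.b g ∨ IsConj D.d g ∨ IsConj (-D.b) g ∨ IsConj (-D.d) g ∨
      (∃ l, 1 ≤ l ∧ l ≤ (p - 3) / 2 ∧ IsConj (D.a ^ l) g) ∨
      ∃ m, 1 ≤ m ∧ m ≤ (p - 1) / 2 ∧ IsConj (D.f ^ m) g := by
  have hN := two_mul_half (p := p) hp
  rw [b_eq, d_eq]
  by_cases h1 : tr g = 2
  · by_cases hg : g = 1
    · exact Or.inl hg
    · rcases isConj_unip_of_tr D.t_nonsquare h1 hg with h | h <;> tauto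
  by_cases h2 : tr g = -2
  · by_cases hg : -g = 1
    · exact Or.inr (Or.inl (by rw [← hg, neg_neg]))
    · rcases isConj_unip_of_tr D.t_nonsquare (by rw [tr_neg, h2, neg_neg]) hg with h | h
      · have := isConj_neg h
        tauto
      · have := isConj_neg h
        tauto
  have h4 : tr g ^ 2 ≠ 4 := fun h => by
    have : (tr g - 2) * (tr g + 2) = 0 := by linear_combination h
    rcases mul_eq_zero.1 this with h | h
    · exact h1 (by linear_combination h)
    · exact h2 (by linear_combination h)
  rcases D.exists_tr_eq hp (tr g) with ⟨n, hn, h⟩ | ⟨m, hm1, hm2, h⟩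
  · have hc := isConj_of_tr_eq hp h h4
    rw [← diagSL_pow, ← a_eq] at hc
    have hn0 : n ≠ 0 := by
      rintro rfl
      rw [pow_zero, diagSL_one, tr_one] at h
      exact h1 h
    have hnN : n ≠ half p := by
      rintro rfl
      rw [D.lam_pow_half hp, tr_diagSL] at h
      apply h2
      rw [h, inv_neg, inv_one]
      push_cast
      norm_num
    exact Or.inr (Or.inr (Or.inr (Or.inr (Or.inr (Or.inr (Or.inl ⟨n, by omega, by omega, hc⟩))))))
  · exact Or.inr (Or.inr (Or.inr (Or.inr (Or.inr (Or.inr (Or.inr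
      ⟨m, hm1, hm2, isConj_of_tr_eq hp h h4⟩))))))

lemma eq_find {P : ℕ → Prop} {_ : DecidablePred P} (h : ∃ n, P n) (F : ℕ → ℂ) {z : ℂ}
    (H : ∀ n, P n → z = F n) : z = F (Nat.find h) := H _ (Nat.find_spec h)

/-- A class function with the values prescribed by a row of the table is the class function
attached to that row. -/
theorem eq_ofRow (hp : p ≠ 2) {X : SL2 p → ℂ} (hX : IsClassFun X) (r : Row) (h1 : X 1 = r.one)
    (hn1 : X (-1) = r.negOne) (hb : X D.b = r.b) (hd : X D.d = r.d) (hnb : X (-D.b) = r.negB)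
    (hnd : X (-D.d) = r.negD)
    (ha : ∀ l, 1 ≤ l → l ≤ (p - 3) / 2 → X (D.a ^ l) = r.a l)
    (hf : ∀ m, 1 ≤ m → m ≤ (p - 1) / 2 → X (D.f ^ m) = r.f m) : X = D.ofRow r := by
  classical
  ext g
  unfold ofRow
  split_ifs with c1 c2 c3 c4 c5 c6 c7 c8
  · rw [c1, h1]
  · rw [c2, hn1]
  · rw [hX.apply_eq c3, hb]
  · rw [hX.apply_eq c4, hd]
  · rw [hX.apply_eq c5, hnb]
  · rw [hX.apply_eq c6, hnd]
  · exact eq_find c7 r.a fun n hn => by rw [hX.apply_eq hn.2.2, ha n hn.1 hn.2.1]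
  · exact eq_find c8 r.f fun n hn => by rw [hX.apply_eq hn.2.2, hf n hn.1 hn.2.1]
  · exfalso
    rcases D.conj_cases hp g with h | h | h | h | h | h | h | h
    exacts [c1 h, c2 h, c3 h, c4 h, c5 h, c6 h, c7 h, c8 h]

lemma f_pow_half_succ (hp : p ≠ 2) : D.f ^ (half p + 1) = -1 := by
  have hN := two_mul_half (p := p) hp
  have hpos := half_pos (p := p) hp
  have hp2 := hpf.out.two_le
  have hsq : D.f ^ (half p + 1) * D.f ^ (half p + 1) = 1 := by
    rw [← pow_add, f_pow_eq_one_iff]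
    exact ⟨1, by omega⟩
  refine (eq_one_or_neg_one_of_mul_self hp hsq).resolve_left ?_
  rw [f_pow_eq_one_iff]
  intro h
  have := Nat.le_of_dvd (by omega) h
  omega

lemma f_pow_ne (hp : p ≠ 2) {m : ℕ} (h1 : 1 ≤ m) (h2 : m ≤ half p) :
    D.f ^ m ≠ 1 ∧ D.f ^ m ≠ -1 := by
  have hns := D.not_isSquare_disc_f_pow hp h1 h2
  constructor <;> intro h <;> apply hns <;> refine ⟨0, ?_⟩ <;> rw [h]
  · rw [tr_one]; norm_num
  · rw [tr_neg, tr_one]; norm_num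

/-- An element commuting with a noncentral element of the centralizer of `f` commutes with `f`. -/
lemma commute_f_of_commute (hp : p ≠ 2) {c x : SL2 p} (hc : c * D.f = D.f * c) (h1 : c ≠ 1)
    (h2 : c ≠ -1) (hx : x * c = c * x) : x * D.f = D.f * x := by
  obtain ⟨y, h01, h10, hd⟩ := D.exists_of_commute hp hc
  have hy : y ≠ 0 := by
    rintro rfl
    have hdc := SL2.det_eq c
    rcases D.eq_one_or_neg_one_of_commute hp hc ⟨0, by
      rw [tr]
      linear_combination 4 * hdc + 4 * c.1 0 1 * h10 + (c.1 1 1 - c.1 0 0) * hd⟩ with h | h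
    exacts [h1 h, h2 h]
  have hcc : c.1 = (c.1 0 0 - y * D.f.1 0 0) • (1 : Matrix (Fin 2) (Fin 2) (ZMod p)) +
      y • D.f.1 := by
    ext i j
    fin_cases i <;> fin_cases j <;> simp [h01, h10]
    linear_combination hd
  have hx' : x.1 * c.1 = c.1 * x.1 := congrArg Subtype.val hx
  rw [hcc, mul_add, add_mul, Matrix.mul_smul, Matrix.smul_mul, mul_one, one_mul, Matrix.mul_smul,
    Matrix.smul_mul, add_right_inj] at hx'
  exact Subtype.ext (smul_right_injective _ hy hx')

/-- `⟨f⟩` is its own centralizer. -/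
theorem mem_zpowers_of_commute (hp : p ≠ 2) {x : SL2 p} (hxf : x * D.f = D.f * x) :
    x ∈ Subgroup.zpowers D.f := by
  rcases D.exists_tr_eq hp (tr x) with ⟨n, hn, h⟩ | ⟨m', hm1, hm2, h⟩
  · rcases D.eq_one_or_neg_one_of_commute hp hxf (h ▸ isSquare_disc_diagSL _) with h | h
    · rw [h]; exact one_mem _
    · rw [h, ← D.f_pow_half_succ hp]
      exact pow_mem (Subgroup.mem_zpowers D.f) _
  · have hcomm : x * D.f ^ m' = D.f ^ m' * x := (show Commute x D.f from hxf).pow_right m'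
    rcases D.eq_or_eq_inv_of_tr_eq hp hxf (D.f_pow_comm m') hcomm h with h | h
    · rw [h]; exact pow_mem (Subgroup.mem_zpowers D.f) _
    · rw [h]; exact inv_mem (pow_mem (Subgroup.mem_zpowers D.f) _)

end Choices

/-! ### The upper triangular subgroup -/

section Upper

variable {p : ℕ} [hpf : Fact p.Prime]

instance : Fintype (U p) := Fintype.ofFinite _

/-- The upper left entry, as a homomorphism from `U` to the units of the prime field. -/
def topLeft : U p →* (ZMod p)ˣ where
  toFun u := ⟨u.1.1 0 0, u.1.1 1 1, by
    have := SL2.det_eq u.1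
    have h : u.1.1 1 0 = 0 := u.2
    rw [h] at this
    linear_combination this, by
    have := SL2.det_eq u.1
    have h : u.1.1 1 0 = 0 := u.2
    rw [h] at this
    linear_combination this⟩
  map_one' := Units.ext SL2.one_entries.1
  map_mul' u v := Units.ext <| by
    have h : v.1.1 1 0 = 0 := v.2
    change (u.1 * v.1).1 0 0 = u.1.1 0 0 * v.1.1 0 0
    rw [SL2.mul_entry, h, mul_zero, add_zero]

lemma entry_zero_zero (u : U p) : u.1.1 0 0 = (topLeft u : ZMod p) := rfl

lemma entry_one_one (u : U p) : u.1.1 1 1 = ((topLeft u)⁻¹ : (ZMod p)ˣ) := rfl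

lemma entry_one_zero (u : U p) : u.1.1 1 0 = 0 := u.2

/-- The upper triangular matrix with first row `(μ, x)`. -/
def upper (μ : (ZMod p)ˣ) (x : ZMod p) : U p :=
  ⟨⟨!![(μ : ZMod p), x; 0, ((μ⁻¹ : (ZMod p)ˣ) : ZMod p)], by
    rw [Matrix.det_fin_two_of, Units.mul_inv, mul_zero, sub_zero]⟩, rfl⟩

lemma topLeft_upper (μ : (ZMod p)ˣ) (x : ZMod p) : topLeft (upper μ x) = μ := Units.ext rfl

lemma upper_entry (μ : (ZMod p)ˣ) (x : ZMod p) : (upper μ x).1.1 0 1 = x := rfl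

lemma eq_upper (u : U p) : u = upper (topLeft u) (u.1.1 0 1) := by
  apply Subtype.ext
  exact SL2.ext_entries rfl rfl u.2 rfl

/-- Upper triangular matrices of determinant one are determined by their first row. -/
def upperEquiv : (ZMod p)ˣ × ZMod p ≃ U p where
  toFun x := upper x.1 x.2
  invFun u := (topLeft u, u.1.1 0 1)
  left_inv _ := Prod.ext (topLeft_upper _ _) rfl
  right_inv u := (eq_upper u).symm

lemma sum_U {M : Type*} [AddCommMonoid M] (F : U p → M) :
    ∑ u, F u = ∑ μ : (ZMod p)ˣ, ∑ x : ZMod p, F (upper μ x) := by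
  rw [← Fintype.sum_prod_type', ← Equiv.sum_comp upperEquiv]
  rfl

lemma card_U : Nat.card (U p) = (p - 1) * p := by
  rw [Nat.card_congr upperEquiv.symm, Nat.card_prod, Nat.card_eq_fintype_card, ZMod.card_units,
    Nat.card_zmod]

/-- The subgroup of `U` of matrices with diagonal entries `±1`, generated by `-1` and `b`. -/
def signUnip (p : ℕ) [Fact p.Prime] : Subgroup (U p) :=
  ((powMonoidHom 2).comp (topLeft (p := p))).ker

instance : Fintype (signUnip p) := Fintype.ofFinite _

lemma mem_signUnip {u : U p} : u ∈ signUnip p ↔ topLeft u ^ 2 = 1 := Iff.rfl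

lemma unit_sq_eq_one {μ : (ZMod p)ˣ} : μ ^ 2 = 1 ↔ μ = 1 ∨ μ = -1 := by
  rw [Units.ext_iff, Units.ext_iff, Units.ext_iff]
  push_cast
  exact sq_eq_one_iff

lemma unit_one_ne_neg_one (hp : p ≠ 2) : (1 : (ZMod p)ˣ) ≠ -1 := by
  intro h
  have h1 : (1 : ZMod p) = -1 := by
    have := congrArg Units.val h
    simpa using this
  exact two_ne_zero_of_odd hp (by linear_combination h1)

lemma card_signUnip (hp : p ≠ 2) : Nat.card (signUnip p) = 2 * p := by
  classical
  have h1 : Nat.card (signUnip p) = ∑ u : U p, if topLeft u ^ 2 = 1 then 1 else 0 := by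
    rw [Finset.sum_boole]
    exact Nat.subtype_card _ fun u => by simp [mem_signUnip]
  have h2 : (Finset.univ.filter fun μ : (ZMod p)ˣ => μ ^ 2 = 1) = {1, -1} := by
    ext μ
    simp [unit_sq_eq_one]
  rw [h1, sum_U]
  simp only [topLeft_upper, Finset.sum_const, Finset.card_univ, ZMod.card, smul_eq_mul]
  rw [← Finset.mul_sum, Finset.sum_boole, h2, Finset.card_pair (unit_one_ne_neg_one hp), mul_comm]
  rfl

end Upper

/-! ### The functions on `U` -/

namespace Choices

variable {p : ℕ} [hpf : Fact p.Prime] (D : Choices p)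

/-- The character of the multiplicative group of the prime field sending `lam` to `zeta`. -/
def zhom : (ZMod p)ˣ →* ℂ :=
  (Units.coeHom ℂ).comp (monoidHomOfForallMemZpowers D.lam_generates
    (g' := (D.zeta_primitive.isUnit (Nat.sub_ne_zero_of_lt hpf.out.one_lt)).unit) (by
      rw [orderOf_lam]
      apply orderOf_dvd_of_pow_eq_one
      apply Units.ext
      rw [Units.val_pow_eq_pow_val, IsUnit.unit_spec, D.zeta_primitive.pow_eq_one, Units.val_one]))

lemma zhom_lam : D.zhom D.lam = D.zeta := by
  rw [zhom, MonoidHom.comp_apply, monoidHomOfForallMemZpowers_apply_gen]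
  rfl

lemma exists_lam_pow (μ : (ZMod p)ˣ) : ∃ n, n < p - 1 ∧ D.lam ^ n = μ := by
  classical
  have := IsCyclic.image_range_orderOf D.lam_generates
  have h2 : μ ∈ Finset.image (fun i => D.lam ^ i) (Finset.range (orderOf D.lam)) := by
    rw [this]; exact Finset.mem_univ _
  obtain ⟨n, hn, rfl⟩ := Finset.mem_image.1 h2
  rw [Finset.mem_range, D.orderOf_lam] at hn
  exact ⟨n, hn, rfl⟩

lemma zhom_eq_one_iff {μ : (ZMod p)ˣ} : D.zhom μ = 1 ↔ μ = 1 := by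
  refine ⟨fun h => ?_, fun h => h ▸ map_one _⟩
  obtain ⟨n, hn, rfl⟩ := D.exists_lam_pow μ
  rw [map_pow, zhom_lam, D.zeta_primitive.pow_eq_one_iff_dvd] at h
  rw [← orderOf_dvd_iff_pow_eq_one, orderOf_lam]
  exact h

lemma zhom_pow_card (μ : (ZMod p)ˣ) : D.zhom μ ^ (p - 1) = 1 := by
  rw [← map_pow, unit_pow_card_sub_one, map_one]

lemma zhom_neg_one (hp : p ≠ 2) : D.zhom (-1 : (ZMod p)ˣ) = -1 := by
  have h : D.zhom (-1 : (ZMod p)ˣ) ^ 2 = 1 := by rw [← map_pow, neg_one_sq, map_one]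
  rcases sq_eq_one_iff.1 h with h | h
  · exact absurd (D.zhom_eq_one_iff.1 h).symm (unit_one_ne_neg_one hp)
  · exact h

lemma chiLin_apply (k : ℕ) (u : U p) : D.chiLin k u = D.zhom (topLeft u) ^ k := by
  have hex : ∃ j : ℕ, (D.lam : ZMod p) ^ j = u.1 0 0 := by
    obtain ⟨n, -, hn⟩ := D.exists_lam_pow (topLeft u)
    exact ⟨n, by rw [← Units.val_pow_eq_pow_val, hn]; rfl⟩
  unfold chiLin
  rw [dif_pos hex]
  refine (eq_find hex (fun j => D.zeta ^ (k * j)) fun n hn => ?_).symm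
  have h1 : D.lam ^ n = topLeft u := Units.ext (by rw [Units.val_pow_eq_pow_val]; exact hn)
  rw [← h1, map_pow, zhom_lam, ← pow_mul, mul_comm]

/-- The linear character `chiLin k` as a homomorphism. -/
def linHom (k : ℕ) : U p →* ℂ := (powMonoidHom k).comp (D.zhom.comp topLeft)

lemma coe_linHom (k : ℕ) : (D.linHom k : U p → ℂ) = D.chiLin k := by
  ext u
  rw [chiLin_apply]
  rfl

lemma isIrrChar_chiLin (k : ℕ) : IsIrrChar (D.chiLin k) := by
  rw [← coe_linHom]
  exact isIrrChar_of_hom _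

lemma chiLin_zero : D.chiLin 0 = 1 := by
  ext u
  rw [chiLin_apply, pow_zero, Pi.one_apply]

lemma chiLin_inj {k k' : ℕ} (hk : k < p - 1) (hk' : k' < p - 1) (h : D.chiLin k = D.chiLin k') :
    k = k' := by
  have h1 := congrFun h (upper D.lam 0)
  rw [chiLin_apply, chiLin_apply, topLeft_upper, zhom_lam] at h1
  exact D.zeta_primitive.pow_inj hk hk' h1

/-- The additive character `x ↦ eta ^ x`. -/
def addChar : AddChar (ZMod p) ℂ := AddChar.zmodChar p D.eta_primitive.pow_eq_one

lemma addChar_primitive : D.addChar.IsPrimitive :=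
  AddChar.zmodChar_primitive_of_primitive_root p D.eta_primitive

lemma addChar_eq_one_iff {x : ZMod p} : D.addChar x = 1 ↔ x = 0 := by
  refine ⟨fun h => ?_, fun h => h ▸ AddChar.map_zero_eq_one _⟩
  rw [addChar, AddChar.zmodChar_apply, ← pow_zero D.eta] at h
  exact (ZMod.val_eq_zero x).1 (D.eta_primitive.pow_inj (ZMod.val_lt x) hpf.out.pos h)

lemma gaussPeriod_eq (x : ZMod p) :
    D.gaussPeriod x = ∑ l ∈ Finset.range (half p), D.addChar (x * (D.lam : ZMod p) ^ (2 * l)) := rfl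

lemma gaussPeriod_zero : D.gaussPeriod 0 = half p := by
  simp [gaussPeriod_eq]

lemma sum_units {M : Type*} [AddCommMonoid M] (F : (ZMod p)ˣ → M) :
    ∑ μ, F μ = ∑ n ∈ Finset.range (p - 1), F (D.lam ^ n) := by
  classical
  rw [← IsCyclic.image_range_orderOf D.lam_generates, D.orderOf_lam, Finset.sum_image]
  intro i hi j hj h
  refine pow_injOn_Iio_orderOf (x := D.lam) ?_ ?_ h
  · rw [D.orderOf_lam]; simpa using hi
  · rw [D.orderOf_lam]; simpa using hj

lemma sum_range_two_mul {M : Type*} [AddCommMonoid M] (g : ℕ → M) (n : ℕ) :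
    ∑ i ∈ Finset.range (2 * n), g i = ∑ i ∈ Finset.range n, (g (2 * i) + g (2 * i + 1)) := by
  induction n with
  | zero => simp
  | succ n ih =>
    rw [mul_add, mul_one, Finset.sum_range_succ, Finset.sum_range_succ, ih, Finset.sum_range_succ,
      add_assoc]

lemma lam_pow_card : (D.lam : ZMod p) ^ (p - 1) = 1 := by
  rw [← Units.val_pow_eq_pow_val, unit_pow_card_sub_one, Units.val_one]

/-- The sum of an additive character over the squares of the units is twice a Gauss period. -/
lemma sum_addChar_sq (hp : p ≠ 2) (x : ZMod p) :
    ∑ μ : (ZMod p)ˣ, D.addChar (x * (μ : ZMod p) ^ 2) = 2 * D.gaussPeriod x := by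
  rw [D.sum_units, ← two_mul_half hp, two_mul, Finset.sum_range_add, gaussPeriod_eq, two_mul]
  have h2 : ∀ n, (D.lam : ZMod p) ^ (2 * (half p + n)) = (D.lam : ZMod p) ^ (2 * n) := fun n => by
    rw [mul_add, two_mul_half hp, pow_add, lam_pow_card, one_mul]
  congr 1
  · refine Finset.sum_congr rfl fun n _ => ?_
    rw [Units.val_pow_eq_pow_val, ← pow_mul, mul_comm n]
  · refine Finset.sum_congr rfl fun n _ => ?_
    rw [Units.val_pow_eq_pow_val, ← pow_mul, mul_comm _ 2, h2]

lemma gaussPeriod_mul_sq (hp : p ≠ 2) (x : ZMod p) (μ : (ZMod p)ˣ) :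
    D.gaussPeriod (x * (μ : ZMod p) ^ 2) = D.gaussPeriod x := by
  refine mul_left_cancel₀ (two_ne_zero (α := ℂ)) ?_
  rw [← D.sum_addChar_sq hp, ← D.sum_addChar_sq hp,
    ← Equiv.sum_comp (Equiv.mulLeft μ) fun ν : (ZMod p)ˣ => D.addChar (x * (ν : ZMod p) ^ 2)]
  refine Finset.sum_congr rfl fun ν _ => ?_
  rw [Equiv.coe_mulLeft, Units.val_mul, mul_pow, mul_assoc]

lemma t_ne_zero : D.t ≠ 0 := fun h => D.t_nonsquare (h ▸ IsSquare.zero)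

lemma not_isSquare_lam (hp : p ≠ 2) : ¬ IsSquare (D.lam : ZMod p) := by
  rintro ⟨r, hr⟩
  have hr0 : r ≠ 0 := by
    rintro rfl
    exact D.lam.ne_zero (by rw [hr, mul_zero])
  have h1 : D.lam = (Units.mk0 r hr0) ^ 2 := Units.ext (by rw [hr]; push_cast; rw [sq]; rfl)
  have h2 : D.lam ^ half p = 1 := by
    rw [h1, ← pow_mul, two_mul_half hp, unit_pow_card_sub_one]
  rw [D.lam_pow_half hp] at h2
  exact unit_one_ne_neg_one hp h2.symm

/-- The two Gauss periods attached to the squares and to the nonsquares add up to `-1`. -/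
lemma gaussPeriod_add (hp : p ≠ 2) {x : ZMod p} (hx : x ≠ 0) :
    D.gaussPeriod x + D.gaussPeriod (D.t * x) = -1 := by
  classical
  have ht : D.gaussPeriod (D.t * x) = D.gaussPeriod (x * D.lam) := by
    obtain ⟨y, hy⟩ := exists_sq_or_mul_sq (D.not_isSquare_lam hp) D.t
    rcases hy with hy | hy
    · exact absurd ⟨y, by rw [hy, sq]⟩ D.t_nonsquare
    · have hy0 : y ≠ 0 := by
        rintro rfl
        exact D.t_ne_zero (by rw [hy]; ring)
      rw [← D.gaussPeriod_mul_sq hp (x * D.lam) (Units.mk0 y hy0), hy, Units.val_mk0]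
      congr 1
      ring
  have h1 : ∑ μ : (ZMod p)ˣ, D.addChar (x * μ) = -1 := by
    have h2 := AddChar.sum_mulShift x D.addChar_primitive
    rw [if_neg hx, ← Finset.add_sum_erase _ _ (Finset.mem_univ (0 : ZMod p)), zero_mul,
      AddChar.map_zero_eq_one] at h2
    have h3 : ∑ μ : (ZMod p)ˣ, D.addChar (x * μ) =
        ∑ y ∈ Finset.univ.erase (0 : ZMod p), D.addChar (y * x) := by
      refine Finset.sum_bij (fun μ _ => (μ : ZMod p)) (fun μ _ => by simp)
        (fun μ _ ν _ h => Units.ext h)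
        (fun y hy => ⟨Units.mk0 y (Finset.ne_of_mem_erase hy), Finset.mem_univ _, rfl⟩)
        (fun μ _ => by rw [mul_comm])
    rw [h3]
    simpa [add_comm, eq_neg_iff_add_eq_zero] using h2
  rw [ht, ← h1, D.sum_units, ← two_mul_half hp, sum_range_two_mul, gaussPeriod_eq, gaussPeriod_eq,
    ← Finset.sum_add_distrib]
  refine Finset.sum_congr rfl fun l _ => ?_
  push_cast
  congr 2
  ring

/-- A uniform description of `chiInd`. -/
lemma chiInd_apply (hp : p ≠ 2) (s : ZMod p) (k : ℕ) {u : U p} (hu : topLeft u ^ 2 = 1) :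
    D.chiInd s k u =
      D.zhom (topLeft u) ^ k * D.gaussPeriod (s * (u.1.1 0 0 * u.1.1 0 1)) := by
  unfold chiInd
  rcases unit_sq_eq_one.1 hu with h | h
  · have h0 : u.1.1 0 0 = 1 := by rw [entry_zero_zero, h, Units.val_one]
    rw [if_pos h0, h, map_one, one_pow, one_mul, h0, one_mul]
  · have h0 : u.1.1 0 0 = -1 := by rw [entry_zero_zero, h]; push_cast; rfl
    have h1 : u.1.1 0 0 ≠ 1 := fun hc => by
      rw [h0] at hc
      exact two_ne_zero_of_odd hp (by linear_combination -hc)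
    rw [if_neg h1, if_pos h0, h, D.zhom_neg_one hp, h0, neg_one_mul]

lemma chiInd_apply_of_ne (s : ZMod p) (k : ℕ) {u : U p} (hu : topLeft u ^ 2 ≠ 1) :
    D.chiInd s k u = 0 := by
  rw [Ne, unit_sq_eq_one, not_or] at hu
  unfold chiInd
  rw [if_neg, if_neg]
  · exact fun h => hu.2 (Units.ext (by rw [← entry_zero_zero, h]; push_cast; rfl))
  · exact fun h => hu.1 (Units.ext (by rw [← entry_zero_zero, h]; push_cast; rfl))

omit hpf in
lemma chiInd_congr (s : ZMod p) {k k' : ℕ} (h : k % 2 = k' % 2) : D.chiInd s k = D.chiInd s k' := by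
  have : (-1 : ℂ) ^ k = (-1) ^ k' := by
    rw [neg_one_pow_eq_pow_mod_two, h, ← neg_one_pow_eq_pow_mod_two]
  ext u
  unfold chiInd
  rw [this]

/-- The linear character `(-1)^ν b^τ ↦ (-1)^(ν k) eta^(s τ)` of `⟨-1, b⟩`. -/
def signUnipHom (s : ZMod p) (k : ℕ) : signUnip p →* ℂ where
  toFun u := D.zhom (topLeft u.1) ^ k * D.addChar (s * (u.1.1.1 0 0 * u.1.1.1 0 1))
  map_one' := by
    have h : ((1 : signUnip p) : U p).1.1 0 1 = 0 := SL2.one_entries.2.1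
    rw [h, mul_zero, mul_zero, AddChar.map_zero_eq_one]
    simp
  map_mul' u v := by
    have hu : u.1.1.1 0 0 ^ 2 = 1 := congrArg Units.val (mem_signUnip.1 u.2)
    have hv : v.1.1.1 0 0 * v.1.1.1 1 1 = 1 := (topLeft v.1).mul_inv
    have h00 : ((u * v : signUnip p) : U p).1.1 0 0 = u.1.1.1 0 0 * v.1.1.1 0 0 :=
      congrArg Units.val (map_mul topLeft u.1 v.1)
    have h01 : ((u * v : signUnip p) : U p).1.1 0 1 =
        u.1.1.1 0 0 * v.1.1.1 0 1 + u.1.1.1 0 1 * v.1.1.1 1 1 := SL2.mul_entry _ _ _ _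
    have h1 : s * (((u * v : signUnip p) : U p).1.1 0 0 * ((u * v : signUnip p) : U p).1.1 0 1) =
        s * (u.1.1.1 0 0 * u.1.1.1 0 1) + s * (v.1.1.1 0 0 * v.1.1.1 0 1) := by
      rw [h00, h01]
      linear_combination s * v.1.1.1 0 0 * v.1.1.1 0 1 * hu + s * u.1.1.1 0 0 * u.1.1.1 0 1 * hv
    rw [h1, AddChar.map_add_eq_mul, Subgroup.coe_mul, map_mul, map_mul, mul_pow]
    ring

lemma signUnipHom_apply (s : ZMod p) (k : ℕ) (u : signUnip p) :
    D.signUnipHom s k u =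
      D.zhom (topLeft u.1) ^ k * D.addChar (s * (u.1.1.1 0 0 * u.1.1.1 0 1)) := rfl

/-- `chiInd s k` is induced from a linear character of `⟨-1, b⟩`. -/
theorem induced_signUnipHom (hp : p ≠ 2) (s : ZMod p) (k : ℕ) :
    induced (signUnip p) (D.signUnipHom s k) = D.chiInd s k := by
  ext u
  rw [induced_apply]
  have htl : ∀ x : U p, topLeft (x⁻¹ * u * x) = topLeft u := fun x => by
    rw [map_mul, map_mul, map_inv, mul_comm, mul_inv_cancel_left]
  by_cases hu : topLeft u ^ 2 = 1
  · have hconj : ∀ (μ : (ZMod p)ˣ) (y : ZMod p),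
        extendZero (signUnip p) (D.signUnipHom s k) ((upper μ y)⁻¹ * u * upper μ y) =
        D.zhom (topLeft u) ^ k * D.addChar (s * (u.1.1 0 0 * u.1.1 0 1) *
          ((μ⁻¹ : (ZMod p)ˣ) : ZMod p) ^ 2) := by
      intro μ y
      have hmem : (upper μ y)⁻¹ * u * upper μ y ∈ signUnip p := by
        rw [mem_signUnip, htl, hu]
      rw [extendZero_of_mem _ _ hmem, signUnipHom_apply, htl]
      have e00 : ((upper μ y)⁻¹ * u * upper μ y).1.1 0 0 = u.1.1 0 0 :=
        congrArg Units.val (htl _)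
      have hu2 : u.1.1 0 0 ^ 2 = 1 := congrArg Units.val hu
      have hu3 : u.1.1 0 0 * u.1.1 1 1 = 1 := (topLeft u).mul_inv
      have hu4 : u.1.1 1 1 = u.1.1 0 0 := by
        linear_combination u.1.1 0 0 * hu3 - u.1.1 1 1 * hu2
      have e01 : ((upper μ y)⁻¹ * u * upper μ y).1.1 0 1 =
          u.1.1 0 1 * ((μ⁻¹ : (ZMod p)ˣ) : ZMod p) ^ 2 := by
        obtain ⟨i00, i01, i10, i11⟩ := SL2.inv_entries (upper μ y).1
        change ((upper μ y).1⁻¹ * u.1 * (upper μ y).1).1 0 1 = _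
        simp only [SL2.mul_entry, i00, i01]
        have w00 : (upper μ y).1.1 0 0 = (μ : ZMod p) := rfl
        have w01 : (upper μ y).1.1 0 1 = y := rfl
        have w11 : (upper μ y).1.1 1 1 = ((μ⁻¹ : (ZMod p)ˣ) : ZMod p) := rfl
        rw [w01, w11, hu4, entry_one_zero]
        ring
      rw [e00, e01]
      congr 2
      ring
    rw [sum_U]
    simp only [hconj, Finset.sum_const, Finset.card_univ, ZMod.card, nsmul_eq_mul]
    rw [← Finset.mul_sum, ← Finset.mul_sum, D.chiInd_apply hp s k hu,
      ← Equiv.sum_comp (Equiv.inv (ZMod p)ˣ)]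
    simp only [Equiv.inv_apply, inv_inv]
    rw [D.sum_addChar_sq hp, card_signUnip hp]
    have : (p : ℂ) ≠ 0 := by exact_mod_cast hpf.out.ne_zero
    push_cast
    field_simp
  · rw [D.chiInd_apply_of_ne s k hu, Finset.sum_eq_zero, mul_zero]
    intro x _
    rw [extendZero_of_notMem]
    rwa [mem_signUnip, htl]

lemma isClassFun_chiInd (hp : p ≠ 2) (s : ZMod p) (k : ℕ) : IsClassFun (D.chiInd s k) := by
  rw [← D.induced_signUnipHom hp]
  exact isClassFun_induced _ _

lemma signUnipHom_injective (hp : p ≠ 2) {s s' : ZMod p} {k k' : ℕ}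
    (h : (D.signUnipHom s k : signUnip p → ℂ) = D.signUnipHom s' k') :
    s = s' ∧ k % 2 = k' % 2 := by
  constructor
  · have hm : upper 1 1 ∈ signUnip p := by rw [mem_signUnip, topLeft_upper, one_pow]
    have h1 := congrFun h ⟨upper 1 1, hm⟩
    have w00 : (upper (1 : (ZMod p)ˣ) 1).1.1 0 0 = 1 := rfl
    have w01 : (upper (1 : (ZMod p)ˣ) 1).1.1 0 1 = 1 := rfl
    rw [signUnipHom_apply, signUnipHom_apply] at h1
    simp only [topLeft_upper, map_one, one_pow, one_mul, w00, w01, mul_one] at h1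
    rw [← sub_eq_zero, ← D.addChar_eq_one_iff, AddChar.map_sub_eq_div, h1]
    exact div_self (AddChar.val_isUnit _ _).ne_zero
  · have hm : upper (-1) 0 ∈ signUnip p := by rw [mem_signUnip, topLeft_upper, neg_one_sq]
    have h1 := congrFun h ⟨upper (-1) 0, hm⟩
    have w01 : (upper (-1 : (ZMod p)ˣ) 0).1.1 0 1 = 0 := rfl
    rw [signUnipHom_apply, signUnipHom_apply] at h1
    simp only [topLeft_upper, w01, mul_zero, AddChar.map_zero_eq_one, mul_one,
      D.zhom_neg_one hp] at h1
    rcases Nat.mod_two_eq_zero_or_one k with e | e <;>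
      rcases Nat.mod_two_eq_zero_or_one k' with e' | e' <;>
      rw [neg_one_pow_eq_pow_mod_two, neg_one_pow_eq_pow_mod_two (n := k'), e, e'] at h1 <;>
      norm_num at h1 <;> omega

lemma res_chiInd (hp : p ≠ 2) (s : ZMod p) (k : ℕ) :
    res (signUnip p) (D.chiInd s k) = ∑ l ∈ Finset.range (half p),
      (D.signUnipHom (s * (D.lam : ZMod p) ^ (2 * l)) k : signUnip p → ℂ) := by
  ext u
  rw [res, D.chiInd_apply hp s k (mem_signUnip.1 u.2), gaussPeriod_eq, Finset.mul_sum,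
    Finset.sum_apply]
  refine Finset.sum_congr rfl fun l _ => ?_
  rw [signUnipHom_apply]
  congr 2
  ring

/-- The two values of the parameter `s` for which `chiInd s k` is used. -/
def IsParam (s : ZMod p) : Prop := s = 1 ∨ s = D.t

open scoped Classical in
theorem charInner_chiInd (hp : p ≠ 2) {s s' : ZMod p} (hs : D.IsParam s) (hs' : D.IsParam s')
    (k k' : ℕ) : charInner (D.chiInd s k) (D.chiInd s' k') =
      if s = s' ∧ k % 2 = k' % 2 then 1 else 0 := by
  have key : ∀ l < half p, s = s' * (D.lam : ZMod p) ^ (2 * l) ↔ s = s' ∧ l = 0 := by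
    intro l hl
    refine ⟨fun h => ?_, fun h => by simp [h.1, h.2]⟩
    have hsq : IsSquare ((D.lam : ZMod p) ^ (2 * l)) := ⟨(D.lam : ZMod p) ^ l, by ring⟩
    have hss : s = s' := by
      rcases hs with rfl | rfl <;> rcases hs' with rfl | rfl
      · rfl
      · exfalso
        apply D.t_nonsquare
        rw [eq_comm, mul_comm] at h
        rw [eq_inv_of_mul_eq_one_right h]
        exact hsq.inv
      · exfalso
        apply D.t_nonsquare
        rw [h, one_mul]
        exact hsq
      · rfl
    refine ⟨hss, ?_⟩
    have hs0 : s ≠ 0 := by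
      rcases hs with rfl | rfl
      exacts [one_ne_zero, D.t_ne_zero]
    rw [← hss, eq_comm, mul_eq_left₀ hs0, ← Units.val_pow_eq_pow_val, Units.val_eq_one,
      ← orderOf_dvd_iff_pow_eq_one, orderOf_lam] at h
    by_contra hl0
    have := Nat.le_of_dvd (by omega) h
    have := two_mul_half (p := p) hp
    omega
  rw [← D.induced_signUnipHom hp s k, charInner_induced _ _ (D.isClassFun_chiInd hp s' k'),
    D.res_chiInd hp, charInner_sum_right]
  have hterm : ∀ l ∈ Finset.range (half p), charInner (D.signUnipHom s k : signUnip p → ℂ)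
      (D.signUnipHom (s' * (D.lam : ZMod p) ^ (2 * l)) k') =
      if l = 0 then (if s = s' ∧ k % 2 = k' % 2 then 1 else 0) else 0 := by
    intro l hl
    rw [Finset.mem_range] at hl
    rw [(isIrrChar_of_hom _).charInner_eq (isIrrChar_of_hom _)]
    by_cases hl0 : l = 0
    · subst hl0
      rw [if_pos rfl, mul_zero, pow_zero, mul_one]
      refine if_congr ⟨D.signUnipHom_injective hp, fun h => ?_⟩ rfl rfl
      ext u
      rw [signUnipHom_apply, signUnipHom_apply, h.1]
      congr 1
      rcases unit_sq_eq_one.1 (mem_signUnip.1 u.2) with h1 | h1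
      · rw [h1, map_one, one_pow, one_pow]
      · rw [h1, D.zhom_neg_one hp, neg_one_pow_eq_pow_mod_two, h.2, ← neg_one_pow_eq_pow_mod_two]
    · rw [if_neg hl0, if_neg]
      intro h
      exact hl0 ((key l hl).1 (D.signUnipHom_injective hp h).1).2
  rw [Finset.sum_congr rfl hterm, Finset.sum_ite_eq' , if_pos]
  exact Finset.mem_range.2 (half_pos hp)

theorem isIrrChar_chiInd (hp : p ≠ 2) {s : ZMod p} (hs : D.IsParam s) (k : ℕ) :
    IsIrrChar (D.chiInd s k) := by
  refine IsVirtualChar.isIrrChar ?_ ?_ ?_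
  · rw [← D.induced_signUnipHom hp]
    exact isVirtualChar_induced _ (isIrrChar_of_hom _)
  · rw [D.charInner_chiInd hp hs hs, if_pos ⟨rfl, rfl⟩]
  · unfold chiInd
    rw [if_pos (by exact SL2.one_entries.1)]
    have : (1 : U p).1.1 0 1 = 0 := SL2.one_entries.2.1
    rw [this, mul_zero, gaussPeriod_zero]
    exact_mod_cast Nat.zero_le _

lemma chiInd_ne_chiLin (hp : p ≠ 2) {s : ZMod p} (hs : D.IsParam s) (k j : ℕ) :
    D.chiInd s k ≠ D.chiLin j := by
  have hs0 : s ≠ 0 := by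
    rcases hs with rfl | rfl
    exacts [one_ne_zero, D.t_ne_zero]
  intro h
  have h1 : charInner (D.chiInd s k) (D.chiLin j) = 0 := by
    rw [← D.induced_signUnipHom hp s k, charInner_induced _ _ (D.isIrrChar_chiLin j).isClassFun]
    have : res (signUnip p) (D.chiLin j) = (D.signUnipHom 0 j : signUnip p → ℂ) := by
      ext u
      rw [res, chiLin_apply, signUnipHom_apply, zero_mul, AddChar.map_zero_eq_one, mul_one]
    rw [this, (isIrrChar_of_hom _).charInner_ne (isIrrChar_of_hom _)]
    exact fun hc => hs0 (D.signUnipHom_injective hp hc).1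
  rw [← h, (D.isIrrChar_chiInd hp hs k).charInner_self] at h1
  exact one_ne_zero h1

end Choices

/-! ### Parity sums -/

/-- The indicator of the congruence `i ≡ k` modulo `2`. -/
def parity (k i : ℕ) : ℂ := if i % 2 = k % 2 then 1 else 0

lemma parity_even (k j : ℕ) : parity k (2 * j) = parity k 0 := by
  unfold parity
  rw [Nat.mul_mod_right]

lemma parity_odd (k j : ℕ) : parity k (2 * j + 1) = parity k 1 := by
  unfold parity
  congr 2
  omega

lemma parity_reflect (k M i : ℕ) (h : i ≤ 2 * M) : parity k (2 * M - i) = parity k i := by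
  unfold parity
  congr 2
  omega

lemma sum_parity_mul_pow (k M : ℕ) (z : ℂ) :
    ∑ i ∈ Finset.range (2 * M), parity k i * z ^ i =
      z ^ (k % 2) * ∑ j ∈ Finset.range M, (z ^ 2) ^ j := by
  rw [Choices.sum_range_two_mul, Finset.mul_sum]
  refine Finset.sum_congr rfl fun j _ => ?_
  rw [parity_even, parity_odd]
  unfold parity
  rcases Nat.mod_two_eq_zero_or_one k with h | h <;> rw [h] <;> norm_num <;> ring

lemma sum_parity_mul_pow_of_sq_eq (k M : ℕ) {z : ℂ} (hz : z ^ 2 = 1) :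
    ∑ i ∈ Finset.range (2 * M), parity k i * z ^ i = M * z ^ k := by
  rw [sum_parity_mul_pow, hz]
  simp only [one_pow, Finset.sum_const, Finset.card_range, nsmul_eq_mul, mul_one]
  rw [mul_comm]
  conv_rhs => rw [← Nat.mod_add_div k 2, pow_add, pow_mul, hz, one_pow, mul_one]

lemma sum_parity_mul_pow_of_sq_ne (k M : ℕ) {z : ℂ} (hz : z ^ 2 ≠ 1) (hz' : z ^ (2 * M) = 1) :
    ∑ i ∈ Finset.range (2 * M), parity k i * z ^ i = 0 := by
  rw [sum_parity_mul_pow, geom_sum_eq hz, ← pow_mul, hz', sub_self, zero_div, mul_zero]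

/-- Pairing `i` with `2 * M - i` in a sum over the residues modulo `2 * M`. -/
lemma sum_range_fold {M : ℕ} (hM : 0 < M) (g : ℕ → ℂ) :
    ∑ i ∈ Finset.range (2 * M), g i =
      g 0 + g M + ∑ i ∈ Finset.Ico 1 M, (g i + g (2 * M - i)) := by
  have h1 : ∑ i ∈ Finset.Ico 1 M, g (2 * M - i) = ∑ i ∈ Finset.Ico (M + 1) (2 * M), g i := by
    refine Finset.sum_bij (fun i _ => 2 * M - i) ?_ ?_ ?_ ?_
    · intro i hi
      rw [Finset.mem_Ico] at *
      omega
    · intro i hi j hj h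
      rw [Finset.mem_Ico] at *
      omega
    · intro j hj
      rw [Finset.mem_Ico] at hj
      exact ⟨2 * M - j, Finset.mem_Ico.2 (by omega), by omega⟩
    · intro i _
      rfl
  rw [Finset.sum_add_distrib, h1, Finset.range_eq_Ico,
    ← Finset.sum_Ico_consecutive g (Nat.zero_le M) (by omega : M ≤ 2 * M),
    Finset.sum_eq_sum_Ico_succ_bot hM, Finset.sum_eq_sum_Ico_succ_bot (by omega : M < 2 * M)]
  ring

/-- The number of indices used in the decomposition of a Gelfand-Graev character. -/
lemma sum_parity_count (k : ℕ) {N : ℕ} (hN : 0 < N) :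
    ∑ i ∈ Finset.Ico 1 N, parity k i + ∑ j ∈ Finset.Ico 1 (N + 1), parity k j + parity k 0 = N := by
  have h1 := sum_parity_mul_pow_of_sq_eq k N (z := 1) (one_pow 2)
  simp only [one_pow, mul_one] at h1
  rw [sum_range_fold hN, Finset.sum_congr rfl fun i hi => by
    rw [parity_reflect k N i (by rw [Finset.mem_Ico] at hi; omega)], Finset.sum_add_distrib] at h1
  rw [Finset.sum_Ico_succ_top hN]
  linear_combination h1

/-! ### Induction from `U` -/

section InducedU

variable {p : ℕ} [hpf : Fact p.Prime]

/-- The representatives `(x, -1; 1, 0)` of the cosets of `U` other than `U` itself. -/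
def cosetRep (x : ZMod p) : SL2 p := ⟨!![x, -1; 1, 0], by simp [Matrix.det_fin_two]⟩

/-- The product map of the decomposition of `SL(2,p)` into left cosets of `U`. -/
def cosetMap : Option (ZMod p) × U p → SL2 p
  | (none, u) => u.1
  | (some x, u) => cosetRep x * u.1

lemma cosetRep_mul_entries (x : ZMod p) (u : U p) :
    (cosetRep x * u.1).1 0 0 = x * u.1.1 0 0 ∧ (cosetRep x * u.1).1 1 0 = u.1.1 0 0 ∧
      (cosetRep x * u.1).1 1 1 = u.1.1 0 1 := by
  refine ⟨?_, ?_, ?_⟩ <;> rw [SL2.mul_entry] <;> simp [cosetRep, entry_one_zero]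

lemma topLeft_ne_zero (u : U p) : u.1.1 0 0 ≠ 0 := (topLeft u).ne_zero

lemma U_ext {u v : U p} (h0 : u.1.1 0 0 = v.1.1 0 0) (h1 : u.1.1 0 1 = v.1.1 0 1) : u = v := by
  rw [eq_upper u, eq_upper v, h1, show topLeft u = topLeft v from Units.ext h0]

lemma cosetMap_bijective : Function.Bijective (cosetMap (p := p)) := by
  constructor
  · rintro ⟨_ | x, u⟩ ⟨_ | y, v⟩ h
    · rw [Prod.mk.injEq]
      exact ⟨rfl, Subtype.ext h⟩
    · exfalso
      have h1 : u.1.1 1 0 = (cosetRep y * v.1).1 1 0 := congrArg (fun g : SL2 p => g.1 1 0) h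
      rw [(cosetRep_mul_entries y v).2.1, entry_one_zero] at h1
      exact topLeft_ne_zero v h1.symm
    · exfalso
      have h1 : (cosetRep x * u.1).1 1 0 = v.1.1 1 0 := congrArg (fun g : SL2 p => g.1 1 0) h
      rw [(cosetRep_mul_entries x u).2.1, entry_one_zero] at h1
      exact topLeft_ne_zero u h1
    · have h' : cosetRep x * u.1 = cosetRep y * v.1 := h
      have h1 := congrArg (fun g : SL2 p => g.1 1 0) h'
      have h2 := congrArg (fun g : SL2 p => g.1 1 1) h'
      have h3 := congrArg (fun g : SL2 p => g.1 0 0) h'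
      simp only [(cosetRep_mul_entries x u).2.1, (cosetRep_mul_entries y v).2.1,
        (cosetRep_mul_entries x u).2.2, (cosetRep_mul_entries y v).2.2,
        (cosetRep_mul_entries x u).1, (cosetRep_mul_entries y v).1] at h1 h2 h3
      have huv := U_ext h1 h2
      subst huv
      rw [mul_right_cancel₀ (topLeft_ne_zero u) h3]
  · intro g
    by_cases hg : g.1 1 0 = 0
    · exact ⟨(none, ⟨g, hg⟩), rfl⟩
    · refine ⟨(some (g.1 0 0 / g.1 1 0), upper (Units.mk0 _ hg) (g.1 1 1)), ?_⟩
      have hd := SL2.det_eq g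
      change cosetRep _ * (upper _ _).1 = g
      apply SL2.ext_entries
      · rw [(cosetRep_mul_entries _ _).1]
        change g.1 0 0 / g.1 1 0 * g.1 1 0 = g.1 0 0
        field_simp
      · rw [SL2.mul_entry]
        change g.1 0 0 / g.1 1 0 * g.1 1 1 + -1 * (g.1 1 0)⁻¹ = g.1 0 1
        field_simp
        linear_combination hd
      · rw [(cosetRep_mul_entries _ _).2.1]; rfl
      · rw [(cosetRep_mul_entries _ _).2.2]; rfl

lemma card_SL2 : Nat.card (SL2 p) = (p + 1) * Nat.card (U p) := by
  rw [← Nat.card_congr (Equiv.ofBijective _ cosetMap_bijective), Nat.card_prod,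
    Nat.card_eq_fintype_card (α := Option (ZMod p)), Fintype.card_option, ZMod.card]

/-- The character induced from `U`, as a sum over representatives of the cosets of `U`. -/
theorem induced_U_apply {ψ : U p → ℂ} (hψ : IsClassFun ψ) (g : SL2 p) :
    induced (U p) ψ g = extendZero (U p) ψ g +
      ∑ x : ZMod p, extendZero (U p) ψ ((cosetRep x)⁻¹ * g * cosetRep x) := by
  have hconj : ∀ (r : SL2 p) (u : U p), extendZero (U p) ψ ((r * u.1)⁻¹ * g * (r * u.1)) =
      extendZero (U p) ψ (r⁻¹ * g * r) := by
    intro r u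
    have h1 : (r * u.1)⁻¹ * g * (r * u.1) = u.1⁻¹ * (r⁻¹ * g * r) * u.1 := by group
    rw [h1]
    by_cases h : r⁻¹ * g * r ∈ U p
    · have h2 : u.1⁻¹ * (r⁻¹ * g * r) * u.1 ∈ U p := mul_mem (mul_mem (inv_mem u.2) h) u.2
      rw [extendZero_of_mem _ _ h, extendZero_of_mem _ _ h2]
      have := hψ u⁻¹ ⟨_, h⟩
      rw [inv_inv] at this
      exact this
    · have h2 : u.1⁻¹ * (r⁻¹ * g * r) * u.1 ∉ U p := fun h3 => h (by
        have := mul_mem (mul_mem u.2 h3) (inv_mem u.2)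
        simpa [mul_assoc] using this)
      rw [extendZero_of_notMem _ _ h, extendZero_of_notMem _ _ h2]
  have hcard : (Nat.card (U p) : ℂ) ≠ 0 := card_ne_zero'
  rw [induced_apply, ← Equiv.sum_comp (Equiv.ofBijective _ cosetMap_bijective),
    Fintype.sum_prod_type, Fintype.sum_option]
  have h0 : ∀ u : U p, extendZero (U p) ψ
      ((Equiv.ofBijective _ cosetMap_bijective (none, u))⁻¹ * g *
        Equiv.ofBijective _ cosetMap_bijective (none, u)) = extendZero (U p) ψ g := by
    intro u
    have := hconj 1 u
    rwa [one_mul, inv_one, one_mul, mul_one] at this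
  have h1 : ∀ (x : ZMod p) (u : U p), extendZero (U p) ψ
      ((Equiv.ofBijective _ cosetMap_bijective (some x, u))⁻¹ * g *
        Equiv.ofBijective _ cosetMap_bijective (some x, u)) =
      extendZero (U p) ψ ((cosetRep x)⁻¹ * g * cosetRep x) := fun x u => hconj _ u
  simp only [h0, h1, Finset.sum_const, Finset.card_univ, nsmul_eq_mul,
    ← Nat.card_eq_fintype_card]
  rw [← Finset.mul_sum, ← mul_add, inv_mul_cancel_left₀ hcard]

lemma conj_cosetRep_entries (x : ZMod p) (u : U p) :
    ((cosetRep x)⁻¹ * u.1 * cosetRep x).1 0 0 = u.1.1 1 1 ∧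
    ((cosetRep x)⁻¹ * u.1 * cosetRep x).1 0 1 = 0 ∧
    ((cosetRep x)⁻¹ * u.1 * cosetRep x).1 1 0 =
      -(u.1.1 0 1 + x * (u.1.1 0 0 - u.1.1 1 1)) := by
  obtain ⟨i00, i01, i10, i11⟩ := SL2.inv_entries (cosetRep x)
  have w00 : (cosetRep x).1 0 0 = x := rfl
  have w01 : (cosetRep x).1 0 1 = -1 := rfl
  have w10 : (cosetRep x).1 1 0 = 1 := rfl
  have w11 : (cosetRep x).1 1 1 = 0 := rfl
  simp only [SL2.mul_entry, i00, i01, i10, i11, w00, w01, w10, w11, entry_one_zero]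
  refine ⟨?_, ?_, ?_⟩ <;> ring

lemma entry_one_one_eq {u : U p} (h : topLeft u ^ 2 = 1) : u.1.1 1 1 = u.1.1 0 0 := by
  rw [entry_one_one, entry_zero_zero, inv_eq_of_mul_eq_one_left (by rw [← sq, h])]

/-- The value at `±1` of a character induced from `U`. -/
lemma induced_U_of_central {ψ : U p → ℂ} (hψ : IsClassFun ψ) {u : U p} (h : topLeft u ^ 2 = 1)
    (h0 : u.1.1 0 1 = 0) : induced (U p) ψ u.1 = (p + 1) * ψ u := by
  have hx : ∀ x : ZMod p, (cosetRep x)⁻¹ * u.1 * cosetRep x = u.1 := by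
    intro x
    obtain ⟨e00, e01, e10⟩ := conj_cosetRep_entries x u
    have hmem : (cosetRep x)⁻¹ * u.1 * cosetRep x ∈ U p := by
      change _ = _
      rw [e10, h0, entry_one_one_eq h]
      ring
    refine congrArg Subtype.val (U_ext (u := ⟨_, hmem⟩) (v := u) ?_ ?_)
    · rw [e00, entry_one_one_eq h]
    · rw [e01, h0]
  rw [induced_U_apply hψ]
  simp only [hx, extendZero_of_mem _ _ u.2, Finset.sum_const, Finset.card_univ, ZMod.card,
    nsmul_eq_mul]
  ring

/-- A noncentral element of `U` with diagonal `(±1, ±1)` fixes only one coset of `U`. -/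
lemma induced_U_of_unip {ψ : U p → ℂ} (hψ : IsClassFun ψ) {u : U p} (h : topLeft u ^ 2 = 1)
    (h0 : u.1.1 0 1 ≠ 0) : induced (U p) ψ u.1 = ψ u := by
  rw [induced_U_apply hψ, extendZero_of_mem _ _ u.2, Finset.sum_eq_zero, add_zero]
  intro x _
  rw [extendZero_of_notMem]
  intro hmem
  have h1 : ((cosetRep x)⁻¹ * u.1 * cosetRep x).1 1 0 = 0 := hmem
  rw [(conj_cosetRep_entries x u).2.2, entry_one_one_eq h, sub_self, mul_zero, add_zero,
    neg_eq_zero] at h1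
  exact h0 h1

/-- An element of `U` with distinct eigenvalues fixes two cosets of `U`. -/
lemma induced_U_of_split {ψ : U p → ℂ} (hψ : IsClassFun ψ) {u : U p} (h : topLeft u ^ 2 ≠ 1) :
    induced (U p) ψ u.1 = ψ u + ψ (upper (topLeft u)⁻¹ 0) := by
  have hne : u.1.1 0 0 - u.1.1 1 1 ≠ 0 := by
    intro h1
    apply h
    rw [entry_one_one, entry_zero_zero, sub_eq_zero] at h1
    rw [sq, ← mul_inv_cancel (topLeft u)]
    congr 1
    exact Units.ext h1
  rw [induced_U_apply hψ, extendZero_of_mem _ _ u.2, add_right_inj,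
    Finset.sum_eq_single (-(u.1.1 0 1) / (u.1.1 0 0 - u.1.1 1 1))]
  · obtain ⟨e00, e01, e10⟩ :=
      conj_cosetRep_entries (-(u.1.1 0 1) / (u.1.1 0 0 - u.1.1 1 1)) u
    have hmem : (cosetRep (-(u.1.1 0 1) / (u.1.1 0 0 - u.1.1 1 1)))⁻¹ * u.1 *
        cosetRep (-(u.1.1 0 1) / (u.1.1 0 0 - u.1.1 1 1)) ∈ U p := by
      change _ = _
      rw [e10]
      field_simp
      ring
    rw [extendZero_of_mem _ _ hmem]
    congr 1
    exact U_ext e00 e01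
  · intro x _ hx
    rw [extendZero_of_notMem]
    intro hmem
    have h1 : ((cosetRep x)⁻¹ * u.1 * cosetRep x).1 1 0 = 0 := hmem
    rw [(conj_cosetRep_entries x u).2.2] at h1
    apply hx
    field_simp
    linear_combination -h1
  · exact fun h => absurd (Finset.mem_univ _) h

lemma tr_coe_U (u : U p) : tr u.1 = tr (diagSL (topLeft u)) := rfl

/-- Characters induced from `U` vanish off the conjugates of `U`. -/
lemma induced_U_of_nonsplit (ψ : U p → ℂ) {g : SL2 p} (hg : ¬ IsSquare (tr g ^ 2 - 4)) :
    induced (U p) ψ g = 0 := by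
  rw [induced_apply, Finset.sum_eq_zero, mul_zero]
  intro x _
  rw [extendZero_of_notMem]
  intro hmem
  apply hg
  rw [← tr_conj x g, tr_coe_U ⟨_, hmem⟩]
  exact Choices.isSquare_disc_diagSL _

end InducedU

namespace Choices

variable {p : ℕ} [hpf : Fact p.Prime] (D : Choices p)

/-! ### Restrictions to `U` of induced characters -/

lemma half_cast (hp : p ≠ 2) : (2 : ℂ) * half p + 1 = p := by
  have h := two_mul_half (p := p) hp
  have := hpf.out.two_le
  have h2 : 2 * half p + 1 = p := by omega
  exact_mod_cast h2

/-- The sum of the two nonlinear irreducible characters of `U` with a given central character. -/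
def chiSum (k : ℕ) : U p → ℂ := D.chiInd 1 k + D.chiInd D.t k

lemma zhom_sq {μ : (ZMod p)ˣ} (h : μ ^ 2 = 1) : D.zhom μ ^ 2 = 1 := by
  rw [← map_pow, h, map_one]

lemma chiInd_of_central (hp : p ≠ 2) (s : ZMod p) (k : ℕ) {u : U p} (h : topLeft u ^ 2 = 1)
    (h0 : u.1.1 0 1 = 0) : D.chiInd s k u = half p * D.zhom (topLeft u) ^ k := by
  rw [D.chiInd_apply hp s k h, h0, mul_zero, mul_zero, gaussPeriod_zero, mul_comm]

lemma chiSum_of_central (hp : p ≠ 2) (k : ℕ) {u : U p} (h : topLeft u ^ 2 = 1)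
    (h0 : u.1.1 0 1 = 0) : D.chiSum k u = (p - 1) * D.zhom (topLeft u) ^ k := by
  rw [chiSum, Pi.add_apply, D.chiInd_of_central hp _ k h h0, D.chiInd_of_central hp _ k h h0]
  linear_combination D.zhom (topLeft u) ^ k * half_cast hp

lemma chiSum_of_unip (hp : p ≠ 2) (k : ℕ) {u : U p} (h : topLeft u ^ 2 = 1)
    (h0 : u.1.1 0 1 ≠ 0) : D.chiSum k u = -D.zhom (topLeft u) ^ k := by
  rw [chiSum, Pi.add_apply, D.chiInd_apply hp _ k h, D.chiInd_apply hp _ k h, one_mul, ← mul_add,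
    D.gaussPeriod_add hp (mul_ne_zero (topLeft_ne_zero u) h0), mul_neg_one]

lemma chiSum_of_split (k : ℕ) {u : U p} (h : topLeft u ^ 2 ≠ 1) : D.chiSum k u = 0 := by
  rw [chiSum, Pi.add_apply, D.chiInd_apply_of_ne _ k h, D.chiInd_apply_of_ne _ k h, add_zero]

/-- The decomposition of the part of the regular character of `U` with a given central
character. -/
theorem regular_decomposition (hp : p ≠ 2) (k : ℕ) (u : U p) :
    ∑ i ∈ Finset.range (p - 1), parity k i * D.chiLin i u + half p * D.chiSum k u =
      if topLeft u ^ 2 = 1 ∧ u.1.1 0 1 = 0 then (p : ℂ) * half p * D.zhom (topLeft u) ^ k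
      else 0 := by
  simp only [chiLin_apply]
  rw [← two_mul_half hp]
  by_cases h : topLeft u ^ 2 = 1
  · rw [sum_parity_mul_pow_of_sq_eq k _ (D.zhom_sq h)]
    by_cases h0 : u.1.1 0 1 = 0
    · rw [if_pos ⟨h, h0⟩, D.chiSum_of_central hp k h h0]
      ring
    · rw [if_neg (fun hc => h0 hc.2), D.chiSum_of_unip hp k h h0]
      ring
  · rw [if_neg (fun hc => h hc.1), D.chiSum_of_split k h, sum_parity_mul_pow_of_sq_ne]
    · ring
    · rw [← map_pow]
      exact fun hc => h (D.zhom_eq_one_iff.1 hc)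
    · rw [two_mul_half hp, zhom_pow_card]

lemma chiLin_reflect_apply {i : ℕ} (hi : i ≤ p - 1) (u : U p) :
    D.chiLin (p - 1 - i) u = (D.zhom (topLeft u) ^ i)⁻¹ := by
  refine eq_inv_of_mul_eq_one_left ?_
  rw [chiLin_apply, ← pow_add, Nat.sub_add_cancel hi, zhom_pow_card]

lemma zhom_inv (μ : (ZMod p)ˣ) : D.zhom μ⁻¹ = (D.zhom μ)⁻¹ :=
  eq_inv_of_mul_eq_one_left (by rw [← map_mul, inv_mul_cancel, map_one])

lemma inv_eq_self_of_sq {z : ℂ} (h : z ^ 2 = 1) : z⁻¹ = z :=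
  inv_eq_of_mul_eq_one_left (by rw [← sq, h])

/-- The principal series character. -/
def principal (i : ℕ) : SL2 p → ℂ := induced (U p) (D.chiLin i)

theorem res_principal (hp : p ≠ 2) {i : ℕ} (hi : i ≤ p - 1) :
    res (U p) (D.principal i) = D.chiLin i + D.chiLin (p - 1 - i) + D.chiSum i := by
  ext u
  have hcl := (D.isIrrChar_chiLin i).isClassFun
  rw [res, principal, Pi.add_apply, Pi.add_apply, D.chiLin_reflect_apply hi]
  by_cases h : topLeft u ^ 2 = 1
  · have hz : (D.zhom (topLeft u) ^ i) ^ 2 = 1 := by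
      rw [← pow_mul, mul_comm, pow_mul, D.zhom_sq h, one_pow]
    rw [inv_eq_self_of_sq hz]
    by_cases h0 : u.1.1 0 1 = 0
    · rw [induced_U_of_central hcl h h0, D.chiSum_of_central hp i h h0, chiLin_apply]
      ring
    · rw [induced_U_of_unip hcl h h0, D.chiSum_of_unip hp i h h0, chiLin_apply]
      ring
  · rw [induced_U_of_split hcl h, D.chiSum_of_split i h, add_zero, chiLin_apply, chiLin_apply,
      topLeft_upper, zhom_inv, inv_pow]

/-- The Gelfand-Graev character with parameter `s` and a prescribed central character. -/
def gelfandGraev (s : ZMod p) (k : ℕ) : SL2 p → ℂ := induced (U p) (D.chiInd s k)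

theorem res_gelfandGraev_apply (hp : p ≠ 2) (s : ZMod p) (k : ℕ) (u : U p) :
    res (U p) (D.gelfandGraev s k) u = D.chiInd s k u +
      if topLeft u ^ 2 = 1 ∧ u.1.1 0 1 = 0 then (p : ℂ) * half p * D.zhom (topLeft u) ^ k
      else 0 := by
  have hcl := D.isClassFun_chiInd hp s k
  rw [res, gelfandGraev]
  by_cases h : topLeft u ^ 2 = 1
  · by_cases h0 : u.1.1 0 1 = 0
    · rw [induced_U_of_central hcl h h0, if_pos ⟨h, h0⟩, D.chiInd_of_central hp s k h h0]
      ring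
    · rw [induced_U_of_unip hcl h h0, if_neg (fun hc => h0 hc.2), add_zero]
  · rw [induced_U_of_split hcl h, if_neg (fun hc => h hc.1), D.chiInd_apply_of_ne s k h,
      D.chiInd_apply_of_ne]
    rw [topLeft_upper, inv_pow, Ne, inv_eq_one]
    exact h

/-! ### Induction from the nonsplit torus -/

/-- The nonsplit torus `⟨f⟩`. -/
abbrev torus : Subgroup (SL2 p) := Subgroup.zpowers D.f

instance : Fintype D.torus := Fintype.ofFinite _

omit hpf in
lemma card_torus : Nat.card D.torus = p + 1 := by
  rw [Nat.card_zpowers, D.f_order]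

/-- The character of `⟨f⟩` sending `f` to `sigma`. -/
def torusHom : D.torus →* ℂ :=
  (Units.coeHom ℂ).comp (monoidHomOfForallMemZpowers
    (g := (⟨D.f, Subgroup.mem_zpowers D.f⟩ : D.torus))
    (g' := (D.sigma_primitive.isUnit (Nat.succ_ne_zero p)).unit)
    (fun x => by
      obtain ⟨n, hn⟩ := Subgroup.mem_zpowers_iff.1 x.2
      exact Subgroup.mem_zpowers_iff.2 ⟨n, Subtype.ext hn⟩)
    (by
      rw [Subgroup.orderOf_mk, D.f_order]
      apply orderOf_dvd_of_pow_eq_one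
      apply Units.ext
      rw [Units.val_pow_eq_pow_val, IsUnit.unit_spec, D.sigma_primitive.pow_eq_one, Units.val_one]))

omit hpf in
lemma torusHom_f : D.torusHom ⟨D.f, Subgroup.mem_zpowers D.f⟩ = D.sigma := by
  rw [torusHom, MonoidHom.comp_apply, monoidHomOfForallMemZpowers_apply_gen]
  rfl

/-- The `j`-th power of `torusHom`. -/
def torusPow (j : ℕ) : D.torus →* ℂ := (powMonoidHom j).comp D.torusHom

omit hpf in
lemma torusPow_apply (j : ℕ) (x : D.torus) : D.torusPow j x = D.torusHom x ^ j := rfl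

omit hpf in
lemma f_pow_mem (m : ℕ) : D.f ^ m ∈ D.torus := pow_mem (Subgroup.mem_zpowers D.f) m

omit hpf in
lemma torusHom_f_pow (m : ℕ) : D.torusHom ⟨D.f ^ m, D.f_pow_mem m⟩ = D.sigma ^ m := by
  rw [← torusHom_f, ← map_pow]
  rfl

omit hpf in
lemma torus_commute (x : D.torus) : x.1 * D.f = D.f * x.1 := by
  obtain ⟨n, hn⟩ := Subgroup.mem_zpowers_iff.1 x.2
  rw [← hn]
  exact (Commute.refl D.f).zpow_left n

omit hpf in
lemma torus_mul_comm (x y : D.torus) : x.1 * y.1 = y.1 * x.1 := by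
  obtain ⟨n, hn⟩ := Subgroup.mem_zpowers_iff.1 y.2
  rw [← hn]
  exact (show Commute x.1 D.f from D.torus_commute x).zpow_right n

lemma neg_one_mem_torus (hp : p ≠ 2) : (-1 : SL2 p) ∈ D.torus := by
  rw [← D.f_pow_half_succ hp]
  exact D.f_pow_mem _

lemma torusHom_neg_one (hp : p ≠ 2) : D.torusHom ⟨-1, D.neg_one_mem_torus hp⟩ = -1 := by
  have hN := two_mul_half (p := p) hp
  have hp2 := hpf.out.two_le
  have h1 : D.torusHom ⟨-1, D.neg_one_mem_torus hp⟩ = D.sigma ^ (half p + 1) := by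
    rw [← torusHom_f_pow]
    congr 1
    exact Subtype.ext (D.f_pow_half_succ hp).symm
  rw [h1]
  have h2 : (D.sigma ^ (half p + 1)) ^ 2 = 1 := by
    rw [← pow_mul, show (half p + 1) * 2 = p + 1 by omega, D.sigma_primitive.pow_eq_one]
  refine (sq_eq_one_iff.1 h2).resolve_left fun h => ?_
  have := Nat.le_of_dvd (by omega) ((D.sigma_primitive.pow_eq_one_iff_dvd _).1 h)
  omega

omit hpf in
lemma torusHom_pow_card (x : D.torus) : D.torusHom x ^ (p + 1) = 1 := by
  rw [← map_pow, ← D.card_torus, pow_card_eq_one', map_one]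

omit hpf in
lemma torusPow_inj {j j' : ℕ} (hj : j < p + 1) (hj' : j' < p + 1)
    (h : (D.torusPow j : D.torus → ℂ) = D.torusPow j') : j = j' := by
  have h1 := congrFun h ⟨D.f, Subgroup.mem_zpowers D.f⟩
  rw [torusPow_apply, torusPow_apply, torusHom_f] at h1
  exact D.sigma_primitive.pow_inj hj hj' h1

lemma induced_torus_one_or_neg_one (hp : p ≠ 2) (j : ℕ) {g : SL2 p} (hg : g = 1 ∨ g = -1)
    (hmem : g ∈ D.torus) :
    induced D.torus (D.torusPow j) g = (2 * p * half p) * D.torusHom ⟨g, hmem⟩ ^ j := by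
  have hc : ∀ x : SL2 p, x⁻¹ * g * x = g := by
    intro x
    rcases hg with rfl | rfl
    · group
    · simp
  rw [induced_apply]
  simp only [hc, extendZero_of_mem _ _ hmem, Finset.sum_const, Finset.card_univ, nsmul_eq_mul,
    ← Nat.card_eq_fintype_card]
  have h1 : (Nat.card (SL2 p) : ℂ) = (p + 1) * (2 * half p * p) := by
    rw [card_SL2, card_U, ← two_mul_half hp]
    push_cast
    ring
  have h2 : (p + 1 : ℂ) ≠ 0 := by exact_mod_cast Nat.succ_ne_zero p
  rw [h1, card_torus, torusPow_apply]
  push_cast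
  field_simp

/-- An element of `⟨f⟩` other than `±1` has irreducible characteristic polynomial. -/
lemma not_isSquare_disc_of_mem (hp : p ≠ 2) {x : SL2 p} (hx : x ∈ D.torus) (h1 : x ≠ 1)
    (h2 : x ≠ -1) : ¬ IsSquare (tr x ^ 2 - 4) := fun h =>
  (D.eq_one_or_neg_one_of_commute hp (D.torus_commute ⟨x, hx⟩) h).elim h1 h2

lemma induced_torus_of_split (hp : p ≠ 2) (j : ℕ) {g : SL2 p} (hg : IsSquare (tr g ^ 2 - 4))
    (h1 : g ≠ 1) (h2 : g ≠ -1) : induced D.torus (D.torusPow j) g = 0 := by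
  rw [induced_apply, Finset.sum_eq_zero, mul_zero]
  intro x _
  rw [extendZero_of_notMem]
  intro hmem
  refine D.not_isSquare_disc_of_mem hp hmem ?_ ?_ (by rwa [tr_conj])
  · intro h
    apply h1
    have := congrArg (fun y => x * y * x⁻¹) h
    simpa [mul_assoc] using this
  · intro h
    apply h2
    have := congrArg (fun y => x * y * x⁻¹) h
    simpa [mul_assoc] using this

/-- A noncentral element `c` of `⟨f⟩` is conjugate in `SL(2,p)` to no other elements of `⟨f⟩` than
`c` and `c⁻¹`. -/
theorem induced_torus_of_mem (hp : p ≠ 2) (j : ℕ) (c : D.torus) (h1 : c.1 ≠ 1) (h2 : c.1 ≠ -1) :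
    induced D.torus (D.torusPow j) c.1 = D.torusHom c ^ j + (D.torusHom c ^ j)⁻¹ := by
  classical
  have hns := D.not_isSquare_disc_of_mem hp c.2 h1 h2
  have hdisc : tr c.1 ^ 2 ≠ 4 := fun h => hns ⟨0, by rw [h]; norm_num⟩
  have hcf := D.torus_commute c
  obtain ⟨y, hy⟩ := isConj_iff.1 (isConj_of_tr_eq hp (tr_inv c.1).symm hdisc)
  -- `y` conjugates `c⁻¹` to `c`
  have hcent : ∀ x : SL2 p, x⁻¹ * c.1 * x = c.1 ↔ x ∈ D.torus := by
    intro x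
    constructor
    · intro h
      apply D.mem_zpowers_of_commute hp
      apply D.commute_f_of_commute hp hcf h1 h2
      rw [← h]
      nth_rewrite 2 [h]
      group
    · intro h
      rw [mul_assoc, D.torus_mul_comm c ⟨x, h⟩, inv_mul_cancel_left]
  have hinv : ∀ x : SL2 p, x⁻¹ * c.1 * x = c.1⁻¹ ↔ x * y⁻¹ ∈ D.torus := by
    intro x
    rw [← hcent]
    constructor
    · intro h
      have h3 : (x * y⁻¹)⁻¹ * c.1 * (x * y⁻¹) = y * (x⁻¹ * c.1 * x) * y⁻¹ := by group
      rw [h3, h, hy]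
    · intro h
      have h3 : x⁻¹ * c.1 * x = y⁻¹ * ((x * y⁻¹)⁻¹ * c.1 * (x * y⁻¹)) * y := by group
      rw [h3, h]
      nth_rewrite 1 [← hy]
      group
  have hne : c.1 ≠ c.1⁻¹ := by
    intro h
    rcases eq_one_or_neg_one_of_mul_self hp (mul_eq_one_iff_eq_inv.2 h) with h | h
    exacts [h1 h, h2 h]
  have hterm : ∀ x : SL2 p, extendZero D.torus (D.torusPow j) (x⁻¹ * c.1 * x) =
      (if x ∈ D.torus then D.torusHom c ^ j else 0) +
        (if x * y⁻¹ ∈ D.torus then (D.torusHom c ^ j)⁻¹ else 0) := by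
    intro x
    by_cases hx1 : x⁻¹ * c.1 * x = c.1
    · rw [if_pos ((hcent x).1 hx1), if_neg (fun h => hne (hx1.symm.trans ((hinv x).2 h))), hx1,
        extendZero_of_mem _ _ c.2, add_zero, torusPow_apply]
    by_cases hx2 : x⁻¹ * c.1 * x = c.1⁻¹
    · rw [if_neg (fun h => hx1 ((hcent x).2 h)), if_pos ((hinv x).1 hx2), zero_add, hx2,
        extendZero_of_mem _ _ (inv_mem c.2), torusPow_apply]
      have : D.torusHom ⟨c.1⁻¹, inv_mem c.2⟩ * D.torusHom c = 1 := by
        rw [← map_mul]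
        have : (⟨c.1⁻¹, inv_mem c.2⟩ : D.torus) * c = 1 := inv_mul_cancel c
        rw [this, map_one]
      rw [eq_inv_of_mul_eq_one_left this, inv_pow]
    · rw [if_neg (fun h => hx1 ((hcent x).2 h)), if_neg (fun h => hx2 ((hinv x).2 h)), add_zero,
        extendZero_of_notMem]
      intro hmem
      have hzf := D.torus_commute ⟨_, hmem⟩
      have hzc : x⁻¹ * c.1 * x * c.1 = c.1 * (x⁻¹ * c.1 * x) := D.torus_mul_comm ⟨_, hmem⟩ c
      rcases D.eq_or_eq_inv_of_tr_eq hp hzf hcf hzc (tr_conj x c.1) with h | h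
      exacts [hx1 h, hx2 h]
  have hcount : ∀ z : ℂ, ∑ x : SL2 p, (if x ∈ D.torus then z else 0) = Nat.card D.torus * z := by
    intro z
    have := sum_extendZero_mul D.torus (fun _ => z) (fun _ => (1 : ℂ))
    simp only [mul_one, Finset.sum_const, Finset.card_univ, nsmul_eq_mul,
      ← Nat.card_eq_fintype_card] at this
    rw [← this]
    refine Finset.sum_congr rfl fun x _ => ?_
    by_cases hx : x ∈ D.torus
    · rw [if_pos hx, extendZero_of_mem _ _ hx]
    · rw [if_neg hx, extendZero_of_notMem _ _ hx]
  have hshift : ∑ x : SL2 p, (if x * y⁻¹ ∈ D.torus then (D.torusHom c ^ j)⁻¹ else 0) =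
      Nat.card D.torus * (D.torusHom c ^ j)⁻¹ :=
    (Equiv.sum_comp (Equiv.mulRight y⁻¹)
      (fun x => if x ∈ D.torus then (D.torusHom c ^ j)⁻¹ else 0)).trans (hcount _)
  rw [induced_apply, Fintype.sum_congr _ _ hterm, Finset.sum_add_distrib, hcount, hshift,
    ← mul_add, inv_mul_cancel_left₀ card_ne_zero']

end Choices

namespace Choices

variable {p : ℕ} [hpf : Fact p.Prime] (D : Choices p)

/-! ### Virtual characters of `SL(2,p)` and their restrictions -/

/-- The Steinberg character. -/
def steinberg : SL2 p → ℂ := D.principal 0 - 1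

/-- The discrete series character, as a virtual character. -/
def discrete (j : ℕ) : SL2 p → ℂ :=
  D.gelfandGraev 1 j + D.gelfandGraev D.t j - induced D.torus (D.torusPow j)

/-- The indices in `[1, n)` congruent to `k` modulo `2`. -/
def parityIco (k n : ℕ) : Finset ℕ := (Finset.Ico 1 n).filter fun i => i % 2 = k % 2

lemma mem_parityIco {k n i : ℕ} : i ∈ parityIco k n ↔ (1 ≤ i ∧ i < n) ∧ i % 2 = k % 2 := by
  rw [parityIco, Finset.mem_filter, Finset.mem_Ico]

/-- The sum of the constituents of the Gelfand-Graev character which do not depend on the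
parameter `s`. -/
def commonPart (k : ℕ) : SL2 p → ℂ :=
  (if k % 2 = 0 then D.steinberg else 0) + ∑ i ∈ parityIco k (half p), D.principal i +
    ∑ j ∈ parityIco k (half p + 1), D.discrete j

/-- What remains of the Gelfand-Graev character when the constituents common to both parameters
are removed. -/
def remainder (s : ZMod p) (k : ℕ) : SL2 p → ℂ := D.gelfandGraev s k - D.commonPart k

lemma sum_parityIco (k n : ℕ) (F : ℕ → ℂ) :
    ∑ i ∈ parityIco k n, F i = ∑ i ∈ Finset.Ico 1 n, parity k i * F i := by
  rw [parityIco, Finset.sum_filter]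
  refine Finset.sum_congr rfl fun i _ => ?_
  unfold parity
  split_ifs <;> simp

lemma isClassFun_one {G : Type} [Group G] : IsClassFun (1 : G → ℂ) := fun _ _ => rfl

lemma isClassFun_principal (i : ℕ) : IsClassFun (D.principal i) := isClassFun_induced _ _

lemma isIrrChar_one {G : Type} [Group G] : IsIrrChar (1 : G → ℂ) :=
  isIrrChar_of_hom (1 : G →* ℂ)

lemma isVirtualChar_principal (i : ℕ) : IsVirtualChar (D.principal i) :=
  isVirtualChar_induced _ (D.isIrrChar_chiLin i)

lemma isVirtualChar_gelfandGraev (hp : p ≠ 2) {s : ZMod p} (hs : D.IsParam s) (k : ℕ) :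
    IsVirtualChar (D.gelfandGraev s k) :=
  isVirtualChar_induced _ (D.isIrrChar_chiInd hp hs k)

lemma isParam_one : D.IsParam 1 := Or.inl rfl

lemma isParam_t : D.IsParam D.t := Or.inr rfl

lemma isVirtualChar_steinberg : IsVirtualChar D.steinberg :=
  (D.isVirtualChar_principal 0).sub isIrrChar_one.isVirtualChar

lemma isVirtualChar_discrete (hp : p ≠ 2) (j : ℕ) : IsVirtualChar (D.discrete j) :=
  ((D.isVirtualChar_gelfandGraev hp D.isParam_one j).add
    (D.isVirtualChar_gelfandGraev hp D.isParam_t j)).sub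
    (isVirtualChar_induced _ (isIrrChar_of_hom _))

lemma isVirtualChar_commonPart (hp : p ≠ 2) (k : ℕ) : IsVirtualChar (D.commonPart k) := by
  refine (IsVirtualChar.add ?_ (IsVirtualChar.sum _ fun i _ => D.isVirtualChar_principal i)).add
    (IsVirtualChar.sum _ fun j _ => D.isVirtualChar_discrete hp j)
  split_ifs
  · exact D.isVirtualChar_steinberg
  · have := IsVirtualChar.sum (G := SL2 p) (∅ : Finset ℕ) (X := fun _ => 0) (by simp)
    rwa [Finset.sum_empty] at this

lemma isVirtualChar_remainder (hp : p ≠ 2) {s : ZMod p} (hs : D.IsParam s) (k : ℕ) :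
    IsVirtualChar (D.remainder s k) :=
  (D.isVirtualChar_gelfandGraev hp hs k).sub (D.isVirtualChar_commonPart hp k)

lemma chiLin_top : D.chiLin (p - 1) = 1 := by
  ext u
  rw [chiLin_apply, zhom_pow_card, Pi.one_apply]

lemma res_steinberg (hp : p ≠ 2) : res (U p) D.steinberg = 1 + D.chiSum 0 := by
  have h := D.res_principal hp (Nat.zero_le (p - 1))
  rw [Nat.sub_zero, chiLin_zero, chiLin_top] at h
  ext u
  have hu := congrFun h u
  simp only [res, steinberg, Pi.sub_apply, Pi.add_apply, Pi.one_apply] at hu ⊢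
  rw [hu]
  ring

/-- The central elements of `U`. -/
lemma coe_eq_one_or_neg_one {u : U p} (h : topLeft u ^ 2 = 1) (h0 : u.1.1 0 1 = 0) :
    (topLeft u = 1 ∧ u.1 = 1) ∨ (topLeft u = -1 ∧ u.1 = -1) := by
  have h11 := entry_one_one_eq h
  have hone := SL2.one_entries (p := p)
  rcases unit_sq_eq_one.1 h with h | h
  · have h00 : u.1.1 0 0 = 1 := by rw [entry_zero_zero, h, Units.val_one]
    refine Or.inl ⟨h, SL2.ext_entries ?_ ?_ ?_ ?_⟩
    · rw [h00, hone.1]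
    · rw [h0, hone.2.1]
    · rw [entry_one_zero, hone.2.2.1]
    · rw [h11, h00, hone.2.2.2]
  · have h00 : u.1.1 0 0 = -1 := by rw [entry_zero_zero, h, Units.val_neg, Units.val_one]
    refine Or.inr ⟨h, SL2.ext_entries ?_ ?_ ?_ ?_⟩ <;> rw [SL2.neg_entry]
    · rw [h00, hone.1]
    · rw [h0, hone.2.1, neg_zero]
    · rw [entry_one_zero, hone.2.2.1, neg_zero]
    · rw [h11, h00, hone.2.2.2]

lemma res_induced_torus_apply (hp : p ≠ 2) (j : ℕ) (u : U p) :
    res (U p) (induced D.torus (D.torusPow j)) u =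
      if topLeft u ^ 2 = 1 ∧ u.1.1 0 1 = 0 then
        2 * ((p : ℂ) * half p * D.zhom (topLeft u) ^ j) else 0 := by
  rw [res]
  split_ifs with h
  · rcases coe_eq_one_or_neg_one h.1 h.2 with ⟨h1, h2⟩ | ⟨h1, h2⟩
    · rw [h2, D.induced_torus_one_or_neg_one hp j (Or.inl rfl) (one_mem _), h1, map_one]
      have : D.torusHom ⟨1, one_mem _⟩ = 1 := map_one _
      rw [this]
      ring
    · rw [h2, D.induced_torus_one_or_neg_one hp j (Or.inr rfl) (D.neg_one_mem_torus hp), h1,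
        D.zhom_neg_one hp, D.torusHom_neg_one hp]
      ring
  · refine D.induced_torus_of_split hp j
      (by rw [tr_coe_U]; exact isSquare_disc_diagSL _) ?_ ?_
    · intro h1
      apply h
      have := SL2.one_entries (p := p)
      refine ⟨Units.ext ?_, ?_⟩
      · rw [Units.val_pow_eq_pow_val, ← entry_zero_zero, h1, this.1, one_pow, Units.val_one]
      · rw [h1, this.2.1]
    · intro h1
      apply h
      have := SL2.one_entries (p := p)
      refine ⟨Units.ext ?_, ?_⟩
      · rw [Units.val_pow_eq_pow_val, ← entry_zero_zero, h1, SL2.neg_entry, this.1, neg_one_sq,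
          Units.val_one]
      · rw [h1, SL2.neg_entry, this.2.1, neg_zero]

theorem res_discrete (hp : p ≠ 2) (j : ℕ) : res (U p) (D.discrete j) = D.chiSum j := by
  ext u
  have h1 := D.res_gelfandGraev_apply hp 1 j u
  have h2 := D.res_gelfandGraev_apply hp D.t j u
  have h3 := D.res_induced_torus_apply hp j u
  have h4 : res (U p) (D.discrete j) u = res (U p) (D.gelfandGraev 1 j) u +
    res (U p) (D.gelfandGraev D.t j) u - res (U p) (induced D.torus (D.torusPow j)) u := rfl
  rw [h4, h1, h2, h3, chiSum, Pi.add_apply]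
  split_ifs <;> ring

lemma chiSum_congr {k k' : ℕ} (h : k % 2 = k' % 2) : D.chiSum k = D.chiSum k' := by
  rw [chiSum, chiSum, D.chiInd_congr 1 h, D.chiInd_congr D.t h]

lemma commonPart_apply (k : ℕ) (g : SL2 p) : D.commonPart k g =
    parity k 0 * D.steinberg g + ∑ i ∈ Finset.Ico 1 (half p), parity k i * D.principal i g +
      ∑ j ∈ Finset.Ico 1 (half p + 1), parity k j * D.discrete j g := by
  rw [commonPart, Pi.add_apply, Pi.add_apply, Finset.sum_apply, Finset.sum_apply, sum_parityIco,
    sum_parityIco]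
  congr 2
  unfold parity
  rcases Nat.mod_two_eq_zero_or_one k with h | h <;> rw [h] <;> simp

theorem res_remainder_apply (hp : p ≠ 2) (s : ZMod p) (k : ℕ) (u : U p) :
    res (U p) (D.remainder s k) u =
      D.chiInd s k u + parity k (half p) * D.chiLin (half p) u := by
  have hN := two_mul_half (p := p) hp
  have hpos := half_pos (p := p) hp
  have h0 : res (U p) (D.remainder s k) u =
    res (U p) (D.gelfandGraev s k) u - D.commonPart k u.1 := rfl
  have hst : D.steinberg u.1 = 1 + D.chiSum 0 u := congrFun (D.res_steinberg hp) u
  have hpar : ∀ i, parity k i * D.chiSum i u = parity k i * D.chiSum k u := by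
    intro i
    unfold parity
    split_ifs with h
    · rw [D.chiSum_congr h]
    · rw [zero_mul, zero_mul]
  have hpr : ∀ i ∈ Finset.Ico 1 (half p), parity k i * D.principal i u.1 =
      (parity k i * D.chiLin i u + parity k (2 * half p - i) * D.chiLin (2 * half p - i) u) +
        parity k i * D.chiSum k u := by
    intro i hi
    rw [Finset.mem_Ico] at hi
    have h1 : D.principal i u.1 = D.chiLin i u + D.chiLin (p - 1 - i) u + D.chiSum i u :=
      congrFun (D.res_principal hp (by omega)) u
    rw [parity_reflect k _ i (by omega), h1, hN, mul_add, hpar]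
    ring
  have hdi : ∀ j ∈ Finset.Ico 1 (half p + 1), parity k j * D.discrete j u.1 =
      parity k j * D.chiSum k u := by
    intro j _
    rw [← hpar]
    congr 1
    exact congrFun (D.res_discrete hp j) u
  have hreg := D.regular_decomposition hp k u
  have hcount := sum_parity_count k hpos
  rw [← hN, sum_range_fold hpos] at hreg
  rw [h0, D.res_gelfandGraev_apply hp, ← hreg, commonPart_apply, Finset.sum_congr rfl hpr,
    Finset.sum_congr rfl hdi, hst, mul_add, hpar, chiLin_zero, Pi.one_apply]
  simp only [Finset.sum_add_distrib, ← Finset.sum_mul]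
  linear_combination -D.chiSum k u * hcount

/-! ### Values on the nonsplit torus -/

lemma principal_of_nonsplit (i : ℕ) {g : SL2 p} (hg : ¬ IsSquare (tr g ^ 2 - 4)) :
    D.principal i g = 0 := induced_U_of_nonsplit _ hg

lemma gelfandGraev_of_nonsplit (s : ZMod p) (k : ℕ) {g : SL2 p}
    (hg : ¬ IsSquare (tr g ^ 2 - 4)) : D.gelfandGraev s k g = 0 := induced_U_of_nonsplit _ hg

lemma steinberg_of_nonsplit {g : SL2 p} (hg : ¬ IsSquare (tr g ^ 2 - 4)) :
    D.steinberg g = -1 := by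
  rw [steinberg, Pi.sub_apply, D.principal_of_nonsplit 0 hg, Pi.one_apply, zero_sub]

lemma discrete_of_mem_torus (hp : p ≠ 2) (j : ℕ) (c : D.torus) (h1 : c.1 ≠ 1) (h2 : c.1 ≠ -1) :
    D.discrete j c.1 = -(D.torusHom c ^ j + (D.torusHom c ^ j)⁻¹) := by
  have hns := D.not_isSquare_disc_of_mem hp c.2 h1 h2
  rw [discrete, Pi.sub_apply, Pi.add_apply, D.gelfandGraev_of_nonsplit _ j hns,
    D.gelfandGraev_of_nonsplit _ j hns, D.induced_torus_of_mem hp j c h1 h2]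
  ring

lemma discrete_f_pow (hp : p ≠ 2) (j : ℕ) {m : ℕ} (h1 : 1 ≤ m) (h2 : m ≤ half p) :
    D.discrete j (D.f ^ m) = -(D.sigma ^ (j * m) + (D.sigma ^ (j * m))⁻¹) := by
  obtain ⟨h3, h4⟩ := D.f_pow_ne hp h1 h2
  have := D.discrete_of_mem_torus hp j ⟨D.f ^ m, D.f_pow_mem m⟩ h3 h4
  rw [torusHom_f_pow, ← pow_mul, mul_comm m] at this
  exact this

/-- The discrete series characters sum up to a geometric sum of the powers of `sigma ^ m` with
exponents of a given parity, without the terms of exponents `0` and `half p + 1`. -/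
theorem remainder_f_pow (hp : p ≠ 2) (s : ZMod p) (k : ℕ) {m : ℕ} (h1 : 1 ≤ m)
    (h2 : m ≤ half p) :
    D.remainder s k (D.f ^ m) = parity k (half p + 1) * (-1) ^ (m + 1) := by
  have hN := two_mul_half (p := p) hp
  have hp2 := hpf.out.two_le
  have hns := D.not_isSquare_disc_f_pow hp h1 h2
  have hM : 2 * (half p + 1) = p + 1 := by omega
  have hz : (D.sigma ^ m) ^ 2 ≠ 1 := by
    rw [← pow_mul, Ne, D.sigma_primitive.pow_eq_one_iff_dvd]
    intro h
    have := Nat.le_of_dvd (by omega) h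
    omega
  have hz' : (D.sigma ^ m) ^ (2 * (half p + 1)) = 1 := by
    rw [hM, ← pow_mul, mul_comm, pow_mul, D.sigma_primitive.pow_eq_one, one_pow]
  have hhalf : (D.sigma ^ m) ^ (half p + 1) = (-1) ^ m := by
    have h3 := D.torusHom_f_pow (half p + 1)
    have h4 : D.torusHom ⟨D.f ^ (half p + 1), D.f_pow_mem _⟩ = -1 := by
      rw [← D.torusHom_neg_one hp]
      congr 1
      exact Subtype.ext (D.f_pow_half_succ hp)
    rw [← pow_mul, mul_comm, pow_mul, ← h3, h4]
  have key := sum_parity_mul_pow_of_sq_ne k (half p + 1) hz hz'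
  rw [sum_range_fold (Nat.succ_pos _), hhalf] at key
  have hdi : ∀ j ∈ Finset.Ico 1 (half p + 1), parity k j * D.discrete j (D.f ^ m) =
      -(parity k j * (D.sigma ^ m) ^ j +
        parity k (2 * (half p + 1) - j) * (D.sigma ^ m) ^ (2 * (half p + 1) - j)) := by
    intro j hj
    rw [Finset.mem_Ico] at hj
    have h5 : (D.sigma ^ m) ^ (2 * (half p + 1) - j) = ((D.sigma ^ m) ^ j)⁻¹ := by
      refine eq_inv_of_mul_eq_one_left ?_
      rw [← pow_add, Nat.sub_add_cancel (by omega), hz']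
    rw [D.discrete_f_pow hp j h1 h2, parity_reflect k _ j (by omega), h5, ← pow_mul, mul_comm m]
    ring
  rw [remainder, Pi.sub_apply, D.gelfandGraev_of_nonsplit s k hns, commonPart_apply,
    D.steinberg_of_nonsplit hns, Finset.sum_congr rfl hdi, Finset.sum_neg_distrib,
    Finset.sum_eq_zero (s := Finset.Ico 1 (half p))
      (fun i _ => by rw [D.principal_of_nonsplit i hns, mul_zero])]
  linear_combination key

end Choices

namespace Choices

variable {p : ℕ} [hpf : Fact p.Prime] (D : Choices p)

/-! ### Orthogonality relations -/

lemma one_ne_t : (1 : ZMod p) ≠ D.t := fun h => D.t_nonsquare (h ▸ IsSquare.one)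

lemma charInner_chiLin_chiSum (hp : p ≠ 2) (i k : ℕ) :
    charInner (D.chiLin i) (D.chiSum k) = 0 := by
  rw [chiSum, charInner_add_right,
    (D.isIrrChar_chiLin i).charInner_ne (D.isIrrChar_chiInd hp D.isParam_one k)
      (D.chiInd_ne_chiLin hp D.isParam_one k i).symm,
    (D.isIrrChar_chiLin i).charInner_ne (D.isIrrChar_chiInd hp D.isParam_t k)
      (D.chiInd_ne_chiLin hp D.isParam_t k i).symm, add_zero]

lemma charInner_chiInd_chiSum (hp : p ≠ 2) {s : ZMod p} (hs : D.IsParam s) (k k' : ℕ) :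
    charInner (D.chiInd s k) (D.chiSum k') = parity k' k := by
  rw [chiSum, charInner_add_right, D.charInner_chiInd hp hs D.isParam_one,
    D.charInner_chiInd hp hs D.isParam_t]
  unfold parity
  have := D.one_ne_t
  rcases hs with rfl | rfl
  · simp [this]
  · simp [this.symm]

lemma charInner_chiInd_chiLin (hp : p ≠ 2) {s : ZMod p} (hs : D.IsParam s) (k i : ℕ) :
    charInner (D.chiInd s k) (D.chiLin i) = 0 :=
  (D.isIrrChar_chiInd hp hs k).charInner_ne (D.isIrrChar_chiLin i) (D.chiInd_ne_chiLin hp hs k i)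

lemma charInner_chiLin_of_ne {i i' : ℕ} (hi : i < p - 1) (hi' : i' < p - 1) (h : i ≠ i') :
    charInner (D.chiLin i) (D.chiLin i') = 0 :=
  (D.isIrrChar_chiLin i).charInner_ne (D.isIrrChar_chiLin i') fun hc => h (D.chiLin_inj hi hi' hc)

lemma charInner_principal (i : ℕ) {X : SL2 p → ℂ} (hX : IsClassFun X) :
    charInner (D.principal i) X = charInner (D.chiLin i) (res (U p) X) :=
  charInner_induced _ _ hX

lemma charInner_gelfandGraev (s : ZMod p) (k : ℕ) {X : SL2 p → ℂ} (hX : IsClassFun X) :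
    charInner (D.gelfandGraev s k) X = charInner (D.chiInd s k) (res (U p) X) :=
  charInner_induced _ _ hX

theorem isIrrChar_principal (hp : p ≠ 2) {i : ℕ} (h1 : 1 ≤ i) (h2 : i < half p) :
    IsIrrChar (D.principal i) := by
  have hN := two_mul_half (p := p) hp
  refine (D.isVirtualChar_principal i).isIrrChar ?_ ?_
  · rw [D.charInner_principal i (D.isClassFun_principal i), D.res_principal hp (by omega),
      charInner_add_right, charInner_add_right, D.charInner_chiLin_chiSum hp,
      (D.isIrrChar_chiLin i).charInner_self,
      D.charInner_chiLin_of_ne (by omega) (by omega) (by omega)]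
    norm_num
  · have h := congrFun (D.res_principal hp (i := i) (by omega)) 1
    have hc := D.chiSum_of_central hp i (u := 1) (by rw [map_one, one_pow]) SL2.one_entries.2.1
    rw [Pi.add_apply, Pi.add_apply, hc, chiLin_apply, chiLin_apply, map_one, map_one, one_pow,
      one_pow] at h
    have h' : D.principal i 1 = ((p + 1 : ℕ) : ℂ) := h.trans (by push_cast; ring)
    rw [h']
    exact_mod_cast Nat.zero_le _

lemma charInner_steinberg {X : SL2 p → ℂ} (hX : IsClassFun X)
    (h1 : charInner 1 X = 0) :
    charInner D.steinberg X = charInner (1 : U p → ℂ) (res (U p) X) := by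
  rw [steinberg, charInner_sub_left, h1, sub_zero, D.charInner_principal 0 hX, chiLin_zero]

omit hpf in
lemma res_one {H : Subgroup (SL2 p)} : res H 1 = 1 := rfl

lemma charInner_one_steinberg : charInner 1 D.steinberg = 0 := by
  have h1 : charInner (1 : SL2 p → ℂ) 1 = 1 := isIrrChar_one.charInner_self
  have h2 : charInner (1 : U p → ℂ) 1 = 1 := isIrrChar_one.charInner_self
  rw [charInner_conj, steinberg, charInner_sub_left, D.charInner_principal 0 isClassFun_one,
    chiLin_zero, res_one, h1, h2, sub_self, map_zero]

theorem isIrrChar_steinberg (hp : p ≠ 2) : IsIrrChar D.steinberg := by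
  refine D.isVirtualChar_steinberg.isIrrChar ?_ ?_
  · have h2 : charInner (1 : U p → ℂ) 1 = 1 := isIrrChar_one.charInner_self
    have h3 := D.charInner_chiLin_chiSum hp 0 0
    rw [chiLin_zero] at h3
    rw [D.charInner_steinberg D.isVirtualChar_steinberg.1 D.charInner_one_steinberg,
      D.res_steinberg hp, charInner_add_right, h2, h3, add_zero]
  · have h := congrFun (D.res_steinberg hp) 1
    have hc := D.chiSum_of_central hp 0 (u := 1) (by rw [map_one, one_pow]) SL2.one_entries.2.1
    rw [Pi.add_apply, hc, pow_zero, Pi.one_apply] at h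
    have h' : D.steinberg 1 = (p : ℂ) := h.trans (by ring)
    rw [h']
    exact_mod_cast Nat.zero_le _

/-! ### The discrete series -/

omit hpf in
lemma torusPow_zero : (D.torusPow 0 : D.torus → ℂ) = 1 := by
  ext x
  rw [torusPow_apply, pow_zero, Pi.one_apply]

lemma charInner_one_discrete (hp : p ≠ 2) {j : ℕ} (h1 : 1 ≤ j) (h2 : j ≤ half p) :
    charInner 1 (D.discrete j) = 0 := by
  have hN := two_mul_half (p := p) hp
  have hcl : IsClassFun (1 : SL2 p → ℂ) := isClassFun_one
  have h3 : charInner (D.torusPow j : D.torus → ℂ) 1 = 0 := by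
    rw [← torusPow_zero]
    refine (isIrrChar_of_hom _).charInner_ne (isIrrChar_of_hom _) fun h => ?_
    have := D.torusPow_inj (by omega) (by omega) h
    omega
  have h4 : ∀ s, D.IsParam s → charInner (D.chiInd s j) 1 = 0 := fun s hs => by
    rw [← chiLin_zero, D.charInner_chiInd_chiLin hp hs]
  rw [charInner_conj, discrete, charInner_sub_left, charInner_add_left,
    D.charInner_gelfandGraev _ _ hcl, D.charInner_gelfandGraev _ _ hcl,
    charInner_induced _ _ hcl, res_one, res_one, h3, h4 _ D.isParam_one, h4 _ D.isParam_t]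
  simp

/-- The restriction of a discrete series character to the nonsplit torus. -/
theorem res_torus_discrete (hp : p ≠ 2) {j : ℕ} (h1 : j ≤ p + 1) (x : D.torus) :
    res D.torus (D.discrete j) x = (if x.1 = 1 then (p + 1 : ℂ) else 0) +
      (if x.1 = -1 then (p + 1 : ℂ) * (-1) ^ j else 0) -
      D.torusPow j x - D.torusPow (p + 1 - j) x := by
  have hinv : D.torusPow (p + 1 - j) x = (D.torusHom x ^ j)⁻¹ := by
    rw [torusPow_apply]
    refine eq_inv_of_mul_eq_one_left ?_
    rw [← pow_add, Nat.sub_add_cancel h1, torusHom_pow_card]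
  have hne : (1 : SL2 p) ≠ -1 := fun h => by
    have h3 := congrArg tr h
    rw [tr_neg, tr_one] at h3
    have h2 := two_ne_zero_of_odd hp
    have : (2 : ZMod p) * 2 = 0 := by linear_combination h3
    simp [h2] at this
  rw [hinv, torusPow_apply, res]
  by_cases hx1 : x.1 = 1
  · have hx : x = 1 := Subtype.ext hx1
    have h := congrFun (D.res_discrete hp j) 1
    have hc := D.chiSum_of_central hp j (u := 1) (by rw [map_one, one_pow]) SL2.one_entries.2.1
    rw [hc, map_one, map_one, one_pow, mul_one] at h
    have h' : D.discrete j 1 = p - 1 := h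
    rw [hx1, h', if_pos rfl, if_neg hne, hx, map_one, one_pow]
    norm_num
  by_cases hx2 : x.1 = -1
  · have hx : x = ⟨-1, D.neg_one_mem_torus hp⟩ := Subtype.ext hx2
    have htl : topLeft (upper (-1 : (ZMod p)ˣ) 0) = -1 := topLeft_upper _ _
    have h := congrFun (D.res_discrete hp j) (upper (-1) 0)
    have hc := D.chiSum_of_central hp j (u := upper (-1) 0)
      (by rw [htl, neg_one_sq]) (upper_entry _ _)
    have hu : (upper (-1 : (ZMod p)ˣ) 0).1 = -1 := by
      rcases coe_eq_one_or_neg_one (u := upper (-1) 0) (by rw [htl, neg_one_sq])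
        (upper_entry _ _) with h | h
      · exact absurd (h.1.symm.trans htl) (unit_one_ne_neg_one hp)
      · exact h.2
    rw [hc, res, hu, htl, D.zhom_neg_one hp] at h
    have hsq : ((-1 : ℂ) ^ j) ^ 2 = 1 := by rw [← pow_mul, mul_comm, pow_mul, neg_one_sq, one_pow]
    rw [hx2, h, if_neg hne.symm, if_pos rfl, hx, D.torusHom_neg_one hp, inv_eq_self_of_sq hsq]
    ring
  · rw [D.discrete_of_mem_torus hp j x hx1 hx2, if_neg hx1, if_neg hx2]
    ring

lemma charInner_torusPow_discrete (hp : p ≠ 2) {j j' : ℕ} (h1 : 1 ≤ j) (h2 : j ≤ half p)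
    (h1' : 1 ≤ j') (h2' : j' ≤ half p) :
    charInner (D.torusPow j' : D.torus → ℂ) (res D.torus (D.discrete j)) =
      2 * parity j j' - if j' = j then 1 else 0 := by
  classical
  have hN := two_mul_half (p := p) hp
  have hp1 : (p + 1 : ℂ) ≠ 0 := by exact_mod_cast Nat.succ_ne_zero p
  let A : D.torus → ℂ := fun x => if x = 1 then (p + 1 : ℂ) else 0
  let B : D.torus → ℂ := fun x =>
    if x = ⟨-1, D.neg_one_mem_torus hp⟩ then (p + 1 : ℂ) * (-1) ^ j else 0
  have hres : res D.torus (D.discrete j) =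
      A + B - (D.torusPow j : D.torus → ℂ) - D.torusPow (p + 1 - j) := by
    ext x
    rw [D.res_torus_discrete hp (by omega)]
    simp only [A, B, Pi.sub_apply, Pi.add_apply, Subtype.ext_iff, Subgroup.coe_one]
  have hA : charInner (D.torusPow j' : D.torus → ℂ) A = 1 := by
    rw [charInner, Finset.sum_eq_single 1]
    · simp only [A, if_true, map_one, one_mul, card_torus]
      simp [hp1]
    · intro x _ hx
      simp [A, hx]
    · simp
  have hB : charInner (D.torusPow j' : D.torus → ℂ) B = (-1) ^ j' * (-1) ^ j := by
    rw [charInner, Finset.sum_eq_single ⟨-1, D.neg_one_mem_torus hp⟩]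
    · simp only [B, if_true, card_torus, torusPow_apply, D.torusHom_neg_one hp]
      simp only [map_mul, map_add, map_pow, map_neg, map_one, map_natCast]
      push_cast
      field_simp
    · intro x _ hx
      simp [B, hx]
    · simp
  have h3 : charInner (D.torusPow j' : D.torus → ℂ) (D.torusPow j) = if j' = j then 1 else 0 := by
    rw [(isIrrChar_of_hom _).charInner_eq (isIrrChar_of_hom _)]
    exact if_congr ⟨D.torusPow_inj (by omega) (by omega), fun h => by rw [h]⟩ rfl rfl
  have h4 : charInner (D.torusPow j' : D.torus → ℂ) (D.torusPow (p + 1 - j)) = 0 := by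
    refine (isIrrChar_of_hom _).charInner_ne (isIrrChar_of_hom _) fun h => ?_
    have := D.torusPow_inj (by omega) (by omega) h
    omega
  rw [hres, charInner_sub_right, charInner_sub_right, charInner_add_right, hA, hB, h3, h4]
  have h5 : (-1 : ℂ) ^ j' * (-1) ^ j = 2 * parity j j' - 1 := by
    rw [neg_one_pow_eq_pow_mod_two, neg_one_pow_eq_pow_mod_two (n := j)]
    unfold parity
    rcases Nat.mod_two_eq_zero_or_one j with e | e <;>
      rcases Nat.mod_two_eq_zero_or_one j' with e' | e' <;> rw [e, e'] <;> norm_num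
  rw [h5]
  ring

/-- The contributions `parity j j'` of the two Gelfand-Graev characters cancel the contribution of
the central elements of the torus. -/
lemma charInner_discrete (hp : p ≠ 2) {j j' : ℕ} (h1 : 1 ≤ j) (h2 : j ≤ half p)
    (h1' : 1 ≤ j') (h2' : j' ≤ half p) :
    charInner (D.discrete j') (D.discrete j) = if j' = j then 1 else 0 := by
  have hcl := (D.isVirtualChar_discrete hp j).1
  rw [discrete, charInner_sub_left, charInner_add_left,
    D.charInner_gelfandGraev _ _ hcl, D.charInner_gelfandGraev _ _ hcl, charInner_induced _ _ hcl,
    D.charInner_torusPow_discrete hp h1 h2 h1' h2', D.res_discrete hp,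
    D.charInner_chiInd_chiSum hp D.isParam_one, D.charInner_chiInd_chiSum hp D.isParam_t]
  ring

theorem isIrrChar_discrete (hp : p ≠ 2) {j : ℕ} (h1 : 1 ≤ j) (h2 : j ≤ half p) :
    IsIrrChar (D.discrete j) := by
  refine (D.isVirtualChar_discrete hp j).isIrrChar ?_ ?_
  · rw [D.charInner_discrete hp h1 h2 h1 h2, if_pos rfl]
  · have h := congrFun (D.res_discrete hp j) 1
    have hc := D.chiSum_of_central hp j (u := 1) (by rw [map_one, one_pow]) SL2.one_entries.2.1
    rw [hc, map_one, map_one, one_pow, mul_one] at h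
    have h' : D.discrete j 1 = ((p - 1 : ℕ) : ℂ) :=
      h.trans (by rw [Nat.cast_sub hpf.out.one_le, Nat.cast_one])
    rw [h']
    exact_mod_cast Nat.zero_le _

/-! ### The exceptional characters -/

lemma charInner_one_commonPart (hp : p ≠ 2) (k : ℕ) : charInner 1 (D.commonPart k) = 0 := by
  have hN := two_mul_half (p := p) hp
  rw [commonPart, charInner_add_right, charInner_add_right, charInner_sum_right,
    charInner_sum_right, Finset.sum_eq_zero, Finset.sum_eq_zero]
  · split_ifs
    · rw [charInner_one_steinberg, add_zero, add_zero]
    · rw [charInner_conj, charInner_zero_left, map_zero, add_zero, add_zero]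
  · intro j hj
    rw [mem_parityIco] at hj
    exact D.charInner_one_discrete hp (by omega) (by omega)
  · intro i hi
    rw [mem_parityIco] at hi
    rw [charInner_conj, D.charInner_principal i isClassFun_one, res_one, ← chiLin_zero,
      D.charInner_chiLin_of_ne (by omega) (by omega) (by omega), map_zero]

lemma charInner_one_remainder (hp : p ≠ 2) {s : ZMod p} (hs : D.IsParam s) (k : ℕ) :
    charInner 1 (D.remainder s k) = 0 := by
  rw [remainder, charInner_sub_right, D.charInner_one_commonPart hp, charInner_conj,
    D.charInner_gelfandGraev _ _ isClassFun_one, res_one, ← chiLin_zero,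
    D.charInner_chiInd_chiLin hp hs, map_zero, sub_zero]

/-- The restriction to `U` of an exceptional character. -/
theorem res_remainder (hp : p ≠ 2) (s : ZMod p) (k : ℕ) :
    res (U p) (D.remainder s k) =
      D.chiInd s k + parity k (half p) • D.chiLin (half p) := by
  ext u
  rw [D.res_remainder_apply hp]
  rfl

lemma charInner_smul_right (c : ℂ) {G : Type} [Group G] [Fintype G] (X Y : G → ℂ) :
    charInner X (c • Y) = (starRingEnd ℂ) c * charInner X Y := by
  rw [charInner_conj, charInner_smul_left, map_mul, ← charInner_conj]

lemma charInner_chiLin_res_remainder (hp : p ≠ 2) {s : ZMod p} (hs : D.IsParam s) (k : ℕ)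
    {i : ℕ} (hi : i < half p) : charInner (D.chiLin i) (res (U p) (D.remainder s k)) = 0 := by
  have hN := two_mul_half (p := p) hp
  rw [D.res_remainder hp, charInner_add_right, charInner_smul_right,
    D.charInner_chiLin_of_ne (by omega) (by omega) (by omega), mul_zero, add_zero, charInner_conj,
    D.charInner_chiInd_chiLin hp hs, map_zero]

/-- A discrete series character occurs with multiplicity one in the Gelfand-Graev characters of the
same parity, hence does not occur in the remainder. -/
lemma charInner_remainder_discrete (hp : p ≠ 2) {s : ZMod p} (hs : D.IsParam s) {k j : ℕ}
    (h1 : 1 ≤ j) (h2 : j ≤ half p) (hjk : j % 2 = k % 2) :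
    charInner (D.remainder s k) (D.discrete j) = 0 := by
  have hN := two_mul_half (p := p) hp
  have hcl := (D.isVirtualChar_discrete hp j).1
  have hst : charInner D.steinberg (D.discrete j) = 0 := by
    rw [D.charInner_steinberg hcl (D.charInner_one_discrete hp h1 h2), D.res_discrete hp,
      ← chiLin_zero, D.charInner_chiLin_chiSum hp]
  rw [remainder, charInner_sub_left, commonPart, charInner_add_left, charInner_add_left,
    charInner_sum_left, charInner_sum_left, D.charInner_gelfandGraev _ _ hcl, D.res_discrete hp,
    D.charInner_chiInd_chiSum hp hs, Finset.sum_eq_zero, Finset.sum_eq_single j,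
    D.charInner_discrete hp h1 h2 h1 h2, if_pos rfl]
  · have h3 : charInner (if k % 2 = 0 then D.steinberg else 0) (D.discrete j) = 0 := by
      split_ifs
      exacts [hst, charInner_zero_left _]
    rw [h3, parity, if_pos hjk.symm]
    norm_num
  · intro j' hj' hne
    rw [mem_parityIco] at hj'
    rw [D.charInner_discrete hp h1 h2 (by omega) (by omega), if_neg hne]
  · intro h
    exact absurd (mem_parityIco.2 ⟨by omega, hjk⟩) h
  · intro i hi
    rw [D.charInner_principal i hcl, D.res_discrete hp, D.charInner_chiLin_chiSum hp]

theorem isIrrChar_remainder (hp : p ≠ 2) {s : ZMod p} (hs : D.IsParam s) (k : ℕ) :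
    IsIrrChar (D.remainder s k) := by
  have hcl := (D.isVirtualChar_remainder hp hs k).1
  have hpos := half_pos (p := p) hp
  have hcommon : charInner (D.commonPart k) (D.remainder s k) = 0 := by
    rw [commonPart, charInner_add_left, charInner_add_left, charInner_sum_left,
      charInner_sum_left, Finset.sum_eq_zero, Finset.sum_eq_zero, add_zero, add_zero]
    · split_ifs
      · rw [D.charInner_steinberg hcl (D.charInner_one_remainder hp hs k), ← chiLin_zero,
          D.charInner_chiLin_res_remainder hp hs k hpos]
      · exact charInner_zero_left _
    · intro j hj
      rw [mem_parityIco] at hj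
      rw [charInner_conj, D.charInner_remainder_discrete hp hs (by omega) (by omega) hj.2,
        map_zero]
    · intro i hi
      rw [mem_parityIco] at hi
      rw [D.charInner_principal i hcl, D.charInner_chiLin_res_remainder hp hs k (by omega)]
  refine (D.isVirtualChar_remainder hp hs k).isIrrChar ?_ ?_
  · have h1 : charInner (D.gelfandGraev s k) (D.remainder s k) = 1 := by
      rw [D.charInner_gelfandGraev _ _ hcl, D.res_remainder hp, charInner_add_right,
        charInner_smul_right, D.charInner_chiInd_chiLin hp hs,
        (D.isIrrChar_chiInd hp hs k).charInner_self, mul_zero, add_zero]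
    have h2 : charInner (D.remainder s k) (D.remainder s k) =
        charInner (D.gelfandGraev s k) (D.remainder s k) -
          charInner (D.commonPart k) (D.remainder s k) := charInner_sub_left _ _ _
    rw [h2, h1, hcommon, sub_zero]
  · have h := D.res_remainder_apply hp s k 1
    have hc := D.chiInd_of_central hp s k (u := 1) (by rw [map_one, one_pow]) SL2.one_entries.2.1
    rw [hc, chiLin_apply, map_one, map_one, one_pow, one_pow, mul_one, mul_one] at h
    have h' : D.remainder s k 1 =
        ((half p + if half p % 2 = k % 2 then 1 else 0 : ℕ) : ℂ) :=
      h.trans (by unfold parity; push_cast; rfl)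
    rw [h']
    exact_mod_cast Nat.zero_le _

/-! ### Completeness -/

lemma unip_eq_upper (x : ZMod p) : unip x = (upper (1 : (ZMod p)ˣ) x).1 := by
  apply SL2.ext_entries <;> simp [unip, upper]

lemma neg_unip_eq_upper (x : ZMod p) : -unip x = (upper (-1 : (ZMod p)ˣ) (-x)).1 := by
  apply SL2.ext_entries <;> rw [SL2.neg_entry] <;> simp [unip, upper]

/-- Class functions on `SL(2,p)` are determined by their values on `U` and on `⟨f⟩`. -/
lemma ext_of_res (hp : p ≠ 2) {X Y : SL2 p → ℂ} (hX : IsClassFun X) (hY : IsClassFun Y)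
    (hU : res (U p) X = res (U p) Y)
    (hf : ∀ m, 1 ≤ m → m ≤ half p → X (D.f ^ m) = Y (D.f ^ m)) : X = Y := by
  have key : ∀ (u : U p) (g : SL2 p), IsConj u.1 g → X g = Y g := fun u g h => by
    rw [hX.apply_eq h, hY.apply_eq h]
    exact congrFun hU u
  ext g
  rcases D.conj_cases hp g with h | h | h | h | h | h | ⟨l, -, -, h⟩ | ⟨m, h1, h2, h⟩
  · exact key 1 g (h ▸ IsConj.refl _)
  · refine key (upper (-1) 0) g ?_
    rw [h, ← neg_zero, ← neg_unip_eq_upper, unip_zero]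
  · exact key (upper 1 1) g (by rw [← unip_eq_upper]; exact h)
  · exact key (upper 1 D.t) g (by rw [← unip_eq_upper]; exact h)
  · exact key (upper (-1) (-1)) g (by rw [← neg_unip_eq_upper]; exact h)
  · exact key (upper (-1) (-D.t)) g (by rw [← neg_unip_eq_upper]; exact h)
  · refine key (upper (D.lam ^ l) 0) g ?_
    rw [a_eq, diagSL_pow] at h
    exact h
  · rw [hX.apply_eq h, hY.apply_eq h]
    exact hf m h1 h2

lemma principal_reflect (hp : p ≠ 2) {i : ℕ} (hi : i ≤ p - 1) :
    D.principal (p - 1 - i) = D.principal i := by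
  have hN := two_mul_half (p := p) hp
  refine D.ext_of_res hp (D.isClassFun_principal _) (D.isClassFun_principal _) ?_ ?_
  · rw [D.res_principal hp (by omega), D.res_principal hp hi, Nat.sub_sub_self hi,
      D.chiSum_congr (k := p - 1 - i) (k' := i) (by omega), add_comm (D.chiLin (p - 1 - i))]
  · intro m h1 h2
    have hns := D.not_isSquare_disc_f_pow hp h1 h2
    rw [D.principal_of_nonsplit _ hns, D.principal_of_nonsplit _ hns]

lemma principal_half (hp : p ≠ 2) :
    D.principal (half p) = D.remainder 1 (half p) + D.remainder D.t (half p) := by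
  have hN := two_mul_half (p := p) hp
  have hpar : parity (half p) (half p) = 1 := if_pos rfl
  have hpar' : parity (half p) (half p + 1) = 0 := if_neg (by omega)
  refine D.ext_of_res hp (D.isClassFun_principal _)
    ((D.isVirtualChar_remainder hp D.isParam_one _).1.add
      (D.isVirtualChar_remainder hp D.isParam_t _).1) ?_ ?_
  · have h1 : res (U p) (D.remainder 1 (half p) + D.remainder D.t (half p)) =
        res (U p) (D.remainder 1 (half p)) + res (U p) (D.remainder D.t (half p)) := rfl
    rw [h1, D.res_remainder hp, D.res_remainder hp, D.res_principal hp (by omega), hpar, one_smul,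
      chiSum, show p - 1 - half p = half p by omega]
    abel
  · intro m h1 h2
    rw [D.principal_of_nonsplit _ (D.not_isSquare_disc_f_pow hp h1 h2), Pi.add_apply,
      D.remainder_f_pow hp _ _ h1 h2, D.remainder_f_pow hp _ _ h1 h2, hpar']
    ring

lemma remainder_congr (s : ZMod p) {k k' : ℕ} (h : k % 2 = k' % 2) (hp : p ≠ 2)
    (hs : D.IsParam s) : D.remainder s k = D.remainder s k' := by
  have hpar : ∀ i, parity k i = parity k' i := fun i => by unfold parity; rw [h]
  refine D.ext_of_res hp (D.isVirtualChar_remainder hp hs _).1 (D.isVirtualChar_remainder hp hs _).1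
    ?_ fun m h1 h2 => ?_
  · rw [D.res_remainder hp, D.res_remainder hp, D.chiInd_congr s h, hpar]
  · rw [D.remainder_f_pow hp _ _ h1 h2, D.remainder_f_pow hp _ _ h1 h2, hpar]

/-- The property of being one of the characters constructed above. -/
def IsListed (X : SL2 p → ℂ) : Prop :=
  X = 1 ∨ X = D.steinberg ∨ (∃ i, 1 ≤ i ∧ i < half p ∧ X = D.principal i) ∨
    (∃ j, 1 ≤ j ∧ j ≤ half p ∧ X = D.discrete j) ∨
    X = D.remainder 1 (half p) ∨ X = D.remainder D.t (half p) ∨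
    X = D.remainder 1 (half p + 1) ∨ X = D.remainder D.t (half p + 1)

theorem IsListed.isIrrChar (hp : p ≠ 2) {X : SL2 p → ℂ} (h : D.IsListed X) : IsIrrChar X := by
  rcases h with rfl | rfl | ⟨i, h1, h2, rfl⟩ | ⟨j, h1, h2, rfl⟩ | rfl | rfl | rfl | rfl
  · exact isIrrChar_one
  · exact D.isIrrChar_steinberg hp
  · exact D.isIrrChar_principal hp h1 h2
  · exact D.isIrrChar_discrete hp h1 h2
  · exact D.isIrrChar_remainder hp D.isParam_one _
  · exact D.isIrrChar_remainder hp D.isParam_t _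
  · exact D.isIrrChar_remainder hp D.isParam_one _
  · exact D.isIrrChar_remainder hp D.isParam_t _

lemma isListed_remainder (hp : p ≠ 2) {s : ZMod p} (hs : D.IsParam s) (k : ℕ) :
    D.IsListed (D.remainder s k) := by
  have h : k % 2 = half p % 2 ∨ k % 2 = (half p + 1) % 2 := by omega
  unfold IsListed
  rcases hs with rfl | rfl <;> rcases h with h | h
  · rw [D.remainder_congr 1 h hp D.isParam_one]; tauto
  · rw [D.remainder_congr 1 h hp D.isParam_one]; tauto
  · rw [D.remainder_congr D.t h hp D.isParam_t]; tauto
  · rw [D.remainder_congr D.t h hp D.isParam_t]; tauto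

/-- An irreducible character which is not listed is orthogonal to the principal series. -/
lemma charInner_principal_of_not_listed (hp : p ≠ 2) {X : SL2 p → ℂ} (hX : IsIrrChar X)
    (hl : ¬ D.IsListed X) {i : ℕ} (hi : i < p - 1) : charInner (D.principal i) X = 0 := by
  have hN := two_mul_half (p := p) hp
  have hpos := half_pos (p := p) hp
  have key : ∀ Y, D.IsListed Y → charInner Y X = 0 := fun Y hY =>
    (hY.isIrrChar D hp).charInner_ne hX (fun h => hl (h ▸ hY))
  have hsmall : ∀ i, i ≤ half p → charInner (D.principal i) X = 0 := by
    intro i hi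
    rcases Nat.eq_zero_or_pos i with rfl | h0
    · have h1 : D.principal 0 = D.steinberg + 1 := by rw [steinberg, sub_add_cancel]
      rw [h1, charInner_add_left, key _ (Or.inr (Or.inl rfl)), key _ (Or.inl rfl), add_zero]
    rcases Nat.lt_or_eq_of_le hi with h1 | rfl
    · exact key _ (Or.inr (Or.inr (Or.inl ⟨i, h0, h1, rfl⟩)))
    · rw [D.principal_half hp, charInner_add_left, key _ (D.isListed_remainder hp D.isParam_one _),
        key _ (D.isListed_remainder hp D.isParam_t _), add_zero]
  by_cases h : i ≤ half p
  · exact hsmall i h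
  · rw [← D.principal_reflect hp (by omega)]
    exact hsmall _ (by omega)

/-- An irreducible character which is not listed is orthogonal to the Gelfand-Graev characters. -/
lemma charInner_gelfandGraev_of_not_listed (hp : p ≠ 2) {X : SL2 p → ℂ} (hX : IsIrrChar X)
    (hl : ¬ D.IsListed X) {s : ZMod p} (hs : D.IsParam s) (k : ℕ) :
    charInner (D.gelfandGraev s k) X = 0 := by
  have key : ∀ Y, D.IsListed Y → charInner Y X = 0 := fun Y hY =>
    (hY.isIrrChar D hp).charInner_ne hX (fun h => hl (h ▸ hY))
  have h1 : D.gelfandGraev s k = D.remainder s k + D.commonPart k := by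
    rw [remainder, sub_add_cancel]
  rw [h1, charInner_add_left, key _ (D.isListed_remainder hp hs k), commonPart,
    charInner_add_left, charInner_add_left, charInner_sum_left, charInner_sum_left,
    Finset.sum_eq_zero, Finset.sum_eq_zero]
  · split_ifs
    · rw [key _ (Or.inr (Or.inl rfl))]
      norm_num
    · rw [charInner_zero_left]
      norm_num
  · intro j hj
    rw [mem_parityIco] at hj
    exact key _ (Or.inr (Or.inr (Or.inr (Or.inl ⟨j, by omega, by omega, rfl⟩))))
  · intro i hi
    rw [mem_parityIco] at hi
    exact key _ (Or.inr (Or.inr (Or.inl ⟨i, by omega, by omega, rfl⟩)))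

/-- The regular character of `U` in terms of its irreducible characters. -/
def regularU : U p → ℂ :=
  ∑ i ∈ Finset.range (p - 1), D.chiLin i +
    ((half p : ℂ) • (D.chiInd 1 0 + D.chiInd D.t 0) +
      (half p : ℂ) • (D.chiInd 1 1 + D.chiInd D.t 1))

open scoped Classical in
lemma regularU_apply (hp : p ≠ 2) (u : U p) :
    D.regularU u = if u = 1 then (Nat.card (U p) : ℂ) else 0 := by
  have h0 := D.regular_decomposition hp 0 u
  have h1 := D.regular_decomposition hp 1 u
  have hsum : ∀ i, parity 0 i + parity 1 i = 1 := fun i => by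
    unfold parity
    rcases Nat.mod_two_eq_zero_or_one i with h | h <;> rw [h] <;> norm_num
  have h2 : D.regularU u = (∑ i ∈ Finset.range (p - 1), parity 0 i * D.chiLin i u +
      half p * D.chiSum 0 u) + (∑ i ∈ Finset.range (p - 1), parity 1 i * D.chiLin i u +
      half p * D.chiSum 1 u) := by
    have h3 : ∑ i ∈ Finset.range (p - 1), D.chiLin i u =
        ∑ i ∈ Finset.range (p - 1), parity 0 i * D.chiLin i u +
          ∑ i ∈ Finset.range (p - 1), parity 1 i * D.chiLin i u := by
      rw [← Finset.sum_add_distrib]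
      refine Finset.sum_congr rfl fun i _ => ?_
      rw [← add_mul, hsum, one_mul]
    simp only [regularU, Pi.add_apply, Pi.smul_apply, smul_eq_mul, Finset.sum_apply, chiSum]
    rw [h3]
    ring
  rw [h2, h0, h1]
  have hone := SL2.one_entries (p := p)
  by_cases hu : topLeft u ^ 2 = 1 ∧ u.1.1 0 1 = 0
  · rw [if_pos hu, if_pos hu]
    rcases coe_eq_one_or_neg_one hu.1 hu.2 with ⟨h3, h4⟩ | ⟨h3, h4⟩
    · have h5 : u = 1 := Subtype.ext h4
      rw [if_pos h5, h3, map_one, card_U, ← two_mul_half hp]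
      push_cast
      ring
    · have h5 : u ≠ 1 := by
        rintro rfl
        rw [map_one] at h3
        exact unit_one_ne_neg_one hp h3
      rw [if_neg h5, h3, D.zhom_neg_one hp]
      ring
  · rw [if_neg hu, if_neg hu, if_neg, add_zero]
    rintro rfl
    exact hu ⟨by rw [map_one, one_pow], hone.2.1⟩

/-- Every irreducible character of `SL(2,p)` is listed: its restriction to `U` has a nonzero
inner product with the regular character of `U`. -/
theorem isIrrChar_iff_isListed (hp : p ≠ 2) (X : SL2 p → ℂ) : IsIrrChar X ↔ D.IsListed X := by
  classical
  refine ⟨fun hX => ?_, fun h => h.isIrrChar D hp⟩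
  by_contra hl
  have h1 : charInner D.regularU (res (U p) X) = 0 := by
    have hlin : ∀ i ∈ Finset.range (p - 1), charInner (D.chiLin i) (res (U p) X) = 0 := by
      intro i hi
      rw [← D.charInner_principal i hX.isClassFun]
      exact D.charInner_principal_of_not_listed hp hX hl (Finset.mem_range.1 hi)
    have hind : ∀ s, D.IsParam s → ∀ k, charInner (D.chiInd s k) (res (U p) X) = 0 := by
      intro s hs k
      rw [← D.charInner_gelfandGraev s k hX.isClassFun]
      exact D.charInner_gelfandGraev_of_not_listed hp hX hl hs k
    rw [regularU, charInner_add_left, charInner_add_left, charInner_sum_left,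
      Finset.sum_eq_zero hlin, charInner_smul_left, charInner_smul_left, charInner_add_left,
      charInner_add_left, hind _ D.isParam_one, hind _ D.isParam_t, hind _ D.isParam_one,
      hind _ D.isParam_t]
    norm_num
  obtain ⟨n, hn, hX1⟩ := hX.one_apply
  rw [charInner, Finset.sum_eq_single 1] at h1
  · rw [D.regularU_apply hp, if_pos rfl, inv_mul_cancel_left₀ card_ne_zero'] at h1
    have h2 : (starRingEnd ℂ) (X 1) = 0 := h1
    rw [hX1, map_natCast] at h2
    exact hn (by exact_mod_cast h2)
  · intro u _ hu
    rw [D.regularU_apply hp, if_neg hu, zero_mul]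
  · simp

end Choices

namespace Choices

variable {p : ℕ} [hpf : Fact p.Prime] (D : Choices p)

/-! ### The rows of the table -/

lemma chiLin_upper (k : ℕ) (μ : (ZMod p)ˣ) (x : ZMod p) :
    D.chiLin k (upper μ x) = D.zhom μ ^ k := by rw [chiLin_apply, topLeft_upper]

lemma chiInd_upper_one (hp : p ≠ 2) (s : ZMod p) (k : ℕ) (x : ZMod p) :
    D.chiInd s k (upper 1 x) = D.gaussPeriod (s * x) := by
  have w00 : (upper (1 : (ZMod p)ˣ) x).1.1 0 0 = 1 := rfl
  rw [D.chiInd_apply hp s k (by rw [topLeft_upper, one_pow]), topLeft_upper, map_one, one_pow,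
    one_mul, w00, one_mul, upper_entry]

lemma chiInd_upper_neg_one (hp : p ≠ 2) (s : ZMod p) (k : ℕ) (x : ZMod p) :
    D.chiInd s k (upper (-1) (-x)) = (-1) ^ k * D.gaussPeriod (s * x) := by
  have w00 : (upper (-1 : (ZMod p)ˣ) (-x)).1.1 0 0 = -1 := by
    rw [entry_zero_zero, topLeft_upper, Units.val_neg, Units.val_one]
  rw [D.chiInd_apply hp s k (by rw [topLeft_upper, neg_one_sq]), topLeft_upper,
    D.zhom_neg_one hp, w00, upper_entry, neg_mul_neg, one_mul]

lemma lam_pow_sq_ne {l : ℕ} (h1 : 1 ≤ l) (h2 : l ≤ (p - 3) / 2) : (D.lam ^ l) ^ 2 ≠ 1 := by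
  rw [← pow_mul, Ne, ← orderOf_dvd_iff_pow_eq_one, orderOf_lam]
  intro h
  have := Nat.le_of_dvd (by omega) h
  omega

lemma chiInd_upper_split (s : ZMod p) (k : ℕ) {l : ℕ} (h1 : 1 ≤ l) (h2 : l ≤ (p - 3) / 2) :
    D.chiInd s k (upper (D.lam ^ l) 0) = 0 :=
  D.chiInd_apply_of_ne s k (by rw [topLeft_upper]; exact D.lam_pow_sq_ne h1 h2)

lemma gaussPeriod_one_mul_one : D.gaussPeriod (1 * 1) = D.Z := by rw [one_mul, Z]

lemma gaussPeriod_one_mul_t : D.gaussPeriod (1 * D.t) = D.Zt := by rw [one_mul, Zt]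

lemma gaussPeriod_t_mul_one : D.gaussPeriod (D.t * 1) = D.Zt := by rw [mul_one, Zt]

lemma gaussPeriod_t_mul_t (hp : p ≠ 2) : D.gaussPeriod (D.t * D.t) = D.Z := by
  have h := D.gaussPeriod_mul_sq hp 1 (Units.mk0 D.t D.t_ne_zero)
  rwa [Units.val_mk0, one_mul, sq] at h

lemma Z_add_Zt (hp : p ≠ 2) : D.Z + D.Zt = -1 := by
  have h := D.gaussPeriod_add hp one_ne_zero
  rwa [mul_one] at h

/-- A class function is given by a row of the table as soon as its restriction to `U` and its
values on the nonsplit torus agree with that row. -/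
theorem eq_ofRow_of_res (hp : p ≠ 2) {X : SL2 p → ℂ} (hX : IsClassFun X) (r : Row)
    (ρ : U p → ℂ) (hρ : res (U p) X = ρ) (h1 : ρ (upper 1 0) = r.one)
    (hn1 : ρ (upper (-1) (-0)) = r.negOne) (hb : ρ (upper 1 1) = r.b)
    (hd : ρ (upper 1 D.t) = r.d) (hnb : ρ (upper (-1) (-1)) = r.negB)
    (hnd : ρ (upper (-1) (-D.t)) = r.negD)
    (ha : ∀ l, 1 ≤ l → l ≤ (p - 3) / 2 → ρ (upper (D.lam ^ l) 0) = r.a l)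
    (hf : ∀ m, 1 ≤ m → m ≤ (p - 1) / 2 → X (D.f ^ m) = r.f m) : X = D.ofRow r := by
  subst hρ
  refine D.eq_ofRow hp hX r ?_ ?_ ?_ ?_ ?_ ?_ ?_ hf
  · rw [← h1, res, ← unip_eq_upper, unip_zero]
  · rw [← hn1, res, ← neg_unip_eq_upper, unip_zero]
  · rw [← hb, res, ← unip_eq_upper, b_eq]
  · rw [← hd, res, ← unip_eq_upper, d_eq]
  · rw [← hnb, res, ← neg_unip_eq_upper, b_eq]
  · rw [← hnd, res, ← neg_unip_eq_upper, d_eq]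
  · intro l h2 h3
    rw [← ha l h2 h3, res, a_eq, diagSL_pow]
    rfl

lemma isClassFun_steinberg : IsClassFun D.steinberg := D.isVirtualChar_steinberg.1

theorem steinberg_eq_phi (hp : p ≠ 2) : D.steinberg = D.phi := by
  have hc := half_cast (p := p) hp
  have hZ := D.Z_add_Zt hp
  refine D.eq_ofRow_of_res hp D.isClassFun_steinberg _ _ (D.res_steinberg hp) ?_ ?_ ?_ ?_ ?_ ?_
    (fun l h1 h2 => ?_)
    (fun m h1 h2 => D.steinberg_of_nonsplit (D.not_isSquare_disc_f_pow hp h1 h2))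
  all_goals simp only [chiSum, Pi.add_apply, Pi.one_apply, D.chiInd_upper_one hp,
    D.chiInd_upper_neg_one hp, gaussPeriod_one_mul_one, gaussPeriod_one_mul_t,
    gaussPeriod_t_mul_one, D.gaussPeriod_t_mul_t hp, mul_zero, gaussPeriod_zero, pow_zero]
  · linear_combination hc
  · linear_combination hc
  · linear_combination hZ
  · linear_combination hZ
  · linear_combination hZ
  · linear_combination hZ
  · rw [D.chiInd_upper_split _ _ h1 h2, D.chiInd_upper_split _ _ h1 h2]
    ring

theorem principal_eq_chi (hp : p ≠ 2) {i : ℕ} (hi : i ≤ p - 1) : D.principal i = D.chi i := by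
  have hc := half_cast (p := p) hp
  have hZ := D.Z_add_Zt hp
  have hs : ((-1 : ℂ) ^ i)⁻¹ = (-1) ^ i := by rw [← inv_pow, inv_neg_one]
  refine D.eq_ofRow_of_res hp (D.isClassFun_principal i) _ _ (D.res_principal hp hi)
    ?_ ?_ ?_ ?_ ?_ ?_ (fun l h1 h2 => ?_)
    (fun m h1 h2 => D.principal_of_nonsplit i (D.not_isSquare_disc_f_pow hp h1 h2))
  all_goals simp only [chiSum, Pi.add_apply, D.chiInd_upper_one hp, D.chiLin_reflect_apply hi,
    chiLin_upper, topLeft_upper, D.zhom_neg_one hp, hs, map_one, one_pow, inv_one,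
    D.chiInd_upper_neg_one hp, gaussPeriod_one_mul_one, gaussPeriod_one_mul_t,
    gaussPeriod_t_mul_one, D.gaussPeriod_t_mul_t hp, mul_zero, gaussPeriod_zero]
  · linear_combination hc
  · linear_combination (-1) ^ i * hc
  · linear_combination hZ
  · linear_combination hZ
  · linear_combination (-1) ^ i * hZ
  · linear_combination (-1) ^ i * hZ
  · rw [D.chiInd_upper_split _ _ h1 h2, D.chiInd_upper_split _ _ h1 h2, map_pow, zhom_lam,
      ← pow_mul, mul_comm l i]
    ring

theorem discrete_eq_theta (hp : p ≠ 2) (j : ℕ) : D.discrete j = D.theta j := by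
  have hc := half_cast (p := p) hp
  have hZ := D.Z_add_Zt hp
  refine D.eq_ofRow_of_res hp (D.isVirtualChar_discrete hp j).1 _ _ (D.res_discrete hp j)
    ?_ ?_ ?_ ?_ ?_ ?_ (fun l h1 h2 => ?_) (fun m h1 h2 => D.discrete_f_pow hp j h1 h2)
  all_goals simp only [chiSum, Pi.add_apply, D.chiInd_upper_one hp,
    D.chiInd_upper_neg_one hp, gaussPeriod_one_mul_one, gaussPeriod_one_mul_t,
    gaussPeriod_t_mul_one, D.gaussPeriod_t_mul_t hp, mul_zero, gaussPeriod_zero]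
  · linear_combination hc
  · linear_combination (-1) ^ j * hc
  · linear_combination hZ
  · linear_combination hZ
  · linear_combination (-1) ^ j * hZ
  · linear_combination (-1) ^ j * hZ
  · rw [D.chiInd_upper_split _ _ h1 h2, D.chiInd_upper_split _ _ h1 h2, add_zero]

lemma zhom_lam_pow_half (hp : p ≠ 2) (l : ℕ) : D.zhom (D.lam ^ l) ^ half p = (-1) ^ l := by
  rw [← map_pow, ← pow_mul, mul_comm, pow_mul, D.lam_pow_half hp, map_pow, D.zhom_neg_one hp]

/-- The row of an exceptional character whose restriction to `U` contains `chiLin (half p)`. -/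
theorem remainder_eq_ofRow_xi (hp : p ≠ 2) {s : ZMod p} (hs : D.IsParam s) {e : ℂ}
    (he : (-1) ^ half p = e) : D.remainder s (half p) = D.ofRow
      { one := (p + 1) / 2, negOne := e * ((p + 1) / 2),
        b := 1 + D.gaussPeriod (s * 1), d := 1 + D.gaussPeriod (s * D.t),
        negB := e * (1 + D.gaussPeriod (s * 1)), negD := e * (1 + D.gaussPeriod (s * D.t)),
        a := fun l => (-1) ^ l, f := fun _ => 0 } := by
  have hc := half_cast (p := p) hp
  have hpar : parity (half p) (half p) = 1 := if_pos rfl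
  have hpar' : parity (half p) (half p + 1) = 0 := if_neg (by omega)
  refine D.eq_ofRow_of_res hp (D.isVirtualChar_remainder hp hs _).1 _ _ (D.res_remainder hp s _)
    ?_ ?_ ?_ ?_ ?_ ?_ (fun l h1 h2 => ?_)
    (fun m h1 h2 => by rw [D.remainder_f_pow hp s _ h1 h2, hpar', zero_mul])
  all_goals simp only [Pi.add_apply, Pi.smul_apply, smul_eq_mul, hpar, one_mul, chiLin_upper,
    D.chiInd_upper_one hp, D.chiInd_upper_neg_one hp, D.zhom_neg_one hp, map_one, one_pow, mul_zero,
    gaussPeriod_zero, he]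
  · linear_combination hc / 2
  · linear_combination e * hc / 2
  · ring
  · ring
  · ring
  · ring
  · rw [D.chiInd_upper_split _ _ h1 h2, zero_add, D.zhom_lam_pow_half hp]

/-- The row of an exceptional character whose restriction to `U` is irreducible. -/
theorem remainder_eq_ofRow_eta (hp : p ≠ 2) {s : ZMod p} (hs : D.IsParam s) {e : ℂ}
    (he : (-1) ^ (half p + 1) = e) : D.remainder s (half p + 1) = D.ofRow
      { one := (p - 1) / 2, negOne := e * ((p - 1) / 2),
        b := D.gaussPeriod (s * 1), d := D.gaussPeriod (s * D.t),
        negB := e * D.gaussPeriod (s * 1), negD := e * D.gaussPeriod (s * D.t),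
        a := fun _ => 0, f := fun m => (-1) ^ (m + 1) } := by
  have hc := half_cast (p := p) hp
  have hpar : parity (half p + 1) (half p) = 0 := if_neg (by omega)
  have hpar' : parity (half p + 1) (half p + 1) = 1 := if_pos rfl
  refine D.eq_ofRow_of_res hp (D.isVirtualChar_remainder hp hs _).1 _ _ (D.res_remainder hp s _)
    ?_ ?_ ?_ ?_ ?_ ?_ (fun l h1 h2 => ?_)
    (fun m h1 h2 => by rw [D.remainder_f_pow hp s _ h1 h2, hpar', one_mul])
  all_goals simp only [Pi.add_apply, Pi.smul_apply, smul_eq_mul, hpar, zero_mul, add_zero,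
    D.chiInd_upper_one hp, D.chiInd_upper_neg_one hp, mul_zero, gaussPeriod_zero, he]
  · linear_combination hc / 2
  · linear_combination e * hc / 2
  · rw [D.chiInd_upper_split _ _ h1 h2]

omit hpf in
lemma half_mod_two_of_one (h : p % 4 = 1) : half p % 2 = 0 := by unfold half; omega

omit hpf in
lemma half_mod_two_of_three (h : p % 4 = 3) : half p % 2 = 1 := by unfold half; omega

/-- The exceptional characters for `p ≡ 1 mod 4`. -/
theorem remainder_eq_of_one (hp : p ≠ 2) (h : p % 4 = 1) :
    D.remainder 1 (half p) = D.xi1 ∧ D.remainder D.t (half p) = D.xi2 ∧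
      D.remainder 1 (half p + 1) = D.eta1 ∧ D.remainder D.t (half p + 1) = D.eta2 := by
  have hh := half_mod_two_of_one h
  have hx : (-1 : ℂ) ^ half p = 1 := (Nat.even_iff.2 hh).neg_one_pow
  have he : (-1 : ℂ) ^ (half p + 1) = -1 := by rw [pow_succ, hx, one_mul]
  have h1 : 1 + D.Z = -D.Zt := by linear_combination D.Z_add_Zt hp
  have h2 : 1 + D.Zt = -D.Z := by linear_combination D.Z_add_Zt hp
  rw [D.remainder_eq_ofRow_xi hp D.isParam_one hx, D.remainder_eq_ofRow_xi hp D.isParam_t hx,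
    D.remainder_eq_ofRow_eta hp D.isParam_one he, D.remainder_eq_ofRow_eta hp D.isParam_t he]
  simp only [gaussPeriod_one_mul_one, gaussPeriod_one_mul_t, gaussPeriod_t_mul_one,
    D.gaussPeriod_t_mul_t hp]
  simp only [h1, h2, one_mul, neg_one_mul]
  exact ⟨rfl, rfl, rfl, rfl⟩

/-- The exceptional characters for `p ≡ 3 mod 4`. -/
theorem remainder_eq_of_three (hp : p ≠ 2) (h : p % 4 = 3) :
    D.remainder 1 (half p) = D.xi1' ∧ D.remainder D.t (half p) = D.xi2' ∧
      D.remainder 1 (half p + 1) = D.eta1' ∧ D.remainder D.t (half p + 1) = D.eta2' := by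
  have hh := half_mod_two_of_three h
  have hx : (-1 : ℂ) ^ half p = -1 := (Nat.odd_iff.2 hh).neg_one_pow
  have he : (-1 : ℂ) ^ (half p + 1) = 1 := by rw [pow_succ, hx, neg_one_mul, neg_neg]
  have h1 : 1 + D.Z = -D.Zt := by linear_combination D.Z_add_Zt hp
  have h2 : 1 + D.Zt = -D.Z := by linear_combination D.Z_add_Zt hp
  rw [D.remainder_eq_ofRow_xi hp D.isParam_one hx, D.remainder_eq_ofRow_xi hp D.isParam_t hx,
    D.remainder_eq_ofRow_eta hp D.isParam_one he, D.remainder_eq_ofRow_eta hp D.isParam_t he]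
  simp only [gaussPeriod_one_mul_one, gaussPeriod_one_mul_t, gaussPeriod_t_mul_one,
    D.gaussPeriod_t_mul_t hp]
  simp only [h1, h2, one_mul, neg_one_mul, neg_neg]
  exact ⟨rfl, rfl, rfl, rfl⟩

/-- The list of irreducible characters, in terms of the table. -/
lemma isListed_iff (hp : p ≠ 2) (X : SL2 p → ℂ) : D.IsListed X ↔
    X = 1 ∨ X = D.phi ∨ (∃ i, 1 ≤ i ∧ i ≤ (p - 3) / 2 ∧ X = D.chi i) ∨
      (∃ j, 1 ≤ j ∧ j ≤ (p - 1) / 2 ∧ X = D.theta j) ∨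
      X = D.remainder 1 (half p) ∨ X = D.remainder D.t (half p) ∨
      X = D.remainder 1 (half p + 1) ∨ X = D.remainder D.t (half p + 1) := by
  have hchi : (∃ i, 1 ≤ i ∧ i < half p ∧ X = D.principal i) ↔
      ∃ i, 1 ≤ i ∧ i ≤ (p - 3) / 2 ∧ X = D.chi i := by
    refine exists_congr fun i => and_congr_right fun h1 => ?_
    have hi : i < half p ↔ i ≤ (p - 3) / 2 := by unfold half; omega
    rw [hi]
    refine and_congr_right fun h2 => ?_
    rw [D.principal_eq_chi hp (by omega)]
  simp only [IsListed, D.steinberg_eq_phi hp, D.discrete_eq_theta hp, hchi]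
  rfl

/-! ### The restrictions are multiplicity free -/

lemma chiInd_one_ne_chiInd_t (hp : p ≠ 2) (k k' : ℕ) : D.chiInd 1 k ≠ D.chiInd D.t k' := by
  classical
  intro h
  have h1 := D.charInner_chiInd hp D.isParam_one D.isParam_t k k'
  rw [if_neg fun hc => D.one_ne_t hc.1, ← h,
    (D.isIrrChar_chiInd hp D.isParam_one k).charInner_self] at h1
  exact one_ne_zero h1

lemma chiInd_ne_of_parity (hp : p ≠ 2) {s : ZMod p} (hs : D.IsParam s) {k k' : ℕ}
    (hk : k % 2 ≠ k' % 2) : D.chiInd s k ≠ D.chiInd s k' := by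
  classical
  intro h
  have h1 := D.charInner_chiInd hp hs hs k k'
  rw [if_neg fun hc => hk hc.2, ← h, (D.isIrrChar_chiInd hp hs k).charInner_self] at h1
  exact one_ne_zero h1

lemma chiInd_ne_one (hp : p ≠ 2) {s : ZMod p} (hs : D.IsParam s) (k : ℕ) : D.chiInd s k ≠ 1 := by
  rw [← chiLin_zero]
  exact D.chiInd_ne_chiLin hp hs k 0

open scoped Classical in
lemma charInner_list_sum {G : Type} [Group G] [Fintype G] {L : List (G → ℂ)} (hL : L.Nodup)
    (hirr : ∀ X ∈ L, IsIrrChar X) {ψ : G → ℂ} (hψ : IsIrrChar ψ) :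
    charInner L.sum ψ = if ψ ∈ L then 1 else 0 := by
  induction L with
  | nil => simp [charInner_zero_left]
  | cons X L ih =>
    rw [List.nodup_cons] at hL
    rw [List.sum_cons, charInner_add_left,
      ih hL.2 fun Y hY => hirr Y (List.mem_cons_of_mem _ hY),
      (hirr X List.mem_cons_self).charInner_eq hψ]
    by_cases h : X = ψ
    · subst h
      simp [hL.1]
    · simp [h, Ne.symm h]

/-- The restriction to `U` of every irreducible character of `SL(2,p)` is a sum of distinct
irreducible characters. -/
theorem exists_list_of_isListed (hp : p ≠ 2) {X : SL2 p → ℂ} (hX : D.IsListed X) :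
    ∃ L : List (U p → ℂ), L.Nodup ∧ (∀ Y ∈ L, IsIrrChar Y) ∧ res (U p) X = L.sum := by
  have hN := two_mul_half (p := p) hp
  have hpos := half_pos (p := p) hp
  have i1 := fun k => D.isIrrChar_chiInd hp D.isParam_one k
  have it := fun k => D.isIrrChar_chiInd hp D.isParam_t k
  have il := fun k => D.isIrrChar_chiLin k
  have hirr : IsIrrChar (1 : U p → ℂ) := isIrrChar_one
  have nl : ∀ s, D.IsParam s → ∀ k j, D.chiLin j ≠ D.chiInd s k := fun s hs k j =>
    (D.chiInd_ne_chiLin hp hs k j).symm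
  have n1 : ∀ s, D.IsParam s → ∀ k, 1 ≠ D.chiInd s k := fun s hs k =>
    (D.chiInd_ne_one hp hs k).symm
  have hrem : ∀ s, D.IsParam s → ∀ k, ∃ L : List (U p → ℂ), L.Nodup ∧ (∀ Y ∈ L, IsIrrChar Y) ∧
      res (U p) (D.remainder s k) = L.sum := by
    intro s hs k
    rw [D.res_remainder hp, parity]
    split_ifs
    · refine ⟨[D.chiInd s k, D.chiLin (half p)], ?_, ?_, ?_⟩
      · simp [D.chiInd_ne_chiLin hp hs]
      · simp [D.isIrrChar_chiInd hp hs, il]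
      · simp
    · refine ⟨[D.chiInd s k], ?_, ?_, ?_⟩
      · simp
      · simp [D.isIrrChar_chiInd hp hs]
      · simp
  rcases hX with rfl | rfl | ⟨i, h1, h2, rfl⟩ | ⟨j, h1, h2, rfl⟩ | rfl | rfl | rfl | rfl
  · exact ⟨[1], by simp, by simpa using hirr, by rw [res_one]; simp⟩
  · refine ⟨[1, D.chiInd 1 0, D.chiInd D.t 0], ?_, ?_, ?_⟩
    · simp [n1 _ D.isParam_one, n1 _ D.isParam_t, D.chiInd_one_ne_chiInd_t hp]
    · simp [hirr, i1, it]
    · rw [D.res_steinberg hp, chiSum]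
      simp
  · refine ⟨[D.chiLin i, D.chiLin (p - 1 - i), D.chiInd 1 i, D.chiInd D.t i], ?_, ?_, ?_⟩
    · have : D.chiLin i ≠ D.chiLin (p - 1 - i) := fun h => by
        have := D.chiLin_inj (by omega) (by omega) h
        omega
      simp [nl _ D.isParam_one, nl _ D.isParam_t, D.chiInd_one_ne_chiInd_t hp, this]
    · simp [i1, it, il]
    · rw [D.res_principal hp (by omega), chiSum]
      simp [add_assoc]
  · refine ⟨[D.chiInd 1 j, D.chiInd D.t j], ?_, ?_, ?_⟩
    · simp [D.chiInd_one_ne_chiInd_t hp]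
    · simp [i1, it]
    · rw [D.res_discrete hp, chiSum]
      simp
  · exact hrem _ D.isParam_one _
  · exact hrem _ D.isParam_t _
  · exact hrem _ D.isParam_one _
  · exact hrem _ D.isParam_t _

include D in
theorem isStrongGelfandPair (hp : p ≠ 2) : IsStrongGelfandPair (U p) := by
  classical
  intro X ψ hX hψ
  obtain ⟨L, h1, h2, h3⟩ := D.exists_list_of_isListed hp ((D.isIrrChar_iff_isListed hp X).1 hX)
  rw [charInner_induced_right _ _ hX.isClassFun, h3, charInner_list_sum h1 h2 hψ]
  split_ifs
  · exact le_rfl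
  · exact zero_le_one

/-! ### Existence of the choices -/

/-- A generator of the norm one group of the field with `p ^ 2` elements, acting on that field by
multiplication, is an element of `SL(2,p)` of order `p + 1`. -/
lemma exists_orderOf_eq_succ (p : ℕ) [Fact p.Prime] : ∃ f : SL2 p, orderOf f = p + 1 := by
  have hp2 := (Fact.out : p.Prime).two_le
  have : Finite (GaloisField p 2) := Nat.finite_of_card_ne_zero (by
    rw [GaloisField.card p 2 two_ne_zero]
    positivity)
  have := Fintype.ofFinite (GaloisField p 2)
  obtain ⟨g, hg⟩ := IsCyclic.exists_generator (α := (GaloisField p 2)ˣ)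
  have hcard : Nat.card (GaloisField p 2)ˣ = (p - 1) * (p + 1) := by
    rw [Nat.card_units, GaloisField.card p 2 two_ne_zero, ← one_pow 2, Nat.sq_sub_sq, mul_comm,
      one_pow]
  have hord : orderOf g = (p - 1) * (p + 1) := by
    rw [orderOf_eq_card_of_forall_mem_zpowers hg, hcard]
  let x : GaloisField p 2 := ((g ^ (p - 1) : (GaloisField p 2)ˣ) : GaloisField p 2)
  have hx : orderOf x = p + 1 := by
    rw [orderOf_units, orderOf_pow_of_dvd (by omega) ⟨p + 1, hord⟩, hord,
      Nat.mul_div_cancel_left _ (by omega)]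
  have hnorm : Algebra.norm (ZMod p) x = 1 := by
    apply (algebraMap (ZMod p) (GaloisField p 2)).injective
    rw [FiniteField.algebraMap_norm_eq_pow, map_one, ← orderOf_dvd_iff_pow_eq_one, hx,
      GaloisField.card p 2 two_ne_zero, Nat.card_zmod, ← one_pow 2, Nat.sq_sub_sq, one_pow,
      Nat.mul_div_cancel _ (by omega)]
  let b := Module.finBasisOfFinrankEq (ZMod p) (GaloisField p 2) (GaloisField.finrank p two_ne_zero)
  let f : SL2 p := ⟨Algebra.leftMulMatrix b x, by rw [← Algebra.norm_eq_matrix_det, hnorm]⟩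
  refine ⟨f, ?_⟩
  rw [← hx, orderOf_eq_orderOf_iff]
  intro n
  rw [← (Algebra.leftMulMatrix_injective b).eq_iff, map_pow, map_one]
  exact Subtype.ext_iff

lemma nonempty (p : ℕ) [Fact p.Prime] (hp : p ≠ 2) : Nonempty (Choices p) := by
  have hp2 := (Fact.out : p.Prime).two_le
  obtain ⟨lam, hlam⟩ := IsCyclic.exists_generator (α := (ZMod p)ˣ)
  obtain ⟨t, ht⟩ := FiniteField.exists_nonsquare (F := ZMod p) (by rwa [ZMod.ringChar_zmod_n])
  obtain ⟨f, hf⟩ := exists_orderOf_eq_succ p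
  exact ⟨{
    lam := lam
    lam_generates := hlam
    t := t
    t_nonsquare := ht
    f := f
    f_order := hf
    zeta := _
    zeta_primitive := Complex.isPrimitiveRoot_exp (p - 1) (by omega)
    sigma := _
    sigma_primitive := Complex.isPrimitiveRoot_exp (p + 1) (by omega)
    eta := _
    eta_primitive := Complex.isPrimitiveRoot_exp p (by omega) }⟩

end Choices

end StrongGelfand

end

open StrongGelfand in
theorem proposition1 (p : ℕ) [Fact p.Prime] (hp : p ≠ 2) :
    (∀ D : Choices p,
      -- the complete list of irreducible characters of `SL(2,p)`
      (p % 4 = 1 → ∀ X : SL2 p → ℂ, IsIrrChar X ↔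
        X = 1 ∨ X = D.phi ∨ (∃ i, 1 ≤ i ∧ i ≤ (p - 3) / 2 ∧ X = D.chi i) ∨
          (∃ j, 1 ≤ j ∧ j ≤ (p - 1) / 2 ∧ X = D.theta j) ∨
          X = D.xi1 ∨ X = D.xi2 ∨ X = D.eta1 ∨ X = D.eta2) ∧
      (p % 4 = 3 → ∀ X : SL2 p → ℂ, IsIrrChar X ↔
        X = 1 ∨ X = D.phi ∨ (∃ i, 1 ≤ i ∧ i ≤ (p - 3) / 2 ∧ X = D.chi i) ∨
          (∃ j, 1 ≤ j ∧ j ≤ (p - 1) / 2 ∧ X = D.theta j) ∨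
          X = D.xi1' ∨ X = D.xi2' ∨ X = D.eta1' ∨ X = D.eta2') ∧
      -- the characters of `U` below are irreducible and pairwise distinct
      (IsIrrChar (1 : U p → ℂ) ∧ (∀ k, 1 ≤ k → k ≤ p - 2 → IsIrrChar (D.chiLin k)) ∧
        IsIrrChar (D.chiOne 1) ∧ IsIrrChar (D.chiOne 2) ∧
        IsIrrChar (D.chiTwo 1) ∧ IsIrrChar (D.chiTwo 2)) ∧
      ((∀ k, 1 ≤ k → k ≤ p - 2 → D.chiLin k ≠ 1) ∧
        (∀ k k', 1 ≤ k → k < k' → k' ≤ p - 2 → D.chiLin k ≠ D.chiLin k') ∧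
        (∀ X ∈ [D.chiOne 1, D.chiOne 2, D.chiTwo 1, D.chiTwo 2],
          X ≠ 1 ∧ ∀ k, 1 ≤ k → k ≤ p - 2 → X ≠ D.chiLin k) ∧
        [D.chiOne 1, D.chiOne 2, D.chiTwo 1, D.chiTwo 2].Nodup) ∧
      -- the decompositions
      res (U p) 1 = 1 ∧
      res (U p) D.phi = 1 + D.chiOne 2 + D.chiTwo 2 ∧
      (∀ i, 1 ≤ i → i ≤ (p - 3) / 2 → Odd i →
        res (U p) (D.chi i) =
          D.chiLin i + D.chiLin (p - 1 - i) + D.chiOne 1 + D.chiTwo 1) ∧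
      (∀ i, 1 ≤ i → i ≤ (p - 3) / 2 → Even i →
        res (U p) (D.chi i) =
          D.chiLin i + D.chiLin (p - 1 - i) + D.chiOne 2 + D.chiTwo 2) ∧
      (∀ j, 1 ≤ j → j ≤ (p - 1) / 2 → Odd j →
        res (U p) (D.theta j) = D.chiOne 1 + D.chiTwo 1) ∧
      (∀ j, 1 ≤ j → j ≤ (p - 1) / 2 → Even j →
        res (U p) (D.theta j) = D.chiOne 2 + D.chiTwo 2) ∧
      (p % 4 = 1 →
        res (U p) D.xi1 = D.chiLin ((p - 1) / 2) + D.chiOne 2 ∧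
        res (U p) D.xi2 = D.chiLin ((p - 1) / 2) + D.chiTwo 2 ∧
        res (U p) D.eta1 = D.chiOne 1 ∧
        res (U p) D.eta2 = D.chiTwo 1) ∧
      (p % 4 = 3 →
        res (U p) D.xi1' = D.chiLin ((p - 1) / 2) + D.chiOne 1 ∧
        res (U p) D.xi2' = D.chiLin ((p - 1) / 2) + D.chiTwo 1 ∧
        res (U p) D.eta1' = D.chiOne 2 ∧
        res (U p) D.eta2' = D.chiTwo 2)) ∧
    IsStrongGelfandPair (U p)
 := by
  refine ⟨fun D => ?_, ?_⟩
  · have hN := Choices.two_mul_half (p := p) hp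
    have hp2 := (Fact.out : p.Prime).two_le
    have i1 := fun k => D.isIrrChar_chiInd hp D.isParam_one k
    have it := fun k => D.isIrrChar_chiInd hp D.isParam_t k
    have hres : ∀ {i k : ℕ}, i % 2 = k % 2 → D.chiSum i = D.chiOne k + D.chiTwo k :=
      fun h => D.chiSum_congr h
    have hrx : ∀ s k, Choices.half p % 2 = k % 2 →
        res (U p) (D.remainder s (Choices.half p)) =
          D.chiLin ((p - 1) / 2) + D.chiInd s k := by
      intro s k h
      rw [D.res_remainder hp, show parity (Choices.half p) (Choices.half p) = 1 from if_pos rfl,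
        one_smul, add_comm, D.chiInd_congr s h]
      rfl
    have hre : ∀ s k, (Choices.half p + 1) % 2 = k % 2 →
        res (U p) (D.remainder s (Choices.half p + 1)) = D.chiInd s k := by
      intro s k h
      rw [D.res_remainder hp,
        show parity (Choices.half p + 1) (Choices.half p) = 0 from if_neg (by omega),
        zero_smul, add_zero, D.chiInd_congr s h]
    have h12 : ∀ s, D.IsParam s → D.chiInd s 1 ≠ D.chiInd s 2 := fun s hs =>
      D.chiInd_ne_of_parity hp hs (by norm_num)
    refine ⟨fun h X => ?_, fun h X => ?_, ⟨Choices.isIrrChar_one, fun k _ _ => D.isIrrChar_chiLin k,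
      i1 1, i1 2, it 1, it 2⟩, ⟨fun k h1 h2 h => ?_, fun k k' h1 h2 h3 h => ?_,
      fun X hX => ?_, ?_⟩, rfl, ?_, fun i h1 h2 h => ?_, fun i h1 h2 h => ?_,
      fun j h1 h2 h => ?_, fun j h1 h2 h => ?_, fun h => ?_, fun h => ?_⟩
    · obtain ⟨e1, e2, e3, e4⟩ := D.remainder_eq_of_one hp h
      rw [D.isIrrChar_iff_isListed hp, D.isListed_iff hp, e1, e2, e3, e4]
    · obtain ⟨e1, e2, e3, e4⟩ := D.remainder_eq_of_three hp h
      rw [D.isIrrChar_iff_isListed hp, D.isListed_iff hp, e1, e2, e3, e4]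
    · rw [← D.chiLin_zero] at h
      have := D.chiLin_inj (by omega) (by omega) h
      omega
    · have := D.chiLin_inj (by omega) (by omega) h
      omega
    · have hmem : ∃ s k, D.IsParam s ∧ X = D.chiInd s k := by
        simp only [List.mem_cons, List.not_mem_nil, or_false] at hX
        rcases hX with rfl | rfl | rfl | rfl
        exacts [⟨1, 1, D.isParam_one, rfl⟩, ⟨1, 2, D.isParam_one, rfl⟩,
          ⟨D.t, 1, D.isParam_t, rfl⟩, ⟨D.t, 2, D.isParam_t, rfl⟩]
      obtain ⟨s, k, hs, rfl⟩ := hmem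
      exact ⟨D.chiInd_ne_one hp hs k, fun j _ _ => D.chiInd_ne_chiLin hp hs k j⟩
    · simp [Choices.chiOne, Choices.chiTwo, D.chiInd_one_ne_chiInd_t hp, h12 _ D.isParam_one,
        h12 _ D.isParam_t]
    · rw [← D.steinberg_eq_phi hp, D.res_steinberg hp, hres (i := 0) (k := 2) rfl, add_assoc]
    · rw [← D.principal_eq_chi hp (by omega), D.res_principal hp (by omega),
        hres (k := 1) (Nat.odd_iff.1 h), ← add_assoc]
    · rw [← D.principal_eq_chi hp (by omega), D.res_principal hp (by omega),
        hres (k := 2) (Nat.even_iff.1 h), ← add_assoc]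
    · rw [← D.discrete_eq_theta hp, D.res_discrete hp, hres (k := 1) (Nat.odd_iff.1 h)]
    · rw [← D.discrete_eq_theta hp, D.res_discrete hp, hres (k := 2) (Nat.even_iff.1 h)]
    · obtain ⟨e1, e2, e3, e4⟩ := D.remainder_eq_of_one hp h
      have hh := Choices.half_mod_two_of_one h
      rw [← e1, ← e2, ← e3, ← e4]
      exact ⟨hrx _ _ (by omega), hrx _ _ (by omega), hre _ _ (by omega), hre _ _ (by omega)⟩
    · obtain ⟨e1, e2, e3, e4⟩ := D.remainder_eq_of_three hp h
      have hh := Choices.half_mod_two_of_three h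
      rw [← e1, ← e2, ← e3, ← e4]
      exact ⟨hrx _ _ (by omega), hrx _ _ (by omega), hre _ _ (by omega), hre _ _ (by omega)⟩
  · obtain ⟨D⟩ := Choices.nonempty p hp
    exact D.isStrongGelfandPair hp
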